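/- **Formulas and linear systems.** Formulas are generated from propositional variables $a\in\mathcal A$ by $A,B::=a\mid a^\bot\mid A⅋B\mid A\otimes B\mid\,!A\mid\,?A\mid\bot\mid 1\mid\circ$, where $\circ$ is a constant called the *jump placeholder*; a sequent is a non-empty finite multiset of formulas. Consider the rules * $\mathsf{ax}$: conclude $a,a^\bot$; $\ \mathsf{ax}_j$: conclude $a,a^\bot,\circ,\dots,\circ$ ($n\ge0$ copies of $\circ$); $\ 1_j$: conclude $1,\circ,\dots,\circ$ ($n\ge 0$ copies); * $⅋$: from $\Gamma,A,B$ conclude $\Gamma,A⅋B$; $\ \otimes$: from $\Gamma,A$ and $B,\Delta$ conclude $\Gamma,A\otimes B,\Delta$; * weak promotion $\mathsf{w!p}$: from $A,\Gamma$ conclude $!A,?\Gamma$. Put $\mathsf{MLL}^\ell=\{\mathsf{ax},\otimes,⅋\}$, $\mathsf{MLL_u}^\ell=\{\mathsf{ax}_j,1_j,⅋,\otimes\}$ and $\mathsf{MELL}^\ell=\{\mathsf{ax}_j,1_j,⅋,\otimes,\mathsf{w!p}\}$. **Relation webs.** A labelled mixed graph is a set $V$ with a symmetric irreflexive relation $\frown$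 (undirected edges), a disjoint irreflexive relation $\to$ (directed edges), and a label in $\mathcal A\cup\mathcal A^\bot\cup\{!,?,1,\bot,\circ\}$ for each vertex. It is a *relation web* if $V\ne\emptyset$, $\to$ is transitive, $(V,\frown)$ has no induced path on four vertices, $(V,\to)$ is a series-parallel order (it has no induced $N$), and no three vertices span exactly one $\frown$-edge, exactly one $\to$-edge and one pair without an edge. It is *modal* if the vertices with an outgoing $\to$-edge are exactly those labelled $!$ or $?$ (the *modal* vertices), and if $u\to w$ and $v\to w$ imply $u\to v$, $v\to u$ or $u=v$. The modal relation web $[\![F]\!]$ of a formula $F$ is defined inductively: variables, negated variables and constants give a single vertex with that label; $[\![A⅋B]\!]$ is the disjoint union of $[\![A]\!]$ and $[\![B]\!]$; $[\![A\otimes B]\!]$ adds to it all $\frown$-edges between the two; $[\![!A]\!]$ (resp. $[\![?A]\!]$) adds to $[\![A]\!]$ a vertex labelled $!$ (resp. $?$) with a $\to$-edge to every vertex of $[\![A]\!]$. **RGB-cographs.** An *RGB-cograph* $\mathcal G$ is a modal relation web $\lfloor\mathcal G\rfloor$ without vertices labelled $\bot$, with an equivalence relation $\curlyvee$ on its vertices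 such that each $\curlyvee$-class consists either of two vertices labelled by dual literals $a,a^\bot$ and any number of $\circ$-vertices, or of one $1$-vertex and any number of $\circ$-vertices, or of one $!$-vertex and any number of $?$-vertices. An *æ-path* is a sequence $x_0,\dots,x_n$ of distinct vertices whose steps $x_i,x_{i+1}$ are alternately $\curlyvee$-links and edges in ${\frown}\cup{\to}$ (directed edges being followed from source to target); it is *chordless* if there is no edge $x_i\frown x_j$ or $x_i\to x_j$ with $i+2\le j$. An *æ-cycle* is a closed sequence $x_0,\dots,x_n=x_0$ of even length $n\geq2$, with $x_0,\dots,x_{n-1}$ distinct, whose steps alternate in the same way; it is chordless if no edge, in either direction, joins two of its vertices that are not consecutive on the cycle. $\mathcal G$ is *æ-connected* if for any two vertices $x,y$ there is a chordless æ-path from $x$ to $y$ or from $y$ to $x$, and *æ-acyclic* if it has no chordless æ-cycle. $\mathcal G$ is *$\mathsf{MELL}$-correct* if it is non-empty, æ-connected and æ-acyclic, and whenever $w\to v$ and $v\curlyvee v'$ there is $w'\curlyvee w$ with $w'\to v'$ (the box-context condition). It is *$\mathsf{MLL}$-correct* (resp. *$\mathsf{MLL_u}$-correct*) if it is $\mathsf{MELL}$-correct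 and all its vertices are labelled by literals (resp. by literals, $1$ or $\circ$). **Theorem.** Let $\mathsf X\in\{\mathsf{MLL},\mathsf{MLL_u},\mathsf{MELL}\}$ and let $F$ be a formula. 1. If $\mathcal G$ is an $\mathsf X$-correct RGB-cograph with $\lfloor\mathcal G\rfloor\cong[\![F]\!]$, then $F$ is provable in $\mathsf X^\ell$. 2. $F$ is provable in $\mathsf X^\ell$ if and only if there is an $\mathsf X$-correct RGB-cograph $\mathcal G$ with $\lfloor\mathcal G\rfloor=[\![F]\!]$. -/

import Mathlib

namespace LL

universe u v w

/-! ## Formulas and the linear sequent systems -/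

/-- Formulas in negation normal form over the propositional variables `𝒜`; `jump` is the
placeholder constant `∘`. -/
inductive Formula (𝒜 : Type u) : Type u
  | pos : 𝒜 → Formula 𝒜
  | neg : 𝒜 → Formula 𝒜
  | par : Formula 𝒜 → Formula 𝒜 → Formula 𝒜
  | tens : Formula 𝒜 → Formula 𝒜 → Formula 𝒜
  | bang : Formula 𝒜 → Formula 𝒜
  | quest : Formula 𝒜 → Formula 𝒜
  | bot : Formula 𝒜
  | one : Formula 𝒜
  | jump : Formula 𝒜

/-- The three logics. -/
inductive Logic : Type
  | MLL
  | MLLu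
  | MELL

/-- Names of the rules of the linear systems. -/
inductive Rule : Type
  | ax
  | axj
  | onej
  | par
  | tens
  | wprom

/-- The rule set of the linear fragment `X^ℓ`. -/
def Logic.linear : Logic → Set Rule
  | .MLL => {Rule.ax, Rule.tens, Rule.par}
  | .MLLu => {Rule.axj, Rule.onej, Rule.par, Rule.tens}
  | .MELL => {Rule.axj, Rule.onej, Rule.par, Rule.tens, Rule.wprom}

/-- Derivability of a sequent (a multiset of formulas) with the rules in `R`. Every derivable
sequent is non-empty. -/
inductive Derivable {𝒜 : Type u} (R : Set Rule) : Multiset (Formula 𝒜) → Prop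
  | ax (h : Rule.ax ∈ R) (a : 𝒜) : Derivable R {Formula.pos a, Formula.neg a}
  | axj (h : Rule.axj ∈ R) (a : 𝒜) (n : ℕ) :
      Derivable R (Formula.pos a ::ₘ Formula.neg a ::ₘ Multiset.replicate n Formula.jump)
  | onej (h : Rule.onej ∈ R) (n : ℕ) :
      Derivable R (Formula.one ::ₘ Multiset.replicate n Formula.jump)
  | par (h : Rule.par ∈ R) (Γ : Multiset (Formula 𝒜)) (A B : Formula 𝒜) :
      Derivable R (A ::ₘ B ::ₘ Γ) → Derivable R (Formula.par A B ::ₘ Γ)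
  | tens (h : Rule.tens ∈ R) (Γ Δ : Multiset (Formula 𝒜)) (A B : Formula 𝒜) :
      Derivable R (A ::ₘ Γ) → Derivable R (B ::ₘ Δ) →
        Derivable R (Formula.tens A B ::ₘ (Γ + Δ))
  | wprom (h : Rule.wprom ∈ R) (Γ : Multiset (Formula 𝒜)) (A : Formula 𝒜) :
      Derivable R (A ::ₘ Γ) → Derivable R (Formula.bang A ::ₘ Γ.map Formula.quest)

/-- The formula `F` is provable with the rules in `R`. -/
def Provable {𝒜 : Type u} (R : Set Rule) (F : Formula 𝒜) : Prop :=
  Derivable R {F}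

/-! ## Labelled mixed graphs and relation webs -/

/-- The labels `𝒜 ∪ 𝒜^⊥ ∪ {!, ?, 1, ⊥, ∘}`. -/
inductive Label (𝒜 : Type u) : Type u
  | pos : 𝒜 → Label 𝒜
  | neg : 𝒜 → Label 𝒜
  | bang : Label 𝒜
  | quest : Label 𝒜
  | one : Label 𝒜
  | bot : Label 𝒜
  | jump : Label 𝒜

namespace Label

variable {𝒜 : Type u}

/-- The label is a literal. -/
def IsAtom (l : Label 𝒜) : Prop := (∃ a, l = pos a) ∨ ∃ a, l = neg a

/-- The label is `!` or `?`. -/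
def IsModal (l : Label 𝒜) : Prop := l = bang ∨ l = quest

/-- The two labels are dual literals. -/
def Dual (l m : Label 𝒜) : Prop :=
  ∃ a, (l = pos a ∧ m = neg a) ∨ (l = neg a ∧ m = pos a)

end Label

/-- A labelled mixed graph on the vertex type `V`: `und` is the undirected edge relation and
`dir` the directed one. -/
structure MixedGraph (𝒜 : Type u) (V : Type v) where
  und : V → V → Prop
  dir : V → V → Prop
  lab : V → Label 𝒜
  und_symm : ∀ x y, und x y → und y x
  und_irrefl : ∀ x, ¬ und x x
  dir_irrefl : ∀ x, ¬ dir x x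
  und_dir_disjoint : ∀ x y, und x y → ¬ dir x y

namespace MixedGraph

variable {𝒜 : Type u} {V : Type v} {W : Type w}

/-- There is an edge of some kind, in some direction, between `x` and `y`. -/
def Joined (G : MixedGraph 𝒜 V) (x y : V) : Prop :=
  G.und x y ∨ G.dir x y ∨ G.dir y x

/-- A one-vertex graph. -/
def single (l : Label 𝒜) : MixedGraph 𝒜 Unit where
  und _ _ := False
  dir _ _ := False
  lab _ := l
  und_symm _ _ h := h
  und_irrefl _ h := h
  dir_irrefl _ h := h
  und_dir_disjoint _ _ h := h.elim

/-- `G ⅋ H`: disjoint union. -/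
def par (G : MixedGraph 𝒜 V) (H : MixedGraph 𝒜 W) : MixedGraph 𝒜 (V ⊕ W) where
  und
    | .inl x, .inl y => G.und x y
    | .inr x, .inr y => H.und x y
    | _, _ => False
  dir
    | .inl x, .inl y => G.dir x y
    | .inr x, .inr y => H.dir x y
    | _, _ => False
  lab := Sum.elim G.lab H.lab
  und_symm := by
    rintro (x | x) (y | y) h
    exacts [G.und_symm _ _ h, h, h, H.und_symm _ _ h]
  und_irrefl := by
    rintro (x | x) h
    exacts [G.und_irrefl _ h, H.und_irrefl _ h]
  dir_irrefl := by
    rintro (x | x) h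
    exacts [G.dir_irrefl _ h, H.dir_irrefl _ h]
  und_dir_disjoint := by
    rintro (x | x) (y | y) h h'
    exacts [G.und_dir_disjoint _ _ h h', h, h, H.und_dir_disjoint _ _ h h']

/-- `G ◁ H`: disjoint union with all directed edges from `G` to `H`. -/
def seq (G : MixedGraph 𝒜 V) (H : MixedGraph 𝒜 W) : MixedGraph 𝒜 (V ⊕ W) where
  und
    | .inl x, .inl y => G.und x y
    | .inr x, .inr y => H.und x y
    | _, _ => False
  dir
    | .inl x, .inl y => G.dir x y
    | .inr x, .inr y => H.dir x y
    | .inl _, .inr _ => True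
    | .inr _, .inl _ => False
  lab := Sum.elim G.lab H.lab
  und_symm := by
    rintro (x | x) (y | y) h
    exacts [G.und_symm _ _ h, h, h, H.und_symm _ _ h]
  und_irrefl := by
    rintro (x | x) h
    exacts [G.und_irrefl _ h, H.und_irrefl _ h]
  dir_irrefl := by
    rintro (x | x) h
    exacts [G.dir_irrefl _ h, H.dir_irrefl _ h]
  und_dir_disjoint := by
    rintro (x | x) (y | y) h h'
    exacts [G.und_dir_disjoint _ _ h h', h, h, H.und_dir_disjoint _ _ h h']

/-- `G ⊗ H`: disjoint union with all undirected edges between `G` and `H`. -/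
def tens (G : MixedGraph 𝒜 V) (H : MixedGraph 𝒜 W) : MixedGraph 𝒜 (V ⊕ W) where
  und
    | .inl x, .inl y => G.und x y
    | .inr x, .inr y => H.und x y
    | _, _ => True
  dir
    | .inl x, .inl y => G.dir x y
    | .inr x, .inr y => H.dir x y
    | _, _ => False
  lab := Sum.elim G.lab H.lab
  und_symm := by
    rintro (x | x) (y | y) h
    exacts [G.und_symm _ _ h, trivial, trivial, H.und_symm _ _ h]
  und_irrefl := by
    rintro (x | x) h
    exacts [G.und_irrefl _ h, H.und_irrefl _ h]
  dir_irrefl := by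
    rintro (x | x) h
    exacts [G.dir_irrefl _ h, H.dir_irrefl _ h]
  und_dir_disjoint := by
    rintro (x | x) (y | y) h h'
    exacts [G.und_dir_disjoint _ _ h h', h', h', H.und_dir_disjoint _ _ h h']

/-- Isomorphism of labelled mixed graphs. -/
structure Iso (G : MixedGraph 𝒜 V) (H : MixedGraph 𝒜 W) extends V ≃ W where
  und_iff : ∀ x y, H.und (toEquiv x) (toEquiv y) ↔ G.und x y
  dir_iff : ∀ x y, H.dir (toEquiv x) (toEquiv y) ↔ G.dir x y
  lab_eq : ∀ x, H.lab (toEquiv x) = G.lab x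

/-- A relation web: a non-empty mixed graph with transitive directed edges whose undirected part
is a cograph (no induced path on four vertices), whose directed part is a series-parallel order
(no induced `N`), and which has no induced triangle with one undirected edge, one directed edge
and one pair of vertices without an edge. -/
structure IsRelationWeb (G : MixedGraph 𝒜 V) : Prop where
  nonempty : Nonempty V
  dir_trans : ∀ x y z, G.dir x y → G.dir y z → G.dir x z
  cograph : ∀ x y z t, G.und x y → G.und y z → G.und z t →
    G.und x z ∨ G.und x t ∨ G.und y t
  series_parallel : ∀ x y z t, G.dir x y → G.dir z y → G.dir z t →
    G.dir x z ∨ G.dir z x ∨ G.dir x t ∨ G.dir t x ∨ G.dir y t ∨ G.dir t y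
  triangle_out : ∀ x y z, G.dir x y → G.und x z → G.Joined y z
  triangle_in : ∀ x y z, G.dir x y → G.und y z → G.Joined x z

/-- A modal relation web: exactly the vertices labelled `!` or `?` have an outgoing directed edge,
and any two distinct vertices with directed edges to a common vertex are themselves joined by a
directed edge. -/
structure IsModalRelationWeb (G : MixedGraph 𝒜 V) : Prop extends IsRelationWeb G where
  properly_labeled : ∀ x, (∃ y, G.dir x y) ↔ (G.lab x).IsModal
  modal : ∀ x y z, G.dir x z → G.dir y z → G.dir x y ∨ G.dir y x ∨ x = y

end MixedGraph

/-- The vertices of the relation web of a formula: the occurrences of atoms, constants and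
modalities in the formula. -/
def Formula.Vertex {𝒜 : Type u} : Formula 𝒜 → Type
  | .pos _ => Unit
  | .neg _ => Unit
  | .par A B => A.Vertex ⊕ B.Vertex
  | .tens A B => A.Vertex ⊕ B.Vertex
  | .bang A => Unit ⊕ A.Vertex
  | .quest A => Unit ⊕ A.Vertex
  | .bot => Unit
  | .one => Unit
  | .jump => Unit

/-- The relation web `⟦F⟧` of a formula. -/
def Formula.web {𝒜 : Type u} : (F : Formula 𝒜) → MixedGraph 𝒜 F.Vertex
  | .pos a => MixedGraph.single (Label.pos a)
  | .neg a => MixedGraph.single (Label.neg a)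
  | .par A B => A.web.par B.web
  | .tens A B => A.web.tens B.web
  | .bang A => (MixedGraph.single Label.bang).seq A.web
  | .quest A => (MixedGraph.single Label.quest).seq A.web
  | .bot => MixedGraph.single Label.bot
  | .one => MixedGraph.single Label.one
  | .jump => MixedGraph.single Label.jump

/-! ## RGB-cographs -/

/-- An RGB-cograph: a modal relation web with a linking. The linking classes are: a pair of
vertices labelled by dual literals together with any number of jumps; one vertex labelled `1`
together with any number of jumps; one vertex labelled `!` together with any number of vertices
labelled `?`. -/
structure RGBCograph (𝒜 : Type u) (V : Type v) extends MixedGraph 𝒜 V where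
  isModalRelationWeb : toMixedGraph.IsModalRelationWeb
  link : Setoid V
  lab_ne_bot : ∀ x, lab x ≠ Label.bot
  link_atom : ∀ x, (lab x).IsAtom → ∃! y, (lab y).IsAtom ∧ link x y ∧ x ≠ y
  link_dual : ∀ x y, (lab x).IsAtom → (lab y).IsAtom → link x y → x ≠ y →
    (lab x).Dual (lab y)
  link_one : ∀ x, lab x = Label.one → ∀ y, link x y → y ≠ x → lab y = Label.jump
  link_jump : ∀ x, lab x = Label.jump → ∃ y, ((lab y).IsAtom ∨ lab y = Label.one) ∧ link x y
  link_modal : ∀ x, (lab x).IsModal →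
    (∀ y, link x y → (lab y).IsModal) ∧ ∃! y, lab y = Label.bang ∧ link x y

namespace RGBCograph

variable {𝒜 : Type u} {V : Type v}

/-- A step from `x` to `y`: a link between distinct vertices if `b` is true, and an edge of the
mixed graph otherwise. Directed edges are followed from source to target. -/
def Step (G : RGBCograph 𝒜 V) (b : Bool) (x y : V) : Prop :=
  if b = true then G.link x y ∧ x ≠ y else G.und x y ∨ G.dir x y

/-- The `n` steps of the sequence `p 0, …, p n` alternate between links and edges of the mixed
graph. -/
def Alternating (G : RGBCograph 𝒜 V) (n : ℕ) (p : ℕ → V) : Prop :=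
  ∃ c : ℕ → Bool, (∀ i, c (i + 1) = !c i) ∧ ∀ i < n, G.Step (c i) (p i) (p (i + 1))

/-- `p 0, …, p n` is a chordless alternating elementary path (with distinct ends, or of
length zero). -/
structure IsChordlessPath (G : RGBCograph 𝒜 V) (n : ℕ) (p : ℕ → V) : Prop where
  alternating : G.Alternating n p
  elementary : ∀ i j, i ≤ n → j ≤ n → p i = p j → i = j
  chordless : ∀ i j, i + 2 ≤ j → j ≤ n → ¬ (G.und (p i) (p j) ∨ G.dir (p i) (p j))

/-- `p 0, …, p n = p 0` is a chordless alternating elementary cycle. As `n` is even, the last and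
the first step alternate too. A chord is an edge between two vertices that are not consecutive on
the cycle. -/
structure IsChordlessCycle (G : RGBCograph 𝒜 V) (n : ℕ) (p : ℕ → V) : Prop where
  pos : 0 < n
  even : Even n
  closed : p n = p 0
  alternating : G.Alternating n p
  elementary : ∀ i j, i < n → j < n → p i = p j → i = j
  chordless : ∀ i j, i + 2 ≤ j → j < n → ¬ (i = 0 ∧ j + 1 = n) → ¬ G.Joined (p i) (p j)

/-- Any two vertices are connected, in one direction or the other, by a chordless path. -/
def AEConnected (G : RGBCograph 𝒜 V) : Prop :=
  ∀ x y, ∃ n p, G.IsChordlessPath n p ∧ ((p 0 = x ∧ p n = y) ∨ (p 0 = y ∧ p n = x))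

/-- There is no chordless cycle. -/
def AEAcyclic (G : RGBCograph 𝒜 V) : Prop :=
  ∀ n p, ¬ G.IsChordlessCycle n p

/-- The box-context condition. -/
def BoxContext (G : RGBCograph 𝒜 V) : Prop :=
  ∀ x y y', G.dir x y → G.link y y' → ∃ x', G.link x' x ∧ G.dir x' y'

/-- `MELL`-correctness. -/
structure MELLCorrect (G : RGBCograph 𝒜 V) : Prop where
  nonempty : Nonempty V
  connected : G.AEConnected
  acyclic : G.AEAcyclic
  boxContext : G.BoxContext

/-- `X`-correctness. -/
def Correct (G : RGBCograph 𝒜 V) : Logic → Prop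
  | .MLL => G.MELLCorrect ∧ ∀ x, (G.lab x).IsAtom
  | .MLLu => G.MELLCorrect ∧
      ∀ x, (G.lab x).IsAtom ∨ G.lab x = Label.one ∨ G.lab x = Label.jump
  | .MELL => G.MELLCorrect

end RGBCograph

end LL

/-! Formulas are located: in `Occ V` the atoms, constants and modalities are vertices, so that a
formula carries its own mixed graph. `NDer m link` is derivability of located sequents relative to a
fixed linking. An axiom is one whole class of atoms, a promotion boxes one whole class of
modalities, and `m = true` adds the two mix rules (the empty sequent and juxtaposition). Mix-free
located derivations are the same thing as linear derivations together with the linking that they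
induce (`NDer.derivable`, `Derivable.exists_link`). It remains to compare `NDer false link {F}` with
correctness of the linking.

From a derivation to a correct graph, induct on the derivation. A tensor puts a complete join
between two vertex sets, and no links cross it, so a chordless path that leaves one side and
returns, or a chordless cycle that crosses, would have a chord (`CPath.mem_of_join`,
`CCycle.mem_of_join`). Hence cycles live in a premise, which gives `NDer.acyclic`. Connectedness
needs the stronger `NDer.reach`: every vertex reaches every formula of the sequent and is reached
from it, so paths can be concatenated through a tensor. The box-context condition holds because a
promotion boxes the whole contents, a set closed under links.

From a correct graph to a derivation, acyclicity and the box-context condition first give a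
derivation with mix (`NDer.of_acyclic_boxContext`). The box-context condition makes the outer
vertices closed under links, so outer levels can be treated before the contents of boxes. At one
level no splitting tensor is sought. Any tensor `A ⊗ B` is replaced by the two conclusions `A` and
`B`. The new sequent is still acyclic (`CCycle.of_join`), so it is derivable by induction. Moreover
`A` and `B` are unconnected, since a chordless path between them would close to a cycle through the
tensor (`CPath.cycle_of_join`).

The central lemma `NDer.splits` then cuts that derivation, in the manner of interpolation.
Conclusions that must stay apart are coloured, the others are neutral. The derivation yields one
derivation per colour, with auxiliary formulas `Θ i` assembled from neutral material, and a
procedure that turns the `Θ i` back into the neutral conclusions. With `A` and `B` of different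
colours, one tensors the two derivations and then applies the procedure.

Finally a derivation that really uses mix leaves two vertices without a chordless path in either
direction (`NDer.mixfree`), so connectedness removes mix. -/

namespace LL

universe u v w

/-! ## Chordless alternating paths -/

section Paths

variable {V : Type v} {L E E' : V → V → Prop}

/-- A step of an alternating path: a link between distinct vertices, or an edge. -/
def AltStep (L E : V → V → Prop) (b : Bool) (x y : V) : Prop :=
  if b = true then L x y ∧ x ≠ y else E x y

/-- Chordless alternating paths for a link relation `L` and an edge relation `E`. -/
structure CPath (L E : V → V → Prop) (n : ℕ) (p : ℕ → V) : Prop where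
  alternating : ∃ b : Bool, ∀ i < n, AltStep L E (b ^^ i.bodd) (p i) (p (i + 1))
  elementary : ∀ i j, i ≤ n → j ≤ n → p i = p j → i = j
  chordless : ∀ i j, i + 2 ≤ j → j ≤ n → ¬ E (p i) (p j)

/-- Chordless alternating cycles for a link relation `L` and an edge relation `E`. -/
structure CCycle (L E : V → V → Prop) (n : ℕ) (p : ℕ → V) : Prop where
  pos : 0 < n
  even : Even n
  closed : p n = p 0
  alternating : ∃ b : Bool, ∀ i < n, AltStep L E (b ^^ i.bodd) (p i) (p (i + 1))
  elementary : ∀ i j, i < n → j < n → p i = p j → i = j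
  chordless : ∀ i j, i + 2 ≤ j → j < n → ¬ (i = 0 ∧ j + 1 = n) →
    ¬ E (p i) (p j) ∧ ¬ E (p j) (p i)

theorem bodd_of_even {n : ℕ} (h : Even n) : n.bodd = false := by
  obtain ⟨k, rfl⟩ := h
  simp [Nat.bodd_add]

theorem bodd_of_odd {n : ℕ} (h : Odd n) : n.bodd = true := by
  obtain ⟨k, rfl⟩ := h
  simp [two_mul, Nat.bodd_add]

theorem exists_exit {X : Set V} {p : ℕ → V} {i j : ℕ} (hij : i ≤ j) (hi : p i ∈ X)
    (hj : p j ∉ X) : ∃ k, i ≤ k ∧ k < j ∧ p k ∈ X ∧ p (k + 1) ∉ X := by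
  induction j, hij using Nat.le_induction with
  | base => exact absurd hi hj
  | succ j hij ih =>
    by_cases h : p j ∈ X
    · exact ⟨j, hij, j.lt_succ_self, h, hj⟩
    · obtain ⟨k, h1, h2, h3⟩ := ih h
      exact ⟨k, h1, h2.trans j.lt_succ_self, h3⟩

theorem exists_entry {X : Set V} {p : ℕ → V} {i j : ℕ} (hij : i ≤ j) (hi : p i ∉ X)
    (hj : p j ∈ X) : ∃ k, i ≤ k ∧ k < j ∧ p k ∉ X ∧ p (k + 1) ∈ X := by
  simpa using exists_exit (X := Xᶜ) hij hi (by simpa using hj)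

theorem AltStep.edge_of_not_link {b : Bool} {x y : V} (h : AltStep L E b x y) (hl : ¬ L x y) :
    b = false ∧ E x y := by
  cases b
  · exact ⟨rfl, by simpa [AltStep] using h⟩
  · simp only [AltStep, if_true] at h
    exact absurd h.1 hl

theorem AltStep.link_of_not_edge {b : Bool} {x y : V} (h : AltStep L E b x y) (hl : ¬ E x y) :
    b = true ∧ L x y ∧ x ≠ y := by
  cases b
  · simp [AltStep] at h
    exact absurd h hl
  · exact ⟨rfl, by simpa [AltStep] using h⟩

theorem AltStep.mono {b : Bool} {x y : V} (h : AltStep L E b x y) (hE : E x y → E' x y) :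
    AltStep L E' b x y := by
  cases b
  · simp [AltStep] at h ⊢
    exact hE h
  · simpa [AltStep] using h

theorem CPath.single (x : V) : CPath L E 0 fun _ => x :=
  ⟨⟨true, fun i h => absurd h (Nat.not_lt_zero i)⟩, fun i j hi hj _ => by omega,
    fun i j h hj => by omega⟩

theorem CPath.pair {b : Bool} {x y : V} (h : AltStep L E b x y) (hxy : x ≠ y) :
    CPath L E 1 fun i => if i = 0 then x else y := by
  refine ⟨⟨b, fun i hi => ?_⟩, fun i j hi hj h => ?_, fun i j h hj => by omega⟩
  · obtain rfl : i = 0 := by omega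
    simpa using h
  · have hi' : i = 0 ∨ i = 1 := by omega
    have hj' : j = 0 ∨ j = 1 := by omega
    rcases hi' with rfl | rfl <;> rcases hj' with rfl | rfl <;> simp_all

theorem CPath.congr {n : ℕ} {p : ℕ → V} (h : CPath L E n p)
    (hE : ∀ i j, i ≤ n → j ≤ n → (E (p i) (p j) ↔ E' (p i) (p j))) : CPath L E' n p := by
  obtain ⟨⟨b, hb⟩, he, hc⟩ := h
  refine ⟨⟨b, fun i hi => (hb i hi).mono (hE i (i + 1) hi.le hi).1⟩, he, fun i j hij hj h => ?_⟩
  exact hc i j hij hj ((hE i j (by omega) hj).2 h)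

theorem CCycle.congr {n : ℕ} {p : ℕ → V} (h : CCycle L E n p)
    (hE : ∀ i j, i ≤ n → j ≤ n → (E (p i) (p j) ↔ E' (p i) (p j))) : CCycle L E' n p := by
  obtain ⟨h0, h1, h2, ⟨b, hb⟩, he, hc⟩ := h
  refine ⟨h0, h1, h2, ⟨b, fun i hi => (hb i hi).mono (hE i (i + 1) hi.le hi).1⟩, he,
    fun i j hij hj hn => ?_⟩
  obtain ⟨h1, h2⟩ := hc i j hij hj hn
  exact ⟨fun h => h1 ((hE i j (by omega) hj.le).2 h),
    fun h => h2 ((hE j i hj.le (by omega)).2 h)⟩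

theorem CPath.sub {n : ℕ} {p : ℕ → V} (h : CPath L E n p) {i j : ℕ} (hij : i ≤ j) (hj : j ≤ n) :
    CPath L E (j - i) fun k => p (i + k) := by
  obtain ⟨⟨b, hb⟩, he, hc⟩ := h
  refine ⟨⟨b ^^ i.bodd, fun k hk => ?_⟩, fun k l hk hl h => ?_, fun k l hkl hl => ?_⟩
  · have := hb (i + k) (by omega)
    rwa [Nat.bodd_add, ← Bool.xor_assoc] at this
  · have := he _ _ (by omega) (by omega) h
    omega
  · exact hc _ _ (by omega) (by omega)

theorem CPath.reverse {n : ℕ} {p : ℕ → V} (h : CPath L E n p) (hL : ∀ x y, L x y → L y x)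
    (hE : ∀ x y, E x y → E y x) : CPath L E n fun k => p (n - k) := by
  obtain ⟨⟨b, hb⟩, he, hc⟩ := h
  -- The first step of the reversed path is the last step of `p`, whose kind has the parity of `n -
  -- 1`.
  refine ⟨⟨b ^^ n.bodd ^^ true, fun k hk => ?_⟩, fun k l hk hl h => ?_, fun k l hkl hl h => ?_⟩
  · obtain ⟨m, rfl⟩ : ∃ m, n = m + 1 + k := ⟨n - 1 - k, by omega⟩
    have := hb m (by omega)
    have e1 : m + 1 + k - k = m + 1 := by omega
    have e2 : m + 1 + k - (k + 1) = m := by omega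
    have e3 : (b ^^ (m + 1 + k).bodd ^^ true ^^ k.bodd) = (b ^^ m.bodd) := by
      simp only [Nat.bodd_add, Nat.bodd_one]
      cases b <;> cases m.bodd <;> cases k.bodd <;> rfl
    simp only [e1, e2, e3]
    revert this
    cases (b ^^ m.bodd)
    · simpa [AltStep] using hE _ _
    · simp only [AltStep, if_true]
      exact fun h => ⟨hL _ _ h.1, h.2.symm⟩
  · have := he _ _ (by omega) (by omega) h
    omega
  · exact hc (n - l) (n - k) (by omega) (by omega) (hE _ _ h)

/-- A set closed under links and edges contains any path that starts in it. -/
theorem mem_of_altStep {X : Set V} {n : ℕ} {p : ℕ → V} {b : ℕ → Bool}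
    (h : ∀ i < n, AltStep L E (b i) (p i) (p (i + 1)))
    (hL : ∀ x ∈ X, ∀ y, L x y → y ∈ X) (hE : ∀ x ∈ X, ∀ y, E x y → y ∈ X) (h0 : p 0 ∈ X) :
    ∀ i ≤ n, p i ∈ X := by
  intro i
  induction i with
  | zero => exact fun _ => h0
  | succ i ih =>
    intro hi
    have h1 := ih (by omega)
    have h2 := h i (by omega)
    revert h2
    cases b i
    · simpa [AltStep] using hE _ h1 _
    · simp only [AltStep, if_true]
      exact fun h => hL _ h1 _ h.1

theorem CPath.mem {X : Set V} {n : ℕ} {p : ℕ → V} (h : CPath L E n p)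
    (hL : ∀ x ∈ X, ∀ y, L x y → y ∈ X) (hE : ∀ x ∈ X, ∀ y, E x y → y ∈ X) (h0 : p 0 ∈ X) :
    ∀ i ≤ n, p i ∈ X := by
  obtain ⟨⟨b, hb⟩, -, -⟩ := h
  exact mem_of_altStep hb hL hE h0

/-- The length is even and positive, so one of the first two steps is an edge. This edge puts the
cycle into `X`, if necessary after going back along the first link. -/
theorem CCycle.mem {X : Set V} {n : ℕ} {p : ℕ → V} (h : CCycle L E n p)
    (hL : ∀ x ∈ X, ∀ y, L x y → y ∈ X) (hs : ∀ x y, L x y → L y x)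
    (hE : ∀ x y, E x y → x ∈ X ∧ y ∈ X) : ∀ i ≤ n, p i ∈ X := by
  obtain ⟨h0, h1, -, ⟨b, hb⟩, -, -⟩ := h
  refine mem_of_altStep hb hL (fun x _ y h => (hE x y h).2) ?_
  have h2 : 1 < n := by
    obtain ⟨k, rfl⟩ := h1
    omega
  have s0 := hb 0 h0
  have s1 := hb 1 h2
  cases b
  · simp [AltStep] at s0
    exact (hE _ _ s0).1
  · simp [AltStep] at s0 s1
    exact hL _ (hE _ _ s1).1 _ (hs _ _ s0.1)

/-- Two chordless paths in disjoint parts `X` and `Y`, joined through `A ⊆ X` and `B ⊆ Y`. -/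
theorem CPath.join {X Y A B : Set V} {n m : ℕ} {p q : ℕ → V} (hp : CPath L E n p)
    (hq : CPath L E m q) (hpX : ∀ i ≤ n, p i ∈ X) (hqY : ∀ i ≤ m, q i ∈ Y)
    (hXY : ∀ x ∈ X, x ∉ Y) (hE : ∀ x ∈ X, ∀ y ∈ Y, (E x y ↔ x ∈ A ∧ y ∈ B))
    (hA : ∀ x ∈ X, ∀ y ∈ A, x ∉ A → ¬ E x y) (hB : ∀ x ∈ B, ∀ y ∈ Y, y ∉ B → ¬ E x y)
    (hpA : p n ∈ A) (hpA' : ∀ i < n, p i ∉ A) (hqB : q 0 ∈ B)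
    (hqB' : ∀ i, 0 < i → i ≤ m → q i ∉ B) :
    CPath L E (n + 1 + m) fun i => if i ≤ n then p i else q (i - (n + 1)) := by
  obtain ⟨⟨b, hb⟩, he, hc⟩ := hp
  obtain ⟨⟨b', hb'⟩, he', hc'⟩ := hq
  -- The last step of `p` enters `A` from outside and so must be a link; hence step `n` may be an
  -- edge. For `n = 0` the kind of the next step is unconstrained and is set to an edge.
  obtain ⟨c, hcn, hc0⟩ : ∃ c : Bool, (c ^^ n.bodd) = false ∧
      ∀ i < n, AltStep L E (c ^^ i.bodd) (p i) (p (i + 1)) := by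
    rcases n.eq_zero_or_pos with rfl | hn
    · exact ⟨false, rfl, fun i h => absurd h (Nat.not_lt_zero i)⟩
    · refine ⟨b, ?_, hb⟩
      obtain ⟨k, rfl⟩ : ∃ k, n = k + 1 := ⟨n - 1, by omega⟩
      have := (hb k (by omega)).link_of_not_edge
        (hA _ (hpX k (by omega)) _ hpA (hpA' k (by omega)))
      have h1 := this.1
      simp only [Nat.bodd_succ]
      revert h1
      cases b <;> cases k.bodd <;> simp
  have hc1 : ∀ i < m, AltStep L E (true ^^ i.bodd) (q i) (q (i + 1)) := by
    rcases m.eq_zero_or_pos with rfl | hm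
    · exact fun i h => absurd h (Nat.not_lt_zero i)
    · have := (hb' 0 hm).link_of_not_edge
        (hB _ hqB _ (hqY 1 hm) (hqB' 1 one_pos hm))
      have h1 := this.1
      simp at h1
      rw [← h1]
      exact hb'
  refine ⟨⟨c, fun i hi => ?_⟩, fun i j hi hj h => ?_, fun i j hij hj h => ?_⟩
  · rcases lt_trichotomy i n with h | rfl | h
    · simp only [h.le, if_true, show i + 1 ≤ n from h]
      exact hc0 i h
    · rw [hcn]
      simpa [AltStep] using (hE _ (hpX _ le_rfl) _ (hqY _ (Nat.zero_le _))).2 ⟨hpA, hqB⟩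
    · obtain ⟨k, rfl⟩ : ∃ k, i = n + 1 + k := ⟨i - (n + 1), by omega⟩
      have e : (c ^^ (n + 1 + k).bodd) = (true ^^ k.bodd) := by
        simp only [Nat.bodd_add, Nat.bodd_one]
        revert hcn
        cases c <;> cases n.bodd <;> cases k.bodd <;> simp
      have h1 : ¬ (n + 1 + k ≤ n) := by omega
      have h2 : ¬ (n + 1 + k + 1 ≤ n) := by omega
      have h3 : n + 1 + k + 1 - (n + 1) = k + 1 := by omega
      simp only [h1, h2, if_false, h3, e, Nat.add_sub_cancel_left]
      exact hc1 k (by omega)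
  · split_ifs at h with h1 h2 h2
    · exact he _ _ h1 h2 h
    · exact absurd (h ▸ hpX i h1) fun h' => hXY _ h' (hqY _ (by omega))
    · exact absurd (h ▸ hqY _ (by omega)) (hXY _ (hpX j h2))
    · have := he' _ _ (by omega) (by omega) h
      omega
  · split_ifs at h with h1 h2 h2
    · exact hc _ _ hij h2 h
    · obtain ⟨ha, hb⟩ := (hE _ (hpX i h1) _ (hqY (j - (n + 1)) (by omega))).1 h
      have e1 : i = n := by
        by_contra hne
        exact hpA' i (by omega) ha
      exact hqB' _ (by omega) (by omega) hb
    · omega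
    · exact hc' _ _ (by omega) (by omega) h

/-- Truncating `p` at its first visit to `A` and `q` from its last visit to `B` leaves a single edge
between the two pieces, so the concatenation has no chord. -/
theorem CPath.exists_join {X Y A B : Set V} {n m : ℕ} {p q : ℕ → V} (hp : CPath L E n p)
    (hq : CPath L E m q) (hpX : ∀ i ≤ n, p i ∈ X) (hqY : ∀ i ≤ m, q i ∈ Y)
    (hXY : ∀ x ∈ X, x ∉ Y) (hE : ∀ x ∈ X, ∀ y ∈ Y, (E x y ↔ x ∈ A ∧ y ∈ B))
    (hA : ∀ x ∈ X, ∀ y ∈ A, x ∉ A → ¬ E x y) (hB : ∀ x ∈ B, ∀ y ∈ Y, y ∉ B → ¬ E x y)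
    (hpA : p n ∈ A) (hqB : q 0 ∈ B) :
    ∃ k r, CPath L E k r ∧ r 0 = p 0 ∧ r k = q m := by
  classical
  have hex : ∃ j, p j ∈ A := ⟨n, hpA⟩
  have hle : Nat.find hex ≤ n := Nat.find_min' hex hpA
  have hp' := hp.sub (Nat.zero_le _) hle
  have hg := Nat.findGreatest_spec (P := fun i => q i ∈ B) (Nat.zero_le m) hqB
  have hgle := Nat.findGreatest_le (P := fun i => q i ∈ B) m
  have hgmax := fun k (h1 : _ < k) (h2 : k ≤ m) =>
    Nat.findGreatest_is_greatest (P := fun i => q i ∈ B) h1 h2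
  obtain ⟨g, hgdef⟩ : ∃ g, g = Nat.findGreatest (fun i => q i ∈ B) m := ⟨_, rfl⟩
  rw [← hgdef] at hg hgle hgmax
  have hq' := hq.sub hgle le_rfl
  simp only [zero_add, Nat.sub_zero] at hp'
  refine ⟨_, _, hp'.join hq' (fun i hi => hpX _ (by omega)) (fun i hi => hqY _ (by omega)) hXY hE
    hA hB (Nat.find_spec hex) (fun i hi => Nat.find_min hex hi) (by simpa using hg)
    (fun i h1 h2 => hgmax _ (by omega) (by omega)), by simp, ?_⟩
  have h1 : ¬ (Nat.find hex + 1 + (m - g) ≤ Nat.find hex) := by omega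
  simp only [h1, if_false]
  congr 1
  omega

/-- A chordless path cannot leave and reenter a part `X` through a complete join of `A ⊆ X` and
`B`. -/
theorem CPath.mem_of_join {X A B : Set V} {n : ℕ} {p : ℕ → V} (hp : CPath L E n p)
    (hL : ∀ x y, L x y → (x ∈ X ↔ y ∈ X))
    (hE : ∀ x ∈ X, ∀ y, y ∉ X → (E x y ∨ E y x) → x ∈ A ∧ y ∈ B)
    (hAB : ∀ x ∈ A, ∀ y ∈ B, E x y) (h0 : p 0 ∈ X) (hn : p n ∈ X) : ∀ i ≤ n, p i ∈ X := by
  intro k hk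
  by_contra hkX
  obtain ⟨b, hb⟩ := hp.alternating
  obtain ⟨i, -, hi, hi1, hi2⟩ := exists_exit (Nat.zero_le k) h0 hkX
  obtain ⟨j, hj, hj1, hj2, hj3⟩ := exists_entry hk hkX hn
  obtain ⟨c1, e1⟩ := (hb i (by omega)).edge_of_not_link
    (fun h => hi2 ((hL _ _ h).1 hi1))
  obtain ⟨c2, e2⟩ := (hb j hj1).edge_of_not_link (fun h => hj2 ((hL _ _ h).2 hj3))
  have ha := (hE _ hi1 _ hi2 (Or.inl e1)).1
  have hb' := (hE _ hj3 _ hj2 (Or.inr e2)).2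
  -- The exit starts in `A` and the reentry starts in `B`, so `p i` and `p j` are joined. This is a
  -- chord unless the two crossings are consecutive, and then two edges in a row break the
  -- alternation.
  rcases (show j = i + 1 ∨ i + 2 ≤ j by omega) with rfl | h
  · rw [Nat.bodd_succ] at c2
    revert c1 c2
    cases b <;> cases i.bodd <;> simp
  · exact hp.chordless i j h (by omega) (hAB _ ha _ hb')

/-- A chordless cycle cannot cross a complete join between `A` and `B`. -/
theorem CCycle.mem_of_join {X A B : Set V} {n : ℕ} {p : ℕ → V} (hp : CCycle L E n p)
    (hL : ∀ x y, L x y → (x ∈ X ↔ y ∈ X))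
    (hE : ∀ x ∈ X, ∀ y, y ∉ X → (E x y ∨ E y x) → x ∈ A ∧ y ∈ B)
    (hAB : ∀ x ∈ A, ∀ y ∈ B, E x y) {k : ℕ} (hk : k ≤ n) (hkX : p k ∈ X) :
    ∀ i ≤ n, p i ∈ X := by
  obtain ⟨b, hb⟩ := hp.alternating
  by_contra! hcon
  obtain ⟨l, hl, hlX⟩ := hcon
  obtain ⟨⟨i, hi, hi1, hi2⟩, ⟨j, hj, hj1, hj2⟩⟩ :
      (∃ i, i < n ∧ p i ∈ X ∧ p (i + 1) ∉ X) ∧ ∃ i, i < n ∧ p i ∉ X ∧ p (i + 1) ∈ X := by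
    by_cases h0 : p 0 ∈ X
    · obtain ⟨i, -, h1, h2, h3⟩ := exists_exit (Nat.zero_le l) h0 hlX
      obtain ⟨j, -, h4, h5, h6⟩ := exists_entry hl hlX (hp.closed ▸ h0)
      exact ⟨⟨i, by omega, h2, h3⟩, ⟨j, h4, h5, h6⟩⟩
    · obtain ⟨i, -, h1, h2, h3⟩ := exists_entry (Nat.zero_le k) h0 hkX
      obtain ⟨j, -, h4, h5, h6⟩ := exists_exit hk hkX (hp.closed ▸ h0)
      exact ⟨⟨j, h4, h5, h6⟩, ⟨i, by omega, h2, h3⟩⟩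
  obtain ⟨c1, e1⟩ := (hb i hi).edge_of_not_link (fun h => hi2 ((hL _ _ h).1 hi1))
  obtain ⟨c2, e2⟩ := (hb j hj).edge_of_not_link (fun h => hj1 ((hL _ _ h).2 hj2))
  have ha := (hE _ hi1 _ hi2 (Or.inl e1)).1
  have hb' := (hE _ hj2 _ hj1 (Or.inr e2)).2
  have hpar : i.bodd = j.bodd := by
    revert c1 c2
    cases b <;> cases i.bodd <;> cases j.bodd <;> simp
  have hne : i ≠ j := fun h => hj1 (h ▸ hi1)
  -- Both crossings are edges, so their indices have equal parity. As `n` is even, distinct indices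
  -- of equal parity are never neighbours on the cycle, not even around its end.
  have key : ∀ a c : ℕ, a < c → c < n → a.bodd = c.bodd → a + 2 ≤ c ∧ ¬ (a = 0 ∧ c + 1 = n) := by
    intro a c hac hcn hp'
    constructor
    · by_contra h
      obtain rfl : c = a + 1 := by omega
      rw [Nat.bodd_succ] at hp'
      cases h : a.bodd <;> simp [h] at hp'
    · rintro ⟨rfl, h⟩
      have := bodd_of_even hp.even
      rw [← h, Nat.bodd_succ, ← hp'] at this
      simp at this
  rcases lt_or_gt_of_ne hne with h | h
  · obtain ⟨h1, h2⟩ := key i j h hj hpar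
    exact (hp.chordless i j h1 hj h2).1 (hAB _ ha _ hb')
  · obtain ⟨h1, h2⟩ := key j i h hi hpar.symm
    exact (hp.chordless j i h1 hi h2).2 (hAB _ ha _ hb')

/-- A chordless path whose ends only lie in `A` and `B` becomes a chordless cycle once `A` and `B`
are completely joined. -/
theorem CPath.cycle_of_join {A B : Set V} {n : ℕ} {p : ℕ → V} (hp : CPath L E n p)
    (hs : ∀ x y, E x y → E y x) (hAB : ∀ x ∈ A, x ∉ B)
    (hE' : ∀ x y, E' x y ↔ E x y ∨ (x ∈ A ∧ y ∈ B) ∨ (x ∈ B ∧ y ∈ A))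
    (hA : ∀ x y, E x y → (x ∈ A ↔ y ∈ A)) (hB : ∀ x y, E x y → (x ∈ B ↔ y ∈ B))
    (h0 : p 0 ∈ A) (hn : p n ∈ B) : ∃ m q, CCycle L E' m q := by
  -- Cut down to a segment that meets `A` only at its start and `B` only at its end: first visit to
  -- `B`, then last visit to `A` before it.
  obtain ⟨j, hjn, hjB, hjmin⟩ : ∃ j ≤ n, p j ∈ B ∧ ∀ i < j, p i ∉ B := by
    classical
    have hex : ∃ j, p j ∈ B := ⟨n, hn⟩
    exact ⟨Nat.find hex, Nat.find_min' hex hn, Nat.find_spec hex, fun i h => Nat.find_min hex h⟩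
  obtain ⟨i, hij, hiA, himax⟩ : ∃ i ≤ j, p i ∈ A ∧ ∀ k, i < k → k ≤ j → p k ∉ A := by
    classical
    have h := Nat.findGreatest_spec (P := fun i => p i ∈ A) (Nat.zero_le j) h0
    exact ⟨_, Nat.findGreatest_le j, h, fun k h1 h2 => Nat.findGreatest_is_greatest h1 h2⟩
  have hne : i ≠ j := fun h => hAB _ hiA (h ▸ hjB)
  have hsub := hp.sub hij hjn
  obtain ⟨m, hm⟩ : ∃ m, j - i = m + 1 := ⟨j - i - 1, by omega⟩
  rw [hm] at hsub
  obtain ⟨q, hq⟩ : ∃ q : ℕ → V, q = fun k => p (i + k) := ⟨_, rfl⟩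
  rw [← hq] at hsub
  have hq0 : q 0 ∈ A := by simpa [hq] using hiA
  have hqm : q (m + 1) ∈ B := by
    rw [hq]
    convert hjB using 2
    omega
  have hqA : ∀ k, 0 < k → k ≤ m + 1 → q k ∉ A := fun k h1 h2 => by
    rw [hq]
    exact himax _ (by omega) (by omega)
  have hqB : ∀ k, k < m + 1 → q k ∉ B := fun k h1 => by
    rw [hq]
    exact hjmin _ (by omega)
  obtain ⟨⟨b, hb⟩, he, hc⟩ := hsub
  -- Old edges never enter or leave `A` or `B`, so the segment begins and ends with a link. Its
  -- length `m + 1` is therefore odd, and the new edge from the end to the start closes it to an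
  -- alternating cycle.
  have s0 := (hb 0 (by omega)).link_of_not_edge fun h => hqA 1 one_pos (by omega) ((hA _ _ h).1 hq0)
  have s1 := (hb m (by omega)).link_of_not_edge fun h => hqB m (by omega) ((hB _ _ h).2 hqm)
  have hb1 : b = true := by simpa using s0.1
  subst hb1
  have hmodd : m.bodd = false := by
    have := s1.1
    revert this
    cases m.bodd <;> simp
  refine ⟨m + 2, fun k => if k = m + 2 then q 0 else q k, ⟨by omega, ?_, by simp, ⟨true, ?_⟩, ?_, ?_⟩⟩
  · rcases Nat.even_or_odd m with h | h
    · exact h.add (by decide)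
    · rw [bodd_of_odd h] at hmodd
      exact absurd hmodd (by simp)
  · intro k hk
    have hk' : k ≠ m + 2 := by omega
    simp only [hk', if_false]
    rcases (show k < m + 1 ∨ k = m + 1 by omega) with h | rfl
    · have h2 : ¬ (k + 1 = m + 2) := by omega
      simp only [h2, if_false]
      exact (hb k h).mono fun h => (hE' _ _).2 (Or.inl h)
    · simp only [if_true, Nat.bodd_succ, hmodd]
      simpa [AltStep] using (hE' _ _).2 (Or.inr (Or.inr ⟨hqm, hq0⟩))
  · intro k l hk hl h
    have hk' : ¬ (k = m + 2) := by omega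
    have hl' : ¬ (l = m + 2) := by omega
    simp only [hk', hl', if_false] at h
    exact he k l (by omega) (by omega) h
  · intro k l hkl hl hn
    have hk' : ¬ (k = m + 2) := by omega
    have hl' : ¬ (l = m + 2) := by omega
    simp only [hk', hl', if_false]
    have key : ¬ E' (q k) (q l) := by
      rw [hE']
      rintro (h | ⟨h1, h2⟩ | ⟨h1, h2⟩)
      · exact hc k l hkl (by omega) h
      · have e1 : k = 0 := by
          by_contra h
          exact hqA k (by omega) (by omega) h1
        have e2 : l = m + 1 := by
          by_contra h
          exact hqB l (by omega) h2
        exact hn ⟨e1, by omega⟩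
      · exact hqB k (by omega) h1
    refine ⟨key, fun h => key ?_⟩
    rw [hE'] at h ⊢
    rcases h with h | h | h
    · exact Or.inl (hs _ _ h)
    · exact Or.inr (Or.inr h.symm)
    · exact Or.inr (Or.inl h.symm)

/-- Completely joining two unions of components `A` and `B` creates no new room for cycles: a
chordless cycle before implies one after. -/
theorem CCycle.of_join {A B : Set V} {n : ℕ} {p : ℕ → V} (hp : CCycle L E n p)
    (hs : ∀ x y, E x y → E y x) (hAB : ∀ x ∈ A, x ∉ B)
    (hE' : ∀ x y, E' x y ↔ E x y ∨ (x ∈ A ∧ y ∈ B) ∨ (x ∈ B ∧ y ∈ A))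
    (hA : ∀ x y, E x y → (x ∈ A ↔ y ∈ A)) (hB : ∀ x y, E x y → (x ∈ B ↔ y ∈ B)) :
    ∃ m q, CCycle L E' m q := by
  by_cases h : (∃ k ≤ n, p k ∈ A) ∧ ∃ k ≤ n, p k ∈ B
  · obtain ⟨⟨k, hk, hkA⟩, ⟨l, hl, hlB⟩⟩ := h
    have red : ∀ C : Set V, (∃ k ≤ n, p k ∈ C) → ∃ k < n, p k ∈ C := by
      rintro C ⟨k, hk, hkC⟩
      rcases hk.lt_or_eq with h | rfl
      · exact ⟨k, h, hkC⟩
      · exact ⟨0, hp.pos, hp.closed ▸ hkC⟩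
    obtain ⟨k, hk, hkA⟩ := red A ⟨k, hk, hkA⟩
    obtain ⟨l, hl, hlB⟩ := red B ⟨l, hl, hlB⟩
    have main : ∀ (C D : Set V) (k l : ℕ), (∀ x ∈ C, x ∉ D) →
        (∀ x y, E' x y ↔ E x y ∨ (x ∈ C ∧ y ∈ D) ∨ (x ∈ D ∧ y ∈ C)) →
        (∀ x y, E x y → (x ∈ C ↔ y ∈ C)) → (∀ x y, E x y → (x ∈ D ↔ y ∈ D)) →
        k < l → l < n → p k ∈ C → p l ∈ D → ∃ m q, CCycle L E' m q := by
      intro C D k l hCD hE' hC hD hkl hl hkC hlD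
      have hsub : CPath L E (l - k) fun i => p (k + i) := by
        obtain ⟨b, hb⟩ := hp.alternating
        refine ⟨⟨b ^^ k.bodd, fun i hi => ?_⟩, fun i j hi hj h => ?_, fun i j hij hj h => ?_⟩
        · have := hb (k + i) (by omega)
          rwa [Nat.bodd_add, ← Bool.xor_assoc] at this
        · have := hp.elementary _ _ (by omega) (by omega) h
          omega
        -- The only forward edge that chordlessness of the cycle fails to exclude is one from its
        -- first to its last listed vertex. Such an edge would run from `C` to `D`, against closure
        -- of `C` under edges.
        · by_cases hbd : k + i = 0 ∧ k + j + 1 = n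
          · have h1 : p (k + i) ∈ C := by
              convert hkC using 2
              omega
            have h2 : p (k + j) ∈ D := by
              convert hlD using 2
              omega
            exact hCD _ ((hC _ _ h).1 h1) h2
          · exact (hp.chordless _ _ (by omega) (by omega) hbd).1 h
      refine hsub.cycle_of_join hs hCD hE' hC hD (by simpa using hkC) ?_
      convert hlD using 2
      omega
    rcases lt_trichotomy k l with h | rfl | h
    · exact main A B k l hAB hE' hA hB h hl hkA hlB
    · exact absurd hlB (hAB _ hkA)
    · refine main B A l k (fun x h h' => hAB x h' h) (fun x y => ?_) hB hA h hk hlB hkA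
      rw [hE' x y]
      tauto
  -- The cycle misses `A` or `B`, so the old and the new edges agree on it.
  · refine ⟨n, p, hp.congr fun i j hi hj => ?_⟩
    rw [hE']
    constructor
    · exact Or.inl
    · rintro (h' | ⟨h1, h2⟩ | ⟨h1, h2⟩)
      · exact h'
      · exact absurd ⟨⟨i, hi, h1⟩, ⟨j, hj, h2⟩⟩ h
      · exact absurd ⟨⟨j, hj, h2⟩, ⟨i, hi, h1⟩⟩ h

end Paths

/-! ## Located formulas -/

/-- Formulas whose atoms, constants and modalities are vertices. -/
inductive Occ (V : Type v) : Type v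
  | atom : V → Occ V
  | par : Occ V → Occ V → Occ V
  | tens : Occ V → Occ V → Occ V
  | mod : V → Occ V → Occ V

namespace Occ

variable {V : Type v}

/-- All vertices. -/
def verts : Occ V → Multiset V
  | atom x => {x}
  | par A B => A.verts + B.verts
  | tens A B => A.verts + B.verts
  | mod x A => x ::ₘ A.verts

/-- The vertices that are not below a modality. -/
def overts : Occ V → Multiset V
  | atom x => {x}
  | par A B => A.overts + B.overts
  | tens A B => A.overts + B.overts
  | mod x _ => {x}

/-- The maximal subformulas that are not a `par` or a `tens`. -/
def leaves : Occ V → Multiset (Occ V)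
  | atom x => {atom x}
  | par A B => A.leaves + B.leaves
  | tens A B => A.leaves + B.leaves
  | mod x A => {mod x A}

/-- The undirected edges. -/
def und : Occ V → V → V → Prop
  | atom _, _, _ => False
  | par A B, x, y => A.und x y ∨ B.und x y
  | tens A B, x, y => (A.und x y ∨ B.und x y) ∨
      (x ∈ A.verts ∧ y ∈ B.verts) ∨ (x ∈ B.verts ∧ y ∈ A.verts)
  | mod _ A, x, y => A.und x y

/-- The directed edges. -/
def dir : Occ V → V → V → Prop
  | atom _, _, _ => False
  | par A B, x, y => A.dir x y ∨ B.dir x y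
  | tens A B, x, y => A.dir x y ∨ B.dir x y
  | mod z A, x, y => (x = z ∧ y ∈ A.verts) ∨ A.dir x y

/-- The undirected edges between vertices that are not below a modality. -/
def ound : Occ V → V → V → Prop
  | atom _, _, _ => False
  | par A B, x, y => A.ound x y ∨ B.ound x y
  | tens A B, x, y => (A.ound x y ∨ B.ound x y) ∨
      (x ∈ A.overts ∧ y ∈ B.overts) ∨ (x ∈ B.overts ∧ y ∈ A.overts)
  | mod _ _, _, _ => False

/-- All edges. -/
def edge (T : Occ V) (x y : V) : Prop := T.und x y ∨ T.dir x y

theorem overts_le_verts (T : Occ V) : T.overts ≤ T.verts := by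
  induction T with
  | atom x => exact le_rfl
  | par A B ihA ihB => exact add_le_add ihA ihB
  | tens A B ihA ihB => exact add_le_add ihA ihB
  | mod x A ih => simp [overts, verts]

theorem exists_mem_overts (T : Occ V) : ∃ x, x ∈ T.overts := by
  induction T with
  | atom x => exact ⟨x, by simp [overts]⟩
  | par A B ihA ihB => exact ihA.imp fun x h => by simp [overts, h]
  | tens A B ihA ihB => exact ihA.imp fun x h => by simp [overts, h]
  | mod x A ih => exact ⟨x, by simp [overts]⟩

theorem ound_symm {T : Occ V} {x y : V} (h : T.ound x y) : T.ound y x := by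
  induction T with
  | atom z => exact h
  | par A B ihA ihB => exact h.imp ihA ihB
  | tens A B ihA ihB =>
    rcases h with (h | h) | h | h
    · exact Or.inl (Or.inl (ihA h))
    · exact Or.inl (Or.inr (ihB h))
    · exact Or.inr (Or.inr h.symm)
    · exact Or.inr (Or.inl h.symm)
  | mod z A ih => exact h

theorem mem_of_und {T : Occ V} {x y : V} (h : T.und x y) : x ∈ T.verts ∧ y ∈ T.verts := by
  induction T with
  | atom z => exact h.elim
  | par A B ihA ihB =>
    simp only [und, verts, Multiset.mem_add] at *
    tauto
  | tens A B ihA ihB =>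
    simp only [und, verts, Multiset.mem_add] at *
    tauto
  | mod z A ih =>
    simp only [und, verts, Multiset.mem_cons] at *
    tauto

theorem mem_of_dir {T : Occ V} {x y : V} (h : T.dir x y) : x ∈ T.verts ∧ y ∈ T.verts := by
  induction T with
  | atom z => exact h.elim
  | par A B ihA ihB =>
    simp only [dir, verts, Multiset.mem_add] at *
    tauto
  | tens A B ihA ihB =>
    simp only [dir, verts, Multiset.mem_add] at *
    tauto
  | mod z A ih =>
    simp only [dir, verts, Multiset.mem_cons] at *
    tauto

theorem mem_of_ound {T : Occ V} {x y : V} (h : T.ound x y) : x ∈ T.overts ∧ y ∈ T.overts := by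
  induction T with
  | atom z => exact h.elim
  | par A B ihA ihB =>
    simp only [ound, overts, Multiset.mem_add] at *
    tauto
  | tens A B ihA ihB =>
    simp only [ound, overts, Multiset.mem_add] at *
    tauto
  | mod z A ih => exact h.elim

theorem mem_of_edge {T : Occ V} {x y : V} (h : T.edge x y) : x ∈ T.verts ∧ y ∈ T.verts :=
  h.elim mem_of_und mem_of_dir

end Occ

/-! ## Located sequents -/

section Sequents

variable {V : Type v}

/-- The vertices of a sequent. -/
def sverts (S : Multiset (Occ V)) : Multiset V := S.bind Occ.verts

/-- The vertices of a sequent that are not below a modality. -/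
def soverts (S : Multiset (Occ V)) : Multiset V := S.bind Occ.overts

/-- The edges of a sequent. -/
def sedge (S : Multiset (Occ V)) (x y : V) : Prop := ∃ T ∈ S, T.edge x y

/-- The directed edges of a sequent. -/
def sdir (S : Multiset (Occ V)) (x y : V) : Prop := ∃ T ∈ S, T.dir x y

/-- The edges of a sequent between vertices that are not below a modality. -/
def sound (S : Multiset (Occ V)) (x y : V) : Prop := ∃ T ∈ S, T.ound x y

@[simp] theorem sverts_zero : sverts (0 : Multiset (Occ V)) = 0 := Multiset.zero_bind _
@[simp] theorem soverts_zero : soverts (0 : Multiset (Occ V)) = 0 := Multiset.zero_bind _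
@[simp] theorem sverts_cons (T : Occ V) (S) : sverts (T ::ₘ S) = T.verts + sverts S :=
  Multiset.cons_bind _ _ _
@[simp] theorem soverts_cons (T : Occ V) (S) : soverts (T ::ₘ S) = T.overts + soverts S :=
  Multiset.cons_bind _ _ _
@[simp] theorem sverts_add (S T : Multiset (Occ V)) : sverts (S + T) = sverts S + sverts T :=
  Multiset.add_bind _ _ _
@[simp] theorem soverts_add (S T : Multiset (Occ V)) : soverts (S + T) = soverts S + soverts T :=
  Multiset.add_bind _ _ _

theorem mem_sverts {S : Multiset (Occ V)} {x : V} : x ∈ sverts S ↔ ∃ T ∈ S, x ∈ T.verts :=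
  Multiset.mem_bind

theorem mem_soverts {S : Multiset (Occ V)} {x : V} : x ∈ soverts S ↔ ∃ T ∈ S, x ∈ T.overts :=
  Multiset.mem_bind

@[simp] theorem sedge_cons {T : Occ V} {S} {x y : V} :
    sedge (T ::ₘ S) x y ↔ T.edge x y ∨ sedge S x y := by
  simp [sedge]

@[simp] theorem sedge_add {S T : Multiset (Occ V)} {x y : V} :
    sedge (S + T) x y ↔ sedge S x y ∨ sedge T x y := by
  simp only [sedge, Multiset.mem_add, or_and_right, exists_or]

@[simp] theorem sdir_cons {T : Occ V} {S} {x y : V} :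
    sdir (T ::ₘ S) x y ↔ T.dir x y ∨ sdir S x y := by
  simp [sdir]

@[simp] theorem sdir_add {S T : Multiset (Occ V)} {x y : V} :
    sdir (S + T) x y ↔ sdir S x y ∨ sdir T x y := by
  simp only [sdir, Multiset.mem_add, or_and_right, exists_or]

@[simp] theorem sound_cons {T : Occ V} {S} {x y : V} :
    sound (T ::ₘ S) x y ↔ T.ound x y ∨ sound S x y := by
  simp [sound]

@[simp] theorem sound_add {S T : Multiset (Occ V)} {x y : V} :
    sound (S + T) x y ↔ sound S x y ∨ sound T x y := by
  simp only [sound, Multiset.mem_add, or_and_right, exists_or]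

theorem mem_of_sedge {S : Multiset (Occ V)} {x y : V} (h : sedge S x y) :
    x ∈ sverts S ∧ y ∈ sverts S := by
  obtain ⟨T, hT, h⟩ := h
  exact ⟨mem_sverts.2 ⟨T, hT, (Occ.mem_of_edge h).1⟩, mem_sverts.2 ⟨T, hT, (Occ.mem_of_edge h).2⟩⟩

theorem mem_of_sdir {S : Multiset (Occ V)} {x y : V} (h : sdir S x y) :
    x ∈ sverts S ∧ y ∈ sverts S := by
  obtain ⟨T, hT, h⟩ := h
  exact ⟨mem_sverts.2 ⟨T, hT, (Occ.mem_of_dir h).1⟩, mem_sverts.2 ⟨T, hT, (Occ.mem_of_dir h).2⟩⟩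

theorem mem_of_sound {S : Multiset (Occ V)} {x y : V} (h : sound S x y) :
    x ∈ soverts S ∧ y ∈ soverts S := by
  obtain ⟨T, hT, h⟩ := h
  exact ⟨mem_soverts.2 ⟨T, hT, (Occ.mem_of_ound h).1⟩,
    mem_soverts.2 ⟨T, hT, (Occ.mem_of_ound h).2⟩⟩

theorem sound_symm {S : Multiset (Occ V)} {x y : V} (h : sound S x y) : sound S y x := by
  obtain ⟨T, hT, h⟩ := h
  exact ⟨T, hT, Occ.ound_symm h⟩

theorem soverts_le_sverts (S : Multiset (Occ V)) : soverts S ≤ sverts S := by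
  induction S using Multiset.induction with
  | empty => simp
  | cons T S ih => simpa using add_le_add T.overts_le_verts ih

@[simp] theorem sverts_map_atom (s : Multiset V) : sverts (s.map Occ.atom) = s := by
  induction s using Multiset.induction with
  | empty => simp
  | cons x s ih => simp [ih, Occ.verts]

@[simp] theorem soverts_map_atom (s : Multiset V) : soverts (s.map Occ.atom) = s := by
  induction s using Multiset.induction with
  | empty => simp
  | cons x s ih => simp [ih, Occ.overts]

@[simp] theorem sverts_map_mod (L : Multiset (V × Occ V)) :
    sverts (L.map fun q => Occ.mod q.1 q.2) = L.map Prod.fst + sverts (L.map Prod.snd) := by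
  induction L using Multiset.induction with
  | empty => simp
  | cons x s ih =>
    simp only [Multiset.map_cons, sverts_cons, Occ.verts, ih, Multiset.cons_add]
    rw [add_left_comm]

@[simp] theorem soverts_map_mod (L : Multiset (V × Occ V)) :
    soverts (L.map fun q => Occ.mod q.1 q.2) = L.map Prod.fst := by
  induction L using Multiset.induction with
  | empty => simp
  | cons x s ih => simp [ih, Occ.overts]

/-- Derivability of a located sequent, relative to a linking; the mix rules are present if `m` is
true. -/
inductive NDer (m : Bool) (link : Setoid V) : Multiset (Occ V) → Prop
  | cls (s : Multiset V) (c : V) (h : ∀ x, x ∈ s ↔ link c x) : NDer m link (s.map Occ.atom)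
  | box (L : Multiset (V × Occ V)) (c : V) (h : ∀ x, x ∈ L.map Prod.fst ↔ link c x) :
      NDer m link (L.map Prod.snd) → NDer m link (L.map fun q => Occ.mod q.1 q.2)
  | par (A B : Occ V) (S : Multiset (Occ V)) :
      NDer m link (A ::ₘ B ::ₘ S) → NDer m link (Occ.par A B ::ₘ S)
  | tens (A B : Occ V) (S T : Multiset (Occ V)) :
      NDer m link (A ::ₘ S) → NDer m link (B ::ₘ T) → NDer m link (Occ.tens A B ::ₘ (S + T))
  | nil (h : m = true) : NDer m link 0
  | mix (h : m = true) (S T : Multiset (Occ V)) :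
      NDer m link S → NDer m link T → NDer m link (S + T)

/-- Axioms and boxes introduce whole linking classes, and the other rules only collect vertices of
their premises. -/
theorem NDer.soverts_closed {m : Bool} {link : Setoid V} {S : Multiset (Occ V)}
    (h : NDer m link S) : ∀ x ∈ soverts S, ∀ y, link x y → y ∈ soverts S := by
  induction h with
  | cls s c h =>
    simp only [soverts_map_atom, h]
    exact fun x hx y hy => link.trans hx hy
  | box L c h =>
    simp only [soverts_map_mod, h]
    exact fun x hx y hy => link.trans hx hy
  | par A B S _ ih => simpa [Occ.overts, add_assoc] using ih
  | tens A B S T _ _ ih1 ih2 =>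
    intro x hx y hy
    simp only [soverts_cons, soverts_add, Occ.overts, Multiset.mem_add] at ih1 ih2 hx ⊢
    have h1 := fun h => ih1 x h y hy
    have h2 := fun h => ih2 x h y hy
    tauto
  | nil => simp
  | mix h S T _ _ ih1 ih2 =>
    intro x hx y hy
    simp only [soverts_add, Multiset.mem_add] at hx ⊢
    exact hx.imp (fun h => ih1 x h y hy) (fun h => ih2 x h y hy)

theorem NDer.sverts_closed {m : Bool} {link : Setoid V} {S : Multiset (Occ V)}
    (h : NDer m link S) : ∀ x ∈ sverts S, ∀ y, link x y → y ∈ sverts S := by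
  induction h with
  | cls s c h =>
    simp only [sverts_map_atom, h]
    exact fun x hx y hy => link.trans hx hy
  | box L c h _ ih =>
    intro x hx y hy
    simp only [sverts_map_mod, Multiset.mem_add, h] at hx ⊢
    exact hx.imp (fun h => link.trans h hy) (fun h => ih x h y hy)
  | par A B S _ ih => simpa [Occ.verts, add_assoc] using ih
  | tens A B S T _ _ ih1 ih2 =>
    intro x hx y hy
    simp only [sverts_cons, sverts_add, Occ.verts, Multiset.mem_add] at ih1 ih2 hx ⊢
    have h1 := fun h => ih1 x h y hy
    have h2 := fun h => ih2 x h y hy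
    tauto
  | nil => simp
  | mix h S T _ _ ih1 ih2 =>
    intro x hx y hy
    simp only [sverts_add, Multiset.mem_add] at hx ⊢
    exact hx.imp (fun h => ih1 x h y hy) (fun h => ih2 x h y hy)

end Sequents

/-! ## Splitting a derivation along unconnected conclusions -/

section Split

variable {V : Type v} {link : Setoid V}

/-- There is a chordless path from `T` to `T'` among the outer vertices of `S`. -/
def Conn (link : Setoid V) (S : Multiset (Occ V)) (T T' : Occ V) : Prop :=
  ∃ n p, CPath link (sound S) n p ∧ p 0 ∈ T.overts ∧ p n ∈ T'.overts

theorem Conn.symm {S : Multiset (Occ V)} {T T' : Occ V} (h : Conn link S T T') :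
    Conn link S T' T := by
  obtain ⟨n, p, hp, h0, hn⟩ := h
  exact ⟨n, _, hp.reverse (fun x y => link.symm) (fun x y => sound_symm), by simpa, by simpa⟩

/-- Since `soverts S` is closed under links, a path that starts there never leaves it, so only the
edges within `S` matter. -/
theorem Conn.mono {S S' : Multiset (Occ V)} {T T' U U' : Occ V} (h : Conn link S T T')
    (hT : ∀ x ∈ T.overts, x ∈ soverts S) (hcl : ∀ x ∈ soverts S, ∀ y, link x y → y ∈ soverts S)
    (hE : ∀ x ∈ soverts S, ∀ y ∈ soverts S, (sound S x y ↔ sound S' x y))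
    (hU : ∀ x ∈ T.overts, x ∈ U.overts) (hU' : ∀ x ∈ T'.overts, x ∈ U'.overts) :
    Conn link S' U U' := by
  obtain ⟨n, p, hp, h0, hn⟩ := h
  have hm := hp.mem (X := {x | x ∈ soverts S}) hcl (fun x _ y h => (mem_of_sound h).2) (hT _ h0)
  exact ⟨n, p, hp.congr fun i j hi hj => hE _ (hm i hi) _ (hm j hj), hU _ h0, hU' _ hn⟩

theorem Conn.of_link {S : Multiset (Occ V)} {T T' : Occ V} {x y : V} (hx : x ∈ T.overts)
    (hy : y ∈ T'.overts) (h : link x y) : Conn link S T T' := by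
  by_cases hxy : x = y
  · exact ⟨0, _, CPath.single x, hx, hxy ▸ hy⟩
  · exact ⟨1, _, CPath.pair (b := true) (by simpa [AltStep] using ⟨h, hxy⟩) hxy, by simpa, by simpa⟩

theorem sound_iff_of_disjoint {S T : Multiset (Occ V)} (hd : Disjoint (soverts S) (soverts T))
    {x y : V} (hx : x ∈ soverts S) : sound S x y ↔ sound (S + T) x y := by
  rw [sound_add]
  refine ⟨Or.inl, fun h => h.elim id fun h => ?_⟩
  exact absurd (mem_of_sound h).1 (Multiset.disjoint_left.1 hd hx)

theorem soverts_tens_nodup {A B : Occ V} {S T : Multiset (Occ V)}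
    (h : (soverts (Occ.tens A B ::ₘ (S + T))).Nodup) :
    (soverts (A ::ₘ S)).Nodup ∧ (soverts (B ::ₘ T)).Nodup ∧
      Disjoint (soverts (A ::ₘ S)) (soverts (B ::ₘ T)) := by
  rw [← Multiset.nodup_add]
  convert h using 1
  simp [Occ.overts, add_add_add_comm]

theorem sound_tens_left {A B : Occ V} {S T : Multiset (Occ V)}
    (hd : Disjoint (soverts (A ::ₘ S)) (soverts (B ::ₘ T))) {x y : V}
    (hx : x ∈ soverts (A ::ₘ S)) (hy : y ∈ soverts (A ::ₘ S)) :
    sound (A ::ₘ S) x y ↔ sound (Occ.tens A B ::ₘ (S + T)) x y := by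
  have h1 := Multiset.disjoint_left.1 hd hx
  have h2 := Multiset.disjoint_left.1 hd hy
  have h3 := fun h => h1 (mem_of_sound (S := B ::ₘ T) (y := y) h).1
  simp only [sound_cons, sound_add, soverts_cons, Multiset.mem_add, Occ.ound] at *
  tauto

theorem sound_tens_right {A B : Occ V} {S T : Multiset (Occ V)}
    (hd : Disjoint (soverts (A ::ₘ S)) (soverts (B ::ₘ T))) {x y : V}
    (hx : x ∈ soverts (B ::ₘ T)) (hy : y ∈ soverts (B ::ₘ T)) :
    sound (B ::ₘ T) x y ↔ sound (Occ.tens A B ::ₘ (S + T)) x y := by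
  have h1 := Multiset.disjoint_right.1 hd hx
  have h2 := Multiset.disjoint_right.1 hd hy
  have h3 := fun h => h1 (mem_of_sound (S := A ::ₘ S) (y := y) h).1
  simp only [sound_cons, sound_add, soverts_cons, Multiset.mem_add, Occ.ound] at *
  tauto

/-- The two paths are concatenated through one of the new edges between `A` and `B`. This is how
connections in the two premises become a connection in the conclusion of a tensor. -/
theorem Conn.join {A B T₁ T₂ : Occ V} {S T : Multiset (Occ V)}
    (hn : (soverts (Occ.tens A B ::ₘ (S + T))).Nodup)
    (hS : ∀ x ∈ soverts (A ::ₘ S), ∀ y, link x y → y ∈ soverts (A ::ₘ S))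
    (hT : ∀ x ∈ soverts (B ::ₘ T), ∀ y, link x y → y ∈ soverts (B ::ₘ T))
    (h₁ : T₁ ∈ S) (h : Conn link (A ::ₘ S) T₁ A) (h' : Conn link (B ::ₘ T) B T₂) :
    Conn link (Occ.tens A B ::ₘ (S + T)) T₁ T₂ := by
  obtain ⟨n1, n2, hd⟩ := soverts_tens_nodup hn
  obtain ⟨n, p, hp, h0, hpn⟩ := h
  obtain ⟨m, q, hq, h0', hqm⟩ := h'
  have hpm := hp.mem (X := {x | x ∈ soverts (A ::ₘ S)}) hS (fun x _ y h => (mem_of_sound h).2)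
    (by
      simp only [soverts_cons, Multiset.mem_add, Set.mem_ofPred_eq]
      exact Or.inr (mem_soverts.2 ⟨_, h₁, h0⟩))
  have hqm' := hq.mem (X := {x | x ∈ soverts (B ::ₘ T)}) hT (fun x _ y h => (mem_of_sound h).2)
    (by
      simp only [soverts_cons, Multiset.mem_add, Set.mem_ofPred_eq]
      exact Or.inl h0')
  have hp' := hp.congr (E' := sound (Occ.tens A B ::ₘ (S + T)))
    fun i j hi hj => sound_tens_left hd (hpm i hi) (hpm j hj)
  have hq' := hq.congr (E' := sound (Occ.tens A B ::ₘ (S + T)))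
    fun i j hi hj => sound_tens_right hd (hqm' i hi) (hqm' j hj)
  simp only [soverts_cons] at n1 n2
  have d1 : ∀ x ∈ A.overts, x ∉ soverts S :=
    fun x hx => Multiset.disjoint_left.1 (Multiset.nodup_add.1 n1).2.2 hx
  have d2 : ∀ x ∈ B.overts, x ∉ soverts T :=
    fun x hx => Multiset.disjoint_left.1 (Multiset.nodup_add.1 n2).2.2 hx
  obtain ⟨k, r, hr, hr0, hrk⟩ := hp'.exists_join hq' (A := {x | x ∈ A.overts})
    (B := {x | x ∈ B.overts}) hpm hqm' (fun x hx hx' => Multiset.disjoint_left.1 hd hx hx')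
    (by
      intro x hx y hy
      have h1 := Multiset.disjoint_left.1 hd hx
      have h2 := Multiset.disjoint_right.1 hd hy
      have h3 := fun h => h2 (mem_of_sound (S := A ::ₘ S) (x := x) h).2
      have h4 := fun h => h1 (mem_of_sound (S := B ::ₘ T) (y := y) h).1
      simp only [sound_cons, sound_add, soverts_cons, Multiset.mem_add, Occ.ound,
        Set.mem_ofPred_eq] at *
      tauto)
    (by
      intro x hx y hy hxA h
      have h1 := Multiset.disjoint_left.1 hd hx
      have h4 := fun h => h1 (mem_of_sound (S := B ::ₘ T) (y := y) h).1
      have h5 := d1 y hy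
      have h6 := fun h => h5 (mem_of_sound (S := S) (x := x) h).2
      have h7 := fun h => hxA (Occ.mem_of_ound (T := A) (y := y) h).1
      simp only [sound_cons, sound_add, soverts_cons, Multiset.mem_add, Occ.ound,
        Set.mem_ofPred_eq] at *
      tauto)
    (by
      intro x hx y hy hyB h
      have h1 := Multiset.disjoint_right.1 hd hy
      have h4 := fun h => h1 (mem_of_sound (S := A ::ₘ S) (x := x) h).2
      have h5 := d2 x hx
      have h6 := fun h => h5 (mem_of_sound (S := T) (y := y) h).1
      have h7 := fun h => hyB (Occ.mem_of_ound (T := B) (x := x) h).2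
      simp only [sound_cons, sound_add, soverts_cons, Multiset.mem_add, Occ.ound,
        Set.mem_ofPred_eq] at *
      tauto) hpn h0'
  exact ⟨k, r, hr, hr0 ▸ h0, hrk ▸ hqm⟩

variable {ι : Type}

open Classical in
/-- The formulas of colour `o`. -/
noncomputable def grp (S : Multiset (Option ι × Occ V)) (o : Option ι) : Multiset (Occ V) :=
  (S.filter fun q => q.1 = o).map Prod.snd

@[simp] theorem grp_add (S T : Multiset (Option ι × Occ V)) (o : Option ι) :
    grp (S + T) o = grp S o + grp T o := by
  simp [grp]

theorem grp_cons_self (S : Multiset (Option ι × Occ V)) (o : Option ι) (T : Occ V) :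
    grp ((o, T) ::ₘ S) o = T ::ₘ grp S o := by
  simp [grp]

theorem grp_cons_ne (S : Multiset (Option ι × Occ V)) {o o' : Option ι} (h : o' ≠ o) (T : Occ V) :
    grp ((o', T) ::ₘ S) o = grp S o := by
  simp [grp, h]

theorem grp_eq_zero {S : Multiset (Option ι × Occ V)} {o : Option ι}
    (h : ∀ q ∈ S, q.1 ≠ o) : grp S o = 0 := by
  simp only [grp, Multiset.map_eq_zero, Multiset.filter_eq_nil]
  exact h

theorem grp_none_add {S : Multiset (Option ι × Occ V)} {i : ι}
    (h : ∀ q ∈ S, q.1 = none ∨ q.1 = some i) :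
    grp S none + grp S (some i) = S.map Prod.snd := by
  induction S using Multiset.induction with
  | empty => simp [grp]
  | cons q S ih =>
    have ih := ih fun q hq => h q (Multiset.mem_cons_of_mem hq)
    obtain ⟨o, T⟩ := q
    rcases h _ (Multiset.mem_cons_self _ _) with rfl | rfl
    · rw [grp_cons_self, grp_cons_ne _ (by simp), Multiset.map_cons, ← ih, Multiset.cons_add]
    · rw [grp_cons_self, grp_cons_ne _ (by simp), Multiset.map_cons, ← ih, Multiset.add_cons]

/-- The same colours, with room for a new one. -/
def recolor (S : Multiset (Option ι × Occ V)) : Multiset (Option (Option ι) × Occ V) :=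
  S.map fun q => (q.1.map some, q.2)

theorem recolor_snd (S : Multiset (Option ι × Occ V)) :
    (recolor S).map Prod.snd = S.map Prod.snd := by
  simp [recolor]

theorem mem_recolor {S : Multiset (Option ι × Occ V)} {o : Option (Option ι)} {T : Occ V} :
    (o, T) ∈ recolor S ↔ ∃ c, (c, T) ∈ S ∧ o = c.map some := by
  simp only [recolor, Multiset.mem_map, Prod.exists, Prod.mk.injEq]
  exact ⟨fun ⟨c, U, h, h1, h2⟩ => ⟨c, h2 ▸ h, h1.symm⟩, fun ⟨c, h, h1⟩ => ⟨c, T, h, h1.symm, rfl⟩⟩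

theorem grp_recolor_map (S : Multiset (Option ι × Occ V)) (o : Option ι) :
    grp (recolor S) (o.map some) = grp S o := by
  induction S using Multiset.induction with
  | empty => simp [grp, recolor]
  | cons q S ih =>
    obtain ⟨c, T⟩ := q
    have e : recolor ((c, T) ::ₘ S) = (c.map some, T) ::ₘ recolor S := by simp [recolor]
    rw [e]
    by_cases h : c = o
    · rw [h, grp_cons_self, grp_cons_self, ih]
    · rw [grp_cons_ne _ h, grp_cons_ne, ih]
      exact fun h' => h (Option.map_injective (Option.some_injective _) h')

theorem grp_recolor_new (S : Multiset (Option ι × Occ V)) :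
    grp (recolor S) (some none) = 0 := by
  refine grp_eq_zero fun q hq h => ?_
  obtain ⟨o, T⟩ := q
  obtain ⟨c, -, hc⟩ := mem_recolor.1 hq
  obtain rfl : o = some none := h
  cases c <;> simp at hc

/-- Differently coloured formulas are not connected. -/
def Apart (link : Setoid V) (N : Multiset (Occ V)) (S : Multiset (Option ι × Occ V)) : Prop :=
  ∀ i j, i ≠ j → ∀ T T', (some i, T) ∈ S → (some j, T') ∈ S → ¬ Conn link N T T'

/-- The derivation splits along the colours. -/
def Splits [Fintype ι] (link : Setoid V) (S : Multiset (Option ι × Occ V)) : Prop :=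
  ∃ Θ : ι → Multiset (Occ V), (∀ i, NDer true link (Θ i + grp S (some i))) ∧
    ∀ Ξ, NDer true link ((∑ i, Θ i) + Ξ) → NDer true link (grp S none + Ξ)

/-- Pairwise connected formulas carry at most one colour, so nothing has to be cut. This covers
axioms, boxes and the empty sequent. -/
theorem splits_of_conn [Fintype ι] {S : Multiset (Option ι × Occ V)}
    (h : NDer true link (S.map Prod.snd)) (hS : Apart link (S.map Prod.snd) S)
    (hc : ∀ T ∈ S.map Prod.snd, ∀ T' ∈ S.map Prod.snd, Conn link (S.map Prod.snd) T T') :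
    Splits link S := by
  classical
  by_cases hex : ∃ i T, (some i, T) ∈ S
  · obtain ⟨i, T, hi⟩ := hex
    have hall : ∀ q ∈ S, q.1 = none ∨ q.1 = some i := by
      rintro ⟨_ | j, U⟩ hq
      · exact Or.inl rfl
      · refine Or.inr ?_
        by_contra hne
        refine hS j i (fun h => hne (by rw [h])) U T hq hi (hc _ ?_ _ ?_)
        · exact Multiset.mem_map_of_mem Prod.snd hq
        · exact Multiset.mem_map_of_mem Prod.snd hi
    -- All neutral formulas go to the only colour in use; every other colour receives the empty
    -- sequent.
    refine ⟨Function.update 0 i (grp S none), fun j => ?_, fun Ξ hΞ => ?_⟩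
    · by_cases hj : j = i
      · subst hj
        rw [Function.update_self, grp_none_add hall]
        exact h
      · rw [Function.update_of_ne hj, grp_eq_zero]
        · exact NDer.nil rfl
        · rintro q hq hqj
          rcases hall q hq with h' | h' <;> rw [h'] at hqj <;> simp at hqj
          exact hj hqj.symm
    · rw [Finset.sum_update_of_mem (Finset.mem_univ i)] at hΞ
      simpa using hΞ
  · push Not at hex
    refine ⟨0, fun i => ?_, fun Ξ hΞ => ?_⟩
    · rw [grp_eq_zero]
      · exact NDer.nil rfl
      · rintro ⟨o, T⟩ hq rfl
        exact hex i T hq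
    · refine NDer.mix rfl _ _ ?_ (by simpa using hΞ)
      convert h using 1
      rw [grp, Multiset.filter_eq_self.2]
      rintro ⟨_ | j, T⟩ hq
      · rfl
      · exact absurd hq (hex j T)

end Split

/-! ### Splitting a derivation: the tensor cases and the induction -/

section Split

variable {V : Type v} {link : Setoid V} {ι : Type}

theorem map_eq_cons_iff' {α β : Type*} {f : α → β} {s : Multiset α} {b : β} {t : Multiset β}
    (h : s.map f = b ::ₘ t) : ∃ a s', s = a ::ₘ s' ∧ f a = b ∧ s'.map f = t := by
  have hb : b ∈ s.map f := h ▸ Multiset.mem_cons_self b t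
  obtain ⟨a, ha, rfl⟩ := Multiset.mem_map.1 hb
  obtain ⟨s', rfl⟩ := Multiset.exists_cons_of_mem ha
  exact ⟨a, s', rfl, rfl, by simpa using h⟩

theorem map_eq_add_iff' {α β : Type*} {f : α → β} {s : Multiset α} {t u : Multiset β}
    (h : s.map f = t + u) : ∃ s₁ s₂, s = s₁ + s₂ ∧ s₁.map f = t ∧ s₂.map f = u := by
  induction t using Multiset.induction generalizing s with
  | empty => exact ⟨0, s, by simp, by simp, by simpa using h⟩
  | cons b t ih =>
    rw [Multiset.cons_add] at h
    obtain ⟨a, s', rfl, rfl, h'⟩ := map_eq_cons_iff' h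
    obtain ⟨s₁, s₂, rfl, rfl, rfl⟩ := ih h'
    exact ⟨a ::ₘ s₁, s₂, by simp, by simp, rfl⟩

theorem mem_soverts_of_mem {S : Multiset (Occ V)} {T : Occ V} (hT : T ∈ S) :
    ∀ x ∈ T.overts, x ∈ soverts S := fun _ hx => mem_soverts.2 ⟨T, hT, hx⟩

/-- A tensor of an uncoloured or coloured pair, where the second premise has its own colour or
the colour of its partner. -/
theorem Splits.tens_new [Fintype ι] {A B C : Occ V} {S T : Multiset (Option ι × Occ V)}
    (htens : ∀ Δ Δ', NDer true link (A ::ₘ Δ) → NDer true link (B ::ₘ Δ') →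
      NDer true link (C ::ₘ (Δ + Δ')))
    (hS : Splits link ((none, A) ::ₘ S)) (hT : Splits link ((some none, B) ::ₘ recolor T)) :
    Splits link ((none, C) ::ₘ (S + T)) := by
  obtain ⟨Θ, h1, h2⟩ := hS
  obtain ⟨Λ, h3, h4⟩ := hT
  refine ⟨fun i => Θ i + Λ (some i), fun i => ?_, fun Ξ hΞ => ?_⟩
  · have e1 := h1 i
    have e2 := h3 (some i)
    rw [grp_cons_ne _ (by simp)] at e1 e2
    have e3 := grp_recolor_map T (some i)
    rw [Option.map_some] at e3
    rw [e3] at e2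
    rw [grp_cons_ne _ (by simp), grp_add, add_add_add_comm]
    exact NDer.mix rfl _ _ e1 e2
  · rw [Finset.sum_add_distrib, add_assoc] at hΞ
    have e1 := h2 _ hΞ
    have e2 := h3 none
    rw [grp_cons_self, grp_recolor_new, Multiset.add_cons, add_zero] at e2
    rw [grp_cons_self, Multiset.cons_add] at e1
    -- The fresh colour provides `B` with `Λ none` as a separate derivation. The tensor is formed
    -- after the neutral part of the first premise has been rebuilt and before that of the second,
    -- so `Λ none` is still present to be consumed by `h4`.
    have e3 := htens _ (Λ none) e1 e2
    have e4 := h4 (C ::ₘ (grp S none + Ξ)) (by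
      rw [Fintype.sum_option]
      convert e3 using 1
      simp only [← Multiset.singleton_add]
      abel)
    rw [grp_cons_ne _ (by simp)] at e4
    have e5 := grp_recolor_map T none
    rw [Option.map_none] at e5
    rw [e5] at e4
    rw [grp_cons_self, grp_add]
    convert e4 using 1
    simp only [← Multiset.singleton_add]
    abel

/-- The tensor is formed inside colour `i`. If its conclusion has that colour it remains in the
group; if it is neutral it joins the auxiliary formulas `Θ i`, and the final procedure hands it
back. -/
theorem Splits.tens_same [Fintype ι] {A B C : Occ V} {S T : Multiset (Option ι × Occ V)} {i : ι}
    {o : Option ι} (ho : o = none ∨ o = some i)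
    (htens : ∀ Δ Δ', NDer true link (A ::ₘ Δ) → NDer true link (B ::ₘ Δ') →
      NDer true link (C ::ₘ (Δ + Δ')))
    (hS : Splits link ((some i, A) ::ₘ S)) (hT : Splits link ((some i, B) ::ₘ T)) :
    Splits link ((o, C) ::ₘ (S + T)) := by
  classical
  obtain ⟨Θ, h1, h2⟩ := hS
  obtain ⟨Λ, h3, h4⟩ := hT
  have e1 := h1 i
  have e2 := h3 i
  rw [grp_cons_self, Multiset.add_cons] at e1 e2
  have e3 := htens _ _ e1 e2
  have hne : ∀ j ≠ i, NDer true link (Θ j + Λ j + grp (S + T) (some j)) := by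
    intro j hj
    have e1 := h1 j
    have e2 := h3 j
    rw [grp_cons_ne _ (by simpa using hj.symm)] at e1 e2
    rw [grp_add, add_add_add_comm]
    exact NDer.mix rfl _ _ e1 e2
  have hcl : ∀ Ξ, NDer true link ((∑ i, (Θ i + Λ i)) + Ξ) →
      NDer true link (grp (S + T) none + Ξ) := by
    intro Ξ hΞ
    rw [Finset.sum_add_distrib, add_assoc] at hΞ
    have e1 := h2 _ hΞ
    rw [grp_cons_ne _ (by simp), add_left_comm] at e1
    have e2 := h4 _ e1
    rw [grp_cons_ne _ (by simp)] at e2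
    rw [grp_add]
    convert e2 using 1
    abel
  rcases ho with rfl | rfl
  · refine ⟨Function.update (fun j => Θ j + Λ j) i (C ::ₘ (Θ i + Λ i)), fun j => ?_, fun Ξ hΞ => ?_⟩
    · rw [grp_cons_ne _ (by simp)]
      by_cases hj : j = i
      · subst hj
        rw [Function.update_self, grp_add]
        convert e3 using 1
        simp only [← Multiset.singleton_add]
        abel
      · rw [Function.update_of_ne hj]
        exact hne j hj
    · rw [grp_cons_self]
      have := hcl (C ::ₘ Ξ) (by
        convert hΞ using 1
        rw [Finset.sum_update_of_mem (Finset.mem_univ i),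
          ← Finset.add_sum_erase Finset.univ _ (Finset.mem_univ i), Finset.sdiff_singleton_eq_erase]
        simp only [← Multiset.singleton_add]
        abel)
      convert this using 1
      simp only [← Multiset.singleton_add]
      abel
  · refine ⟨fun j => Θ j + Λ j, fun j => ?_, fun Ξ hΞ => ?_⟩
    · by_cases hj : j = i
      · subst hj
        rw [grp_cons_self, grp_add]
        convert e3 using 1
        simp only [← Multiset.singleton_add]
        abel
      · rw [grp_cons_ne _ (by simpa using Ne.symm hj)]
        exact hne j hj
    · rw [grp_cons_ne _ (by simp)]
      exact hcl Ξ hΞ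

/-- `A` may receive a colour of its own as soon as it is connected to no coloured formula. -/
theorem Apart.new {N : Multiset (Occ V)} {A : Occ V} {S : Multiset (Option ι × Occ V)}
    (h : Apart link N S) (hA : ∀ i T, (some i, T) ∈ S → ¬ Conn link N T A) :
    Apart link N ((some none, A) ::ₘ recolor S) := by
  intro i j hij T T' hT hT' hc
  simp only [Multiset.mem_cons, Prod.mk.injEq, Option.some.injEq] at hT hT'
  rcases hT with ⟨rfl, rfl⟩ | hT <;> rcases hT' with ⟨rfl, rfl⟩ | hT'
  · exact hij rfl
  · obtain ⟨_ | c, h1, h2⟩ := mem_recolor.1 hT'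
    · simp at h2
    · exact hA _ _ h1 hc.symm
  · obtain ⟨_ | c, h1, h2⟩ := mem_recolor.1 hT
    · simp at h2
    · exact hA _ _ h1 hc
  · obtain ⟨_ | c, h1, h2⟩ := mem_recolor.1 hT
    · simp at h2
    · obtain ⟨_ | c', h1', h2'⟩ := mem_recolor.1 hT'
      · simp at h2'
      · simp at h2 h2'
        exact h c c' (fun h => hij (by rw [h2, h2', h])) _ _ h1 h1' hc

/-- `A` may share colour `i` when every coloured formula connected to it already has that colour. -/
theorem Apart.cons_some {N : Multiset (Occ V)} {A : Occ V} {S : Multiset (Option ι × Occ V)} {i : ι}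
    (h : Apart link N S) (hA : ∀ j T, (some j, T) ∈ S → Conn link N T A → j = i) :
    Apart link N ((some i, A) ::ₘ S) := by
  intro j k hjk T T' hT hT' hc
  simp only [Multiset.mem_cons, Prod.mk.injEq, Option.some.injEq] at hT hT'
  rcases hT with ⟨rfl, rfl⟩ | hT <;> rcases hT' with ⟨rfl, rfl⟩ | hT'
  · exact hjk rfl
  · exact hjk (hA _ _ hT' hc.symm).symm
  · exact hjk (hA _ _ hT hc)
  · exact h j k hjk T T' hT hT' hc

theorem Apart.cons_none {N : Multiset (Occ V)} {A : Occ V} {S : Multiset (Option ι × Occ V)}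
    (h : Apart link N S) : Apart link N ((none, A) ::ₘ S) := by
  intro j k hjk T T' hT hT' hc
  simp only [Multiset.mem_cons, Prod.mk.injEq, reduceCtorEq, false_and, false_or] at hT hT'
  exact h j k hjk T T' hT hT' hc

theorem Conn.par {A B T T' : Occ V} {N : Multiset (Occ V)}
    (h : Conn link (A ::ₘ B ::ₘ N) T T') : Conn link (Occ.par A B ::ₘ N) T T' := by
  obtain ⟨n, p, hp, h0⟩ := h
  exact ⟨n, p, hp.congr fun i j _ _ => by simp [Occ.ound, or_assoc], h0⟩

/-- A derivation splits along unconnected groups of conclusions. -/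
theorem NDer.splits {N : Multiset (Occ V)} (h : NDer true link N) :
    ∀ {ι : Type} [Fintype ι] (S : Multiset (Option ι × Occ V)), S.map Prod.snd = N →
      (soverts N).Nodup → Apart link N S → Splits link S := by
  induction h with
  | cls s c h =>
    intro ι _ S hS _ hap
    have hd := NDer.cls (m := true) s c h
    rw [← hS] at hap hd
    refine splits_of_conn hd hap ?_
    rw [hS]
    intro T hT T' hT'
    obtain ⟨x, hx, rfl⟩ := Multiset.mem_map.1 hT
    obtain ⟨y, hy, rfl⟩ := Multiset.mem_map.1 hT'
    exact Conn.of_link (x := x) (y := y) (by simp [Occ.overts]) (by simp [Occ.overts])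
      (link.trans (link.symm ((h x).1 hx)) ((h y).1 hy))
  | box L c h hL =>
    intro ι _ S hS _ hap
    have hd := NDer.box (m := true) L c h hL
    rw [← hS] at hap hd
    refine splits_of_conn hd hap ?_
    rw [hS]
    intro T hT T' hT'
    obtain ⟨x, hx, rfl⟩ := Multiset.mem_map.1 hT
    obtain ⟨y, hy, rfl⟩ := Multiset.mem_map.1 hT'
    exact Conn.of_link (x := x.1) (y := y.1) (by simp [Occ.overts]) (by simp [Occ.overts])
      (link.trans (link.symm ((h x.1).1 (Multiset.mem_map_of_mem _ hx)))
        ((h y.1).1 (Multiset.mem_map_of_mem _ hy)))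
  | nil _ =>
    intro ι _ S hS _ hap
    obtain rfl : S = 0 := by simpa using hS
    exact splits_of_conn (by simpa using NDer.nil rfl) (by simpa using hap) (by simp)
  | mix _ N N' hN hN' ih ih' =>
    intro ι _ S hS hnd hap
    obtain ⟨S₁, S₂, rfl, rfl, rfl⟩ := map_eq_add_iff' hS
    rw [soverts_add, Multiset.nodup_add] at hnd
    obtain ⟨nd1, nd2, hd⟩ := hnd
    obtain ⟨Θ, h1, h2⟩ := ih S₁ rfl nd1 fun i j hij T T' hT hT' hc =>
      hap i j hij T T' (by simp [hT]) (by simp [hT'])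
        (hc.mono (mem_soverts_of_mem (Multiset.mem_map_of_mem Prod.snd hT)) hN.soverts_closed
          (fun x hx y hy => sound_iff_of_disjoint hd hx) (fun _ => id) (fun _ => id))
    obtain ⟨Λ, h3, h4⟩ := ih' S₂ rfl nd2 fun i j hij T T' hT hT' hc =>
      hap i j hij T T' (by simp [hT]) (by simp [hT'])
        (hc.mono (mem_soverts_of_mem (Multiset.mem_map_of_mem Prod.snd hT)) hN'.soverts_closed
          (fun x hx y hy => by
            rw [add_comm]
            exact sound_iff_of_disjoint hd.symm hx) (fun _ => id) (fun _ => id))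
    refine ⟨fun i => Θ i + Λ i, fun i => ?_, fun Ξ hΞ => ?_⟩
    · rw [grp_add, add_add_add_comm]
      exact NDer.mix rfl _ _ (h1 i) (h3 i)
    · rw [Finset.sum_add_distrib, add_assoc] at hΞ
      have e1 := h2 _ hΞ
      rw [add_left_comm] at e1
      have e2 := h4 _ e1
      rw [grp_add]
      convert e2 using 1
      abel
  | par A B N hN ih =>
    intro ι _ S hS hnd hap
    obtain ⟨⟨o, C⟩, S, rfl, rfl, rfl⟩ := map_eq_cons_iff' hS
    obtain ⟨Θ, h1, h2⟩ := ih ((o, A) ::ₘ (o, B) ::ₘ S) (by simp)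
      (by simpa [Occ.overts, add_assoc] using hnd) (by
        intro i j hij T T' hT hT' hc
        have key : ∀ {k : ι} {U : Occ V}, (some k, U) ∈ (o, A) ::ₘ (o, B) ::ₘ S →
            ∃ U', (some k, U') ∈ (o, Occ.par A B) ::ₘ S ∧ ∀ x ∈ U.overts, x ∈ U'.overts := by
          intro k U hU
          simp only [Multiset.mem_cons, Prod.mk.injEq] at hU
          rcases hU with ⟨rfl, rfl⟩ | ⟨rfl, rfl⟩ | hU
          · exact ⟨_, Multiset.mem_cons_self _ _, fun x hx => by simp [Occ.overts, hx]⟩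
          · exact ⟨_, Multiset.mem_cons_self _ _, fun x hx => by simp [Occ.overts, hx]⟩
          · exact ⟨U, Multiset.mem_cons_of_mem hU, fun x => id⟩
        obtain ⟨U, hU, hUx⟩ := key hT
        obtain ⟨U', hU', hUx'⟩ := key hT'
        obtain ⟨n, p, hp, h0, hn⟩ := hc.par
        exact hap i j hij U U' hU hU' ⟨n, p, hp, hUx _ h0, hUx' _ hn⟩)
    cases o with
    | none =>
      refine ⟨Θ, fun i => ?_, fun Ξ hΞ => ?_⟩
      · have := h1 i
        rw [grp_cons_ne _ (by simp), grp_cons_ne _ (by simp)] at this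
        rwa [grp_cons_ne _ (by simp)]
      · have := h2 Ξ hΞ
        rw [grp_cons_self, grp_cons_self, Multiset.cons_add, Multiset.cons_add] at this
        rw [grp_cons_self, Multiset.cons_add]
        exact NDer.par _ _ _ this
    | some k =>
      refine ⟨Θ, fun i => ?_, fun Ξ hΞ => ?_⟩
      · have := h1 i
        by_cases hik : i = k
        · subst hik
          rw [grp_cons_self, grp_cons_self, Multiset.add_cons, Multiset.add_cons] at this
          rw [grp_cons_self, Multiset.add_cons]
          exact NDer.par _ _ _ this
        · have hne : (some k : Option ι) ≠ some i := by simpa using Ne.symm hik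
          rw [grp_cons_ne _ hne, grp_cons_ne _ hne] at this
          rwa [grp_cons_ne _ hne]
      · have := h2 Ξ hΞ
        rw [grp_cons_ne _ (by simp), grp_cons_ne _ (by simp)] at this
        rwa [grp_cons_ne _ (by simp)]
  | tens A B N N' hN hN' ih ih' =>
    intro ι _ S hS hnd hap
    obtain ⟨⟨o, C⟩, S, rfl, rfl, hS'⟩ := map_eq_cons_iff' hS
    obtain ⟨S₁, S₂, rfl, rfl, rfl⟩ := map_eq_add_iff' hS'
    obtain ⟨nd1, nd2, hd⟩ := soverts_tens_nodup hnd
    have up1 : ∀ {T T' U U'}, T ∈ A ::ₘ S₁.map Prod.snd →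
        Conn link (A ::ₘ S₁.map Prod.snd) T T' → (∀ x ∈ T.overts, x ∈ U.overts) →
        (∀ x ∈ T'.overts, x ∈ U'.overts) →
        Conn link (Occ.tens A B ::ₘ (S₁.map Prod.snd + S₂.map Prod.snd)) U U' :=
      fun hT hc hU hU' => hc.mono (mem_soverts_of_mem hT) hN.soverts_closed
        (fun x hx y hy => sound_tens_left hd hx hy) hU hU'
    have up2 : ∀ {T T' U U'}, T ∈ B ::ₘ S₂.map Prod.snd →
        Conn link (B ::ₘ S₂.map Prod.snd) T T' → (∀ x ∈ T.overts, x ∈ U.overts) →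
        (∀ x ∈ T'.overts, x ∈ U'.overts) →
        Conn link (Occ.tens A B ::ₘ (S₁.map Prod.snd + S₂.map Prod.snd)) U U' :=
      fun hT hc hU hU' => hc.mono (mem_soverts_of_mem hT) hN'.soverts_closed
        (fun x hx y hy => sound_tens_right hd hx hy) hU hU'
    have mem1 : ∀ {i T}, (i, T) ∈ S₁ → T ∈ A ::ₘ S₁.map Prod.snd :=
      fun h => Multiset.mem_cons_of_mem (Multiset.mem_map_of_mem Prod.snd h)
    have mem2 : ∀ {i T}, (i, T) ∈ S₂ → T ∈ B ::ₘ S₂.map Prod.snd :=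
      fun h => Multiset.mem_cons_of_mem (Multiset.mem_map_of_mem Prod.snd h)
    have ap1 : Apart link (A ::ₘ S₁.map Prod.snd) S₁ := fun i j hij T T' hT hT' hc =>
      hap i j hij T T' (by simp [hT]) (by simp [hT'])
        (up1 (mem1 hT) hc (fun _ => id) (fun _ => id))
    have ap2 : Apart link (B ::ₘ S₂.map Prod.snd) S₂ := fun i j hij T T' hT hT' hc =>
      hap i j hij T T' (by simp [hT]) (by simp [hT'])
        (up2 (mem2 hT) hc (fun _ => id) (fun _ => id))
    -- A coloured formula connected to `A` and one connected to `B` are connected to each other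
    -- through the tensor, so their colours agree.
    have cross : ∀ i j T T', (some i, T) ∈ S₁ → (some j, T') ∈ S₂ →
        Conn link (A ::ₘ S₁.map Prod.snd) T A → Conn link (B ::ₘ S₂.map Prod.snd) T' B →
        i = j := by
      intro i j T T' hT hT' hc hc'
      by_contra hij
      exact hap i j hij T T' (by simp [hT]) (by simp [hT'])
        (Conn.join hnd hN.soverts_closed hN'.soverts_closed
          (Multiset.mem_map_of_mem Prod.snd hT) hc hc'.symm)
    have htens := fun Δ Δ' => NDer.tens (m := true) (link := link) A B Δ Δ'
    cases o with
    | some i =>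
      refine Splits.tens_same (Or.inr rfl) htens
        (ih ((some i, A) ::ₘ S₁) (by simp) nd1 (ap1.cons_some fun j T hT hc => ?_))
        (ih' ((some i, B) ::ₘ S₂) (by simp) nd2 (ap2.cons_some fun j T hT hc => ?_))
      · by_contra hij
        exact hap j i hij T (Occ.tens A B) (by simp [hT]) (by simp)
          (up1 (mem1 hT) hc (fun _ => id) (fun x hx => by simp [Occ.overts, hx]))
      · by_contra hij
        exact hap j i hij T (Occ.tens A B) (by simp [hT]) (by simp)
          (up2 (mem2 hT) hc (fun _ => id) (fun x hx => by simp [Occ.overts, hx]))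
    | none =>
      -- A neutral tensor. If one side has no coloured formula connected to its tensor component,
      -- that component gets a fresh colour. Otherwise all colours connected to `A` or `B` coincide,
      -- and both components take that colour.
      by_cases h2 : ∃ j T, (some j, T) ∈ S₂ ∧ Conn link (B ::ₘ S₂.map Prod.snd) T B
      · by_cases h1 : ∃ i T, (some i, T) ∈ S₁ ∧ Conn link (A ::ₘ S₁.map Prod.snd) T A
        · obtain ⟨j, T', hT', hc'⟩ := h2
          obtain ⟨i, T, hT, hc⟩ := h1
          obtain rfl := cross i j T T' hT hT' hc hc'
          exact Splits.tens_same (Or.inl rfl) htens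
            (ih ((some i, A) ::ₘ S₁) (by simp) nd1
              (ap1.cons_some fun k U hU hcU => cross k i U T' hU hT' hcU hc'))
            (ih' ((some i, B) ::ₘ S₂) (by simp) nd2
              (ap2.cons_some fun k U hU hcU => (cross i k T U hT hU hc hcU).symm))
        · push Not at h1
          rw [add_comm S₁]
          exact Splits.tens_new (fun Δ Δ' hB hA => add_comm Δ' Δ ▸ htens Δ' Δ hA hB)
            (ih' ((none, B) ::ₘ S₂) (by simp) nd2 ap2.cons_none)
            (ih ((some none, A) ::ₘ recolor S₁) (by simp [recolor_snd]) nd1 (ap1.new h1))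
      · push Not at h2
        exact Splits.tens_new htens
          (ih ((none, A) ::ₘ S₁) (by simp) nd1 ap1.cons_none)
          (ih' ((some none, B) ::ₘ recolor S₂) (by simp [recolor_snd]) nd2 (ap2.new h2))

end Split

/-! ## Acyclic sequents are derivable with mix -/

section Leaves

variable {V : Type v}

namespace Occ

/-- Well-formedness: modalities sit exactly on the vertices in `M`. -/
def WF (M : V → Prop) : Occ V → Prop
  | atom x => ¬ M x
  | par A B => A.WF M ∧ B.WF M
  | tens A B => A.WF M ∧ B.WF M
  | mod x A => M x ∧ A.WF M

/-- The number of `par` and `tens` outside the modalities. -/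
def size : Occ V → ℕ
  | atom _ => 0
  | par A B => A.size + B.size + 1
  | tens A B => A.size + B.size + 1
  | mod _ _ => 0

/-- An atom or a modality. -/
def IsLeaf (T : Occ V) : Prop := (∃ x, T = atom x) ∨ ∃ x A, T = mod x A

theorem isLeaf_of_mem_leaves {T l : Occ V} (h : l ∈ T.leaves) : l.IsLeaf := by
  induction T with
  | atom x => exact Or.inl ⟨x, by simpa [leaves] using h⟩
  | par A B ihA ihB => exact (Multiset.mem_add.1 h).elim ihA ihB
  | tens A B ihA ihB => exact (Multiset.mem_add.1 h).elim ihA ihB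
  | mod x A ih => exact Or.inr ⟨x, A, by simpa [leaves] using h⟩

theorem IsLeaf.leaves_eq {T : Occ V} (h : T.IsLeaf) : T.leaves = {T} := by
  rcases h with ⟨x, rfl⟩ | ⟨x, A, rfl⟩ <;> rfl

theorem IsLeaf.exists_overts_eq {T : Occ V} (h : T.IsLeaf) : ∃ x, T.overts = {x} := by
  rcases h with ⟨x, rfl⟩ | ⟨x, A, rfl⟩ <;> exact ⟨x, rfl⟩

theorem sverts_leaves (T : Occ V) : sverts T.leaves = T.verts := by
  induction T with
  | atom x => exact sverts_map_atom {x}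
  | par A B ihA ihB => simp [leaves, verts, ihA, ihB]
  | tens A B ihA ihB => simp [leaves, verts, ihA, ihB]
  | mod x A ih => exact Multiset.singleton_bind _ _

theorem wf_of_mem_leaves {M : V → Prop} {T l : Occ V} (hT : T.WF M) (h : l ∈ T.leaves) :
    l.WF M := by
  induction T with
  | atom x => rw [show l = atom x by simpa [leaves] using h]; exact hT
  | par A B ihA ihB => exact (Multiset.mem_add.1 h).elim (ihA hT.1) (ihB hT.2)
  | tens A B ihA ihB => exact (Multiset.mem_add.1 h).elim (ihA hT.1) (ihB hT.2)
  | mod x A ih => rw [show l = mod x A by simpa [leaves] using h]; exact hT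

theorem dir_iff_leaves {T : Occ V} {x y : V} : T.dir x y ↔ ∃ l ∈ T.leaves, l.dir x y := by
  induction T with
  | atom z => simp [leaves]
  | par A B ihA ihB => simp only [dir, leaves, Multiset.mem_add, or_and_right, exists_or, ihA, ihB]
  | tens A B ihA ihB => simp only [dir, leaves, Multiset.mem_add, or_and_right, exists_or, ihA, ihB]
  | mod z A ih => simp [leaves]

theorem und_of_mem_leaves {T l : Occ V} {x y : V} (hl : l ∈ T.leaves) (h : l.und x y) :
    T.und x y := by
  induction T with
  | atom z => rwa [show l = atom z by simpa [leaves] using hl] at h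
  | par A B ihA ihB => exact (Multiset.mem_add.1 hl).imp ihA ihB
  | tens A B ihA ihB => exact Or.inl ((Multiset.mem_add.1 hl).imp ihA ihB)
  | mod z A ih => rwa [show l = mod z A by simpa [leaves] using hl] at h

theorem exists_leaf {T : Occ V} {x : V} (h : x ∈ T.verts) :
    ∃ l ∈ T.leaves, x ∈ l.verts ∧ ∀ a ∈ l.overts, a ∈ T.overts := by
  induction T with
  | atom z => exact ⟨atom z, by simp [leaves], h, fun a => id⟩
  | par A B ihA ihB =>
    rcases Multiset.mem_add.1 h with h | h
    · obtain ⟨l, h1, h2, h3⟩ := ihA h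
      exact ⟨l, by simp [leaves, h1], h2, fun a ha => by simp [overts, h3 a ha]⟩
    · obtain ⟨l, h1, h2, h3⟩ := ihB h
      exact ⟨l, by simp [leaves, h1], h2, fun a ha => by simp [overts, h3 a ha]⟩
  | tens A B ihA ihB =>
    rcases Multiset.mem_add.1 h with h | h
    · obtain ⟨l, h1, h2, h3⟩ := ihA h
      exact ⟨l, by simp [leaves, h1], h2, fun a ha => by simp [overts, h3 a ha]⟩
    · obtain ⟨l, h1, h2, h3⟩ := ihB h
      exact ⟨l, by simp [leaves, h1], h2, fun a ha => by simp [overts, h3 a ha]⟩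
  | mod z A ih => exact ⟨mod z A, by simp [leaves], h, fun a => id⟩

/-- An undirected edge lies within a leaf or comes from a tensor that separates two leaves. In the
latter case the tensor also joins the outer vertices of the two leaves, which transfers edges
between the contents of two boxes to edges between their modalities. -/
theorem und_cases {T : Occ V} {x y : V} (h : T.und x y) : (∃ l ∈ T.leaves, l.und x y) ∨
    ∃ l ∈ T.leaves, ∃ l' ∈ T.leaves, x ∈ l.verts ∧ y ∈ l'.verts ∧
      ∀ a ∈ l.overts, ∀ b ∈ l'.overts, T.ound a b := by
  induction T with
  | atom z => exact h.elim
  | par A B ihA ihB =>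
    simp only [leaves, Multiset.mem_add]
    rcases h with h | h
    · rcases ihA h with ⟨l, h1, h2⟩ | ⟨l, h1, l', h2, h3, h4, h5⟩
      · exact Or.inl ⟨l, Or.inl h1, h2⟩
      · exact Or.inr ⟨l, Or.inl h1, l', Or.inl h2, h3, h4, fun a ha b hb => Or.inl (h5 a ha b hb)⟩
    · rcases ihB h with ⟨l, h1, h2⟩ | ⟨l, h1, l', h2, h3, h4, h5⟩
      · exact Or.inl ⟨l, Or.inr h1, h2⟩
      · exact Or.inr ⟨l, Or.inr h1, l', Or.inr h2, h3, h4, fun a ha b hb => Or.inr (h5 a ha b hb)⟩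
  | tens A B ihA ihB =>
    simp only [leaves, Multiset.mem_add]
    rcases h with (h | h) | ⟨hx, hy⟩ | ⟨hx, hy⟩
    · rcases ihA h with ⟨l, h1, h2⟩ | ⟨l, h1, l', h2, h3, h4, h5⟩
      · exact Or.inl ⟨l, Or.inl h1, h2⟩
      · exact Or.inr ⟨l, Or.inl h1, l', Or.inl h2, h3, h4,
          fun a ha b hb => Or.inl (Or.inl (h5 a ha b hb))⟩
    · rcases ihB h with ⟨l, h1, h2⟩ | ⟨l, h1, l', h2, h3, h4, h5⟩
      · exact Or.inl ⟨l, Or.inr h1, h2⟩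
      · exact Or.inr ⟨l, Or.inr h1, l', Or.inr h2, h3, h4,
          fun a ha b hb => Or.inl (Or.inr (h5 a ha b hb))⟩
    · obtain ⟨l, h1, h2, h3⟩ := exists_leaf hx
      obtain ⟨l', h1', h2', h3'⟩ := exists_leaf hy
      exact Or.inr ⟨l, Or.inl h1, l', Or.inr h1', h2, h2',
        fun a ha b hb => Or.inr (Or.inl ⟨h3 a ha, h3' b hb⟩)⟩
    · obtain ⟨l, h1, h2, h3⟩ := exists_leaf hx
      obtain ⟨l', h1', h2', h3'⟩ := exists_leaf hy
      exact Or.inr ⟨l, Or.inr h1, l', Or.inl h1', h2, h2',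
        fun a ha b hb => Or.inr (Or.inr ⟨h3 a ha, h3' b hb⟩)⟩
  | mod z A ih => exact Or.inl ⟨mod z A, by simp [leaves], h⟩

theorem exists_dir {T : Occ V} {y : V} (h : y ∈ T.verts) (h' : y ∉ T.overts) : ∃ x, T.dir x y := by
  induction T with
  | atom z => exact absurd h h'
  | par A B ihA ihB =>
    simp only [verts, overts, Multiset.mem_add, not_or] at h h'
    rcases h with h | h
    · exact (ihA h h'.1).imp fun x => Or.inl
    · exact (ihB h h'.2).imp fun x => Or.inr
  | tens A B ihA ihB =>
    simp only [verts, overts, Multiset.mem_add, not_or] at h h'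
    rcases h with h | h
    · exact (ihA h h'.1).imp fun x => Or.inl
    · exact (ihB h h'.2).imp fun x => Or.inr
  | mod z A ih =>
    simp only [verts, overts, Multiset.mem_cons, Multiset.mem_singleton] at h h'
    exact ⟨z, Or.inl ⟨rfl, h.resolve_left h'⟩⟩

theorem nodup_add_disjoint {s t : Multiset V} (h : (s + t).Nodup) {x : V} (hx : x ∈ s) : x ∉ t :=
  Multiset.disjoint_left.1 (Multiset.nodup_add.1 h).2.2 hx

theorem mem_overts_left {A B : Occ V} (hn : (A.verts + B.verts).Nodup) {x : V}
    (hx : x ∈ A.verts) (h : x ∈ A.overts + B.overts) : x ∈ A.overts :=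
  (Multiset.mem_add.1 h).resolve_right fun h =>
    nodup_add_disjoint hn hx (Multiset.mem_of_le B.overts_le_verts h)

theorem mem_overts_right {A B : Occ V} (hn : (A.verts + B.verts).Nodup) {x : V}
    (hx : x ∈ B.verts) (h : x ∈ A.overts + B.overts) : x ∈ B.overts :=
  (Multiset.mem_add.1 h).resolve_left fun h =>
    nodup_add_disjoint hn (Multiset.mem_of_le A.overts_le_verts h) hx

theorem not_mem_overts_of_dir {T : Occ V} (hn : T.verts.Nodup) {x y : V} (h : T.dir x y) :
    y ∉ T.overts := by
  have main : ∀ {A B : Occ V}, (A.verts + B.verts).Nodup →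
      (A.verts.Nodup → A.dir x y → y ∉ A.overts) → (B.verts.Nodup → B.dir x y → y ∉ B.overts) →
      A.dir x y ∨ B.dir x y → y ∉ A.overts + B.overts := by
    intro A B hn ihA ihB h hy
    rcases h with h | h
    · exact ihA (Multiset.nodup_add.1 hn).1 h (mem_overts_left hn (mem_of_dir h).2 hy)
    · exact ihB (Multiset.nodup_add.1 hn).2.1 h (mem_overts_right hn (mem_of_dir h).2 hy)
  induction T with
  | atom z => exact h.elim
  | par A B ihA ihB => exact main hn ihA ihB h
  | tens A B ihA ihB => exact main hn ihA ihB h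
  | mod z A ih =>
    have hz : z ∉ A.verts := (Multiset.nodup_cons.1 hn).1
    simp only [overts, Multiset.mem_singleton]
    rintro rfl
    rcases h with h | h
    · exact hz h.2
    · exact hz (mem_of_dir h).2

theorem und_of_ound {T : Occ V} {x y : V} (h : T.ound x y) : T.und x y := by
  induction T with
  | atom z => exact h
  | par A B ihA ihB => exact h.imp ihA ihB
  | tens A B ihA ihB =>
    exact h.imp (Or.imp ihA ihB) (Or.imp
      (And.imp (Multiset.mem_of_le A.overts_le_verts) (Multiset.mem_of_le B.overts_le_verts))
      (And.imp (Multiset.mem_of_le B.overts_le_verts) (Multiset.mem_of_le A.overts_le_verts)))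
  | mod z A ih => exact h.elim

theorem ound_of_und {T : Occ V} (hn : T.verts.Nodup) {x y : V} (hx : x ∈ T.overts)
    (hy : y ∈ T.overts) (h : T.und x y) : T.ound x y := by
  have main : ∀ {A B : Occ V}, (A.verts + B.verts).Nodup →
      (A.verts.Nodup → x ∈ A.overts → y ∈ A.overts → A.und x y → A.ound x y) →
      (B.verts.Nodup → x ∈ B.overts → y ∈ B.overts → B.und x y → B.ound x y) →
      x ∈ A.overts + B.overts → y ∈ A.overts + B.overts → A.und x y ∨ B.und x y →
      A.ound x y ∨ B.ound x y := by
    intro A B hn ihA ihB hx hy h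
    rcases h with h | h
    · exact Or.inl (ihA (Multiset.nodup_add.1 hn).1 (mem_overts_left hn (mem_of_und h).1 hx)
        (mem_overts_left hn (mem_of_und h).2 hy) h)
    · exact Or.inr (ihB (Multiset.nodup_add.1 hn).2.1 (mem_overts_right hn (mem_of_und h).1 hx)
        (mem_overts_right hn (mem_of_und h).2 hy) h)
  induction T with
  | atom z => exact h
  | par A B ihA ihB => exact main hn ihA ihB hx hy h
  | tens A B ihA ihB =>
    rcases h with h | ⟨h, h'⟩ | ⟨h, h'⟩
    · exact Or.inl (main hn ihA ihB hx hy h)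
    · exact Or.inr (Or.inl ⟨mem_overts_left hn h hx, mem_overts_right hn h' hy⟩)
    · exact Or.inr (Or.inr ⟨mem_overts_right hn h hx, mem_overts_left hn h' hy⟩)
  | mod z A ih =>
    obtain rfl : x = z := by simpa [overts] using hx
    have h' : A.und x y := h
    exact ((Multiset.nodup_cons.1 hn).1 (mem_of_und h').1).elim

theorem ound_irrefl {T : Occ V} (hn : T.verts.Nodup) {x : V} : ¬ T.ound x x := by
  induction T with
  | atom z => exact id
  | par A B ihA ihB =>
    rintro (h | h)
    · exact ihA (Multiset.nodup_add.1 hn).1 h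
    · exact ihB (Multiset.nodup_add.1 hn).2.1 h
  | tens A B ihA ihB =>
    have hd := nodup_add_disjoint hn (x := x)
    rintro ((h | h) | ⟨h, h'⟩ | ⟨h, h'⟩)
    · exact ihA (Multiset.nodup_add.1 hn).1 h
    · exact ihB (Multiset.nodup_add.1 hn).2.1 h
    · exact hd (Multiset.mem_of_le A.overts_le_verts h) (Multiset.mem_of_le B.overts_le_verts h')
    · exact hd (Multiset.mem_of_le A.overts_le_verts h') (Multiset.mem_of_le B.overts_le_verts h)
  | mod z A ih => exact id

end Occ

open Occ

/-- The leaves of a sequent. -/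
def sleaves (S : Multiset (Occ V)) : Multiset (Occ V) := S.bind Occ.leaves

@[simp] theorem sleaves_cons (T : Occ V) (S) : sleaves (T ::ₘ S) = T.leaves + sleaves S :=
  Multiset.cons_bind _ _ _

theorem mem_sleaves {S : Multiset (Occ V)} {l : Occ V} : l ∈ sleaves S ↔ ∃ T ∈ S, l ∈ T.leaves :=
  Multiset.mem_bind

theorem sleaves_eq_self {S : Multiset (Occ V)} (h : ∀ T ∈ S, T.IsLeaf) : sleaves S = S := by
  induction S using Multiset.induction with
  | empty => rfl
  | cons T S ih =>
    rw [sleaves_cons, ih fun U hU => h U (Multiset.mem_cons_of_mem hU),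
      (h T (Multiset.mem_cons_self _ _)).leaves_eq, Multiset.singleton_add]

theorem sverts_sleaves (S : Multiset (Occ V)) : sverts (sleaves S) = sverts S := by
  induction S using Multiset.induction with
  | empty => rfl
  | cons T S ih => rw [sleaves_cons, sverts_add, ih, sverts_leaves, sverts_cons]

theorem sdir_sleaves {S : Multiset (Occ V)} {x y : V} : sdir (sleaves S) x y ↔ sdir S x y := by
  simp only [sdir, mem_sleaves]
  constructor
  · rintro ⟨l, ⟨T, hT, hl⟩, h⟩
    exact ⟨T, hT, dir_iff_leaves.2 ⟨l, hl, h⟩⟩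
  · rintro ⟨T, hT, h⟩
    obtain ⟨l, hl, h⟩ := dir_iff_leaves.1 h
    exact ⟨l, ⟨T, hT, hl⟩, h⟩

theorem sverts_mono {S T : Multiset (Occ V)} (h : S ≤ T) : sverts S ≤ sverts T := by
  obtain ⟨U, rfl⟩ := Multiset.le_iff_exists_add.1 h
  simp

theorem eq_of_mem_verts {S : Multiset (Occ V)} (hn : (sverts S).Nodup) {T U : Occ V} (hT : T ∈ S)
    (hU : U ∈ S) {x : V} (hx : x ∈ T.verts) (hx' : x ∈ U.verts) : T = U := by
  obtain ⟨S, rfl⟩ := Multiset.exists_cons_of_mem hT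
  rw [sverts_cons] at hn
  rcases Multiset.mem_cons.1 hU with rfl | hU
  · rfl
  · exact absurd (mem_sverts.2 ⟨U, hU, hx'⟩) (nodup_add_disjoint hn hx)

theorem nodup_verts_of_mem {S : Multiset (Occ V)} (hn : (sverts S).Nodup) {T : Occ V}
    (hT : T ∈ S) : T.verts.Nodup := by
  obtain ⟨S, rfl⟩ := Multiset.exists_cons_of_mem hT
  rw [sverts_cons] at hn
  exact (Multiset.nodup_add.1 hn).1

theorem mem_overts_of_mem {S : Multiset (Occ V)} (hn : (sverts S).Nodup) {T : Occ V}
    (hT : T ∈ S) {x : V} (hx : x ∈ T.verts) (hx' : x ∈ soverts S) : x ∈ T.overts := by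
  obtain ⟨U, hU, hxU⟩ := mem_soverts.1 hx'
  rwa [eq_of_mem_verts hn hT hU hx (Multiset.mem_of_le U.overts_le_verts hxU)]

theorem not_mem_soverts_of_sdir {S : Multiset (Occ V)} (hn : (sverts S).Nodup) {x y : V}
    (h : sdir S x y) : y ∉ soverts S := by
  obtain ⟨T, hT, h⟩ := h
  exact fun hy => not_mem_overts_of_dir (nodup_verts_of_mem hn hT) h
    (mem_overts_of_mem hn hT (mem_of_dir h).2 hy)

theorem exists_sdir {S : Multiset (Occ V)} {y : V} (h : y ∈ sverts S) (h' : y ∉ soverts S) :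
    ∃ x, sdir S x y := by
  obtain ⟨T, hT, h⟩ := mem_sverts.1 h
  obtain ⟨x, hx⟩ := exists_dir h fun hy => h' (mem_soverts.2 ⟨T, hT, hy⟩)
  exact ⟨x, T, hT, hx⟩

/-- Directed edges point below a modality, so none ends in an outer vertex. The outer graph is thus
an induced subgraph of the whole graph. -/
theorem sound_iff_sedge {S : Multiset (Occ V)} (hn : (sverts S).Nodup) {x y : V}
    (hx : x ∈ soverts S) (hy : y ∈ soverts S) : sound S x y ↔ sedge S x y := by
  constructor
  · rintro ⟨T, hT, h⟩
    exact ⟨T, hT, Or.inl (und_of_ound h)⟩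
  · rintro ⟨T, hT, h | h⟩
    · obtain ⟨h1, h2⟩ := mem_of_und h
      exact ⟨T, hT, ound_of_und (nodup_verts_of_mem hn hT) (mem_overts_of_mem hn hT h1 hx)
        (mem_overts_of_mem hn hT h2 hy) h⟩
    · exact absurd hy (not_mem_soverts_of_sdir hn ⟨T, hT, h⟩)

end Leaves

/-! ### Derivability with mix from acyclicity at the outer level -/

section Core

variable {V : Type v} {link : Setoid V}

open Occ

/-- A leaf has exactly one outer vertex, so a sequent of leaves is partitioned by the linking
classes and is obtained from them by repeated mix. -/
theorem NDer.of_leaves (n : ℕ) : ∀ S : Multiset (Occ V), S.card ≤ n → (∀ T ∈ S, T.IsLeaf) →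
    (∀ x ∈ soverts S, ∀ y, link x y → y ∈ soverts S) →
    (∀ C ≤ S, (∃ c, ∀ x, x ∈ soverts C ↔ link c x) → NDer true link C) → NDer true link S := by
  classical
  induction n with
  | zero =>
    intro S hS _ _ _
    obtain rfl : S = 0 := by simpa using hS
    exact NDer.nil rfl
  | succ n ih =>
    intro S hS hl hcl hcls
    rcases S.empty_or_exists_mem with rfl | ⟨T, hT⟩
    · exact NDer.nil rfl
    obtain ⟨c, hc⟩ := (hl T hT).exists_overts_eq
    have hsplit := Multiset.filter_add_not (fun U : Occ V => ∃ y ∈ U.overts, link c y) S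
    obtain ⟨C, hC⟩ : ∃ C, C = S.filter (fun U : Occ V => ∃ y ∈ U.overts, link c y) := ⟨_, rfl⟩
    obtain ⟨R, hR⟩ : ∃ R, R = S.filter (fun U : Occ V => ¬ ∃ y ∈ U.overts, link c y) := ⟨_, rfl⟩
    rw [← hC, ← hR] at hsplit
    have hTC : T ∈ C := by
      rw [hC, Multiset.mem_filter]
      exact ⟨hT, c, by simp [hc], link.refl c⟩
    rw [← hsplit]
    refine NDer.mix rfl _ _ (hcls C (hC ▸ Multiset.filter_le _ _) ⟨c, fun x => ⟨fun hx => ?_,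
      fun hx => ?_⟩⟩) (ih R ?_ ?_ ?_ ?_)
    · obtain ⟨U, hU, hxU⟩ := mem_soverts.1 hx
      rw [hC, Multiset.mem_filter] at hU
      obtain ⟨hU, y, hy, hcy⟩ := hU
      obtain ⟨z, hz⟩ := (hl U hU).exists_overts_eq
      rw [hz, Multiset.mem_singleton] at hxU hy
      rwa [hxU, ← hy]
    · obtain ⟨U, hU, hxU⟩ := mem_soverts.1 (hcl c (mem_soverts.2 ⟨T, hT, by simp [hc]⟩) x hx)
      refine mem_soverts.2 ⟨U, ?_, hxU⟩
      rw [hC, Multiset.mem_filter]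
      exact ⟨hU, x, hxU, hx⟩
    · have h1 : C.card + R.card = S.card := by rw [← Multiset.card_add, hsplit]
      have h2 : 0 < C.card := Multiset.card_pos_iff_exists_mem.2 ⟨T, hTC⟩
      omega
    · exact fun U hU => hl U (Multiset.mem_of_le (hR ▸ Multiset.filter_le _ _) hU)
    · intro x hx y hxy
      obtain ⟨U, hU, hxU⟩ := mem_soverts.1 hx
      rw [hR, Multiset.mem_filter] at hU
      obtain ⟨W, hW, hyW⟩ := mem_soverts.1 (hcl x (mem_soverts.2 ⟨U, hU.1, hxU⟩) y hxy)
      refine mem_soverts.2 ⟨W, ?_, hyW⟩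
      rw [hR, Multiset.mem_filter]
      refine ⟨hW, ?_⟩
      rintro ⟨z, hz, hcz⟩
      obtain ⟨z', hz'⟩ := (hl W hW).exists_overts_eq
      rw [hz', Multiset.mem_singleton] at hz hyW
      have hzy : z = y := hz.trans hyW.symm
      exact hU.2 ⟨x, hxU, link.trans (hzy ▸ hcz) (link.symm hxy)⟩
    · exact fun D hD => hcls D (hD.trans (hR ▸ Multiset.filter_le _ _))

/-- If the undirected graph outside the modalities has no chordless cycle, the sequent is
derivable with mix from its linking classes. -/
theorem NDer.of_acyclic (n : ℕ) : ∀ S : Multiset (Occ V), (S.map Occ.size).sum ≤ n →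
    (soverts S).Nodup → (∀ x ∈ soverts S, ∀ y, link x y → y ∈ soverts S) →
    (∀ m p, ¬ CCycle link (sound S) m p) →
    (∀ C ≤ sleaves S, (∃ c, ∀ x, x ∈ soverts C ↔ link c x) → NDer true link C) →
    NDer true link S := by
  induction n with
  | zero =>
    intro S hS _ hcl _ hcls
    have hl : ∀ T ∈ S, T.IsLeaf := by
      intro T hT
      have h : T.size ≤ 0 := (Multiset.single_le_sum (fun _ _ => Nat.zero_le _) _
        (Multiset.mem_map_of_mem Occ.size hT)).trans hS
      cases T with
      | atom x => exact Or.inl ⟨x, rfl⟩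
      | mod x A => exact Or.inr ⟨x, A, rfl⟩
      | par A B => simp [Occ.size] at h
      | tens A B => simp [Occ.size] at h
    rw [sleaves_eq_self hl] at hcls
    exact NDer.of_leaves _ S le_rfl hl hcl hcls
  | succ n ih =>
    intro S hS hnd hcl hac hcls
    by_cases hpar : ∃ A B, Occ.par A B ∈ S
    · obtain ⟨A, B, h⟩ := hpar
      obtain ⟨S, rfl⟩ := Multiset.exists_cons_of_mem h
      have hsnd : sound (A ::ₘ B ::ₘ S) = sound (Occ.par A B ::ₘ S) := by
        ext x y
        simp [Occ.ound, or_assoc]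
      refine NDer.par _ _ _ (ih _ ?_ ?_ ?_ ?_ ?_)
      · simp only [Multiset.map_cons, Multiset.sum_cons, Occ.size] at hS ⊢
        omega
      · simpa [Occ.overts, add_assoc] using hnd
      · simpa [Occ.overts, add_assoc] using hcl
      · rwa [hsnd]
      · simpa [Occ.leaves, add_assoc] using hcls
    by_cases htens : ∃ A B, Occ.tens A B ∈ S
    · obtain ⟨A, B, h⟩ := htens
      obtain ⟨S, rfl⟩ := Multiset.exists_cons_of_mem h
      have hnd' : (soverts (A ::ₘ B ::ₘ S)).Nodup := by
        simpa [Occ.overts, add_assoc] using hnd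
      have hAB : ∀ x ∈ A.overts, x ∉ B.overts ∧ x ∉ soverts S := by
        intro x hx
        rw [soverts_cons] at hnd'
        simpa using nodup_add_disjoint hnd' hx
      have hBS : ∀ x ∈ B.overts, x ∉ soverts S := by
        intro x hx
        rw [soverts_cons, soverts_cons] at hnd'
        exact nodup_add_disjoint (Multiset.nodup_add.1 hnd').2.1 hx
      have hE : ∀ x y, sound (Occ.tens A B ::ₘ S) x y ↔ sound (A ::ₘ B ::ₘ S) x y ∨
          (x ∈ {x | x ∈ A.overts} ∧ y ∈ {x | x ∈ B.overts}) ∨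
          (x ∈ {x | x ∈ B.overts} ∧ y ∈ {x | x ∈ A.overts}) := by
        intro x y
        simp only [sound_cons, Occ.ound, Set.mem_ofPred_eq]
        tauto
      have hcomp : ∀ x y, sound (A ::ₘ B ::ₘ S) x y → (x ∈ A.overts ↔ y ∈ A.overts) ∧
          (x ∈ B.overts ↔ y ∈ B.overts) := by
        intro x y h
        have h1 := hAB x
        have h2 := hAB y
        have h3 := hBS x
        have h4 := hBS y
        simp only [sound_cons] at h
        rcases h with h | h | h
        · have := mem_of_ound h
          tauto
        · have := mem_of_ound h
          tauto
        · have := mem_of_sound h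
          tauto
      -- Without the tensor there are fewer edges, hence also fewer chords; that no chordless cycle
      -- appears is the contrapositive of `CCycle.of_join`.
      have hder : NDer true link (A ::ₘ B ::ₘ S) := by
        refine ih _ ?_ hnd' ?_ ?_ ?_
        · simp only [Multiset.map_cons, Multiset.sum_cons, Occ.size] at hS ⊢
          omega
        · simpa [Occ.overts, add_assoc] using hcl
        · intro m p hp
          obtain ⟨m, q, hq⟩ := hp.of_join (fun x y => sound_symm)
            (A := {x | x ∈ A.overts}) (B := {x | x ∈ B.overts})
            (fun x hx => (hAB x hx).1) hE (fun x y h => (hcomp x y h).1)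
            (fun x y h => (hcomp x y h).2)
          exact hac m q hq
        · simpa [Occ.leaves, add_assoc] using hcls
      -- A connection between `A` and `B` would close to a cycle through the tensor edges.
      have hnc : ¬ Conn link (A ::ₘ B ::ₘ S) A B := by
        rintro ⟨m, p, hp, h0, hn⟩
        obtain ⟨m, q, hq⟩ := hp.cycle_of_join (fun x y => sound_symm)
          (A := {x | x ∈ A.overts}) (B := {x | x ∈ B.overts})
          (fun x hx => (hAB x hx).1) hE (fun x y h => (hcomp x y h).1)
          (fun x y h => (hcomp x y h).2) h0 hn
        exact hac m q hq
      -- Two colours separate `A` from `B`; the whole context `S` is neutral.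
      obtain ⟨Θ, h1, h2⟩ := hder.splits (ι := Bool)
        ((some true, A) ::ₘ (some false, B) ::ₘ S.map fun T => (none, T)) (by simp) hnd' (by
          intro i j hij T T' hT hT' hc
          simp only [Multiset.mem_cons, Prod.mk.injEq, Multiset.mem_map, reduceCtorEq, false_and,
            and_false, exists_false, or_false, Option.some.injEq] at hT hT'
          rcases hT with ⟨rfl, rfl⟩ | ⟨rfl, rfl⟩ <;> rcases hT' with ⟨rfl, rfl⟩ | ⟨rfl, rfl⟩
          · exact hij rfl
          · exact hnc hc
          · exact hnc hc.symm
          · exact hij rfl)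
      have e0 : ∀ i : Bool, grp (S.map fun T => ((none : Option Bool), T)) (some i) = 0 := by
        intro i
        refine grp_eq_zero fun q hq => ?_
        obtain ⟨T, -, rfl⟩ := Multiset.mem_map.1 hq
        simp
      have e1 : grp (S.map fun T => ((none : Option Bool), T)) none = S := by
        rw [grp, Multiset.filter_eq_self.2]
        · simp
        · intro q hq
          obtain ⟨T, -, rfl⟩ := Multiset.mem_map.1 hq
          rfl
      have hA := h1 true
      have hB := h1 false
      rw [grp_cons_self, grp_cons_ne _ (by simp), e0, Multiset.add_cons, add_zero] at hA
      rw [grp_cons_ne _ (by simp), grp_cons_self, e0, Multiset.add_cons, add_zero] at hB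
      -- Tensoring the two coloured derivations gives `A ⊗ B` with both auxiliary parts, from which
      -- `h2` rebuilds `S`.
      have h3 := h2 {Occ.tens A B} (by
        have := NDer.tens _ _ _ _ hA hB
        convert this using 1
        rw [Fintype.sum_bool, add_comm, Multiset.singleton_add])
      rw [grp_cons_ne _ (by simp), grp_cons_ne _ (by simp), e1, add_comm,
        Multiset.singleton_add] at h3
      exact h3
    · have hl : ∀ T ∈ S, T.IsLeaf := by
        intro T hT
        cases T with
        | atom x => exact Or.inl ⟨x, rfl⟩
        | mod x A => exact Or.inr ⟨x, A, rfl⟩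
        | par A B => exact absurd ⟨A, B, hT⟩ hpar
        | tens A B => exact absurd ⟨A, B, hT⟩ htens
      rw [sleaves_eq_self hl] at hcls
      exact NDer.of_leaves _ S le_rfl hl hcl hcls

end Core

/-! ### Descending into the boxes -/

section Boxes

variable {V : Type v} {link : Setoid V}

open Occ

theorem exists_map_mod {C : Multiset (Occ V)} (h : ∀ T ∈ C, ∃ x A, T = Occ.mod x A) :
    ∃ L : Multiset (V × Occ V), C = L.map fun q => Occ.mod q.1 q.2 := by
  induction C using Multiset.induction with
  | empty => exact ⟨0, rfl⟩
  | cons T C ih =>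
    obtain ⟨L, rfl⟩ := ih fun U hU => h U (Multiset.mem_cons_of_mem hU)
    obtain ⟨x, A, rfl⟩ := h T (Multiset.mem_cons_self _ _)
    exact ⟨(x, A) ::ₘ L, by simp⟩

theorem exists_map_atom {C : Multiset (Occ V)} (h : ∀ T ∈ C, ∃ x, T = Occ.atom x) :
    ∃ s : Multiset V, C = s.map Occ.atom := by
  induction C using Multiset.induction with
  | empty => exact ⟨0, rfl⟩
  | cons T C ih =>
    obtain ⟨s, rfl⟩ := ih fun U hU => h U (Multiset.mem_cons_of_mem hU)
    obtain ⟨x, rfl⟩ := h T (Multiset.mem_cons_self _ _)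
    exact ⟨x ::ₘ s, by simp⟩

/-- A link and an edge on the same two vertices form a cycle of length two, for which chordlessness
is vacuous. So acyclicity forbids edges between linked vertices. -/
theorem CCycle.of_linked_edge {E : V → V → Prop} {a b : V} (hab : a ≠ b) (h : link a b)
    (hE : E b a) : CCycle link E 2 fun i => if i = 1 then b else a := by
  refine ⟨by omega, even_two, by simp, ⟨true, fun i hi => ?_⟩, fun i j hi hj h => ?_,
    fun i j hij hj hn => by omega⟩
  · interval_cases i
    · simpa [AltStep] using ⟨h, hab⟩
    · simpa [AltStep] using hE
  · interval_cases i <;> interval_cases j <;> simp_all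

/-- Acyclicity and the box-context condition give derivability with mix. -/
theorem NDer.of_acyclic_boxContext (M : V → Prop) (hM : ∀ x y, link x y → (M x ↔ M y)) (n : ℕ) :
    ∀ S : Multiset (Occ V), (sverts S).card ≤ n → (sverts S).Nodup →
    (∀ x ∈ sverts S, ∀ y, link x y → y ∈ sverts S) →
    (∀ x y y', sdir S x y → link y y' → ∃ x', link x' x ∧ sdir S x' y') →
    (∀ m p, ¬ CCycle link (sedge S) m p) → (∀ T ∈ S, T.WF M) → NDer true link S := by
  induction n with
  | zero =>
    intro S hS _ _ _ _ _
    rcases S.empty_or_exists_mem with rfl | ⟨T, hT⟩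
    · exact NDer.nil rfl
    · obtain ⟨x, hx⟩ := T.exists_mem_overts
      have := Multiset.card_pos_iff_exists_mem.2
        ⟨x, mem_sverts.2 ⟨T, hT, Multiset.mem_of_le T.overts_le_verts hx⟩⟩
      omega
  | succ n ih =>
    intro S hS hn hcl hbox hac hwf
    -- A link from an outer vertex to one below a modality would, by the box-context condition, put
    -- a directed edge into the outer vertex.
    have hcl' : ∀ x ∈ soverts S, ∀ y, link x y → y ∈ soverts S := by
      intro x hx y hxy
      by_contra hy
      obtain ⟨z, hz⟩ := exists_sdir (hcl x (Multiset.mem_of_le (soverts_le_sverts S) hx) y hxy) hy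
      obtain ⟨z', -, hz'⟩ := hbox z y x hz (link.symm hxy)
      exact not_mem_soverts_of_sdir hn hz' hx
    have hout : ∀ x y, sound S x y → sedge S x y := fun x y h =>
      (sound_iff_sedge hn (mem_of_sound h).1 (mem_of_sound h).2).1 h
    refine NDer.of_acyclic _ S le_rfl (Multiset.nodup_of_le (soverts_le_sverts S) hn) hcl' ?_ ?_
    · intro m p hp
      have hm := hp.mem (X := {x | x ∈ soverts S}) hcl' (fun x y => link.symm)
        (fun x y h => mem_of_sound h)
      exact hac m p (hp.congr fun i j hi hj => sound_iff_sedge hn (hm i hi) (hm j hj))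
    · rintro C hC ⟨c, hc⟩
      have hnl : (sverts (sleaves S)).Nodup := by rwa [sverts_sleaves]
      have hwf' : ∀ l ∈ C, l.WF M := by
        intro l hl
        obtain ⟨T, hT, hl⟩ := mem_sleaves.1 (Multiset.mem_of_le hC hl)
        exact wf_of_mem_leaves (hwf T hT) hl
      have hleaf : ∀ l ∈ C, l.IsLeaf := by
        intro l hl
        obtain ⟨T, hT, hl⟩ := mem_sleaves.1 (Multiset.mem_of_le hC hl)
        exact isLeaf_of_mem_leaves hl
      by_cases hMc : M c
      -- Links preserve `M`, and well-formedness places modalities exactly on `M`, so a class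
      -- consists only of boxes or only of atoms.
      · obtain ⟨L, rfl⟩ : ∃ L : Multiset (V × Occ V), C = L.map fun q => Occ.mod q.1 q.2 := by
          refine exists_map_mod fun T hT => ?_
          rcases hleaf T hT with ⟨x, rfl⟩ | h
          · exact absurd ((hM c x ((hc x).1 (mem_soverts.2 ⟨_, hT, by simp [overts]⟩))).1 hMc)
              (hwf' _ hT)
          · exact h
        simp only [soverts_map_mod] at hc
        have hmem : ∀ q ∈ L, Occ.mod q.1 q.2 ∈ sleaves S := fun q hq =>
          Multiset.mem_of_le hC (Multiset.mem_map_of_mem (fun q : V × Occ V => Occ.mod q.1 q.2) hq)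
        have hle : L.map Prod.fst + sverts (L.map Prod.snd) ≤ sverts S := by
          have := sverts_mono hC
          rwa [sverts_map_mod, sverts_sleaves] at this
        have hn' := Multiset.nodup_of_le hle hn
        have hcont : ∀ x, x ∈ sverts (L.map Prod.snd) ↔ ∃ q ∈ L, x ∈ q.2.verts := by
          intro x
          rw [mem_sverts]
          simp only [Multiset.mem_map]
          exact ⟨fun ⟨T, ⟨q, hq, h⟩, hx⟩ => ⟨q, hq, h ▸ hx⟩, fun ⟨q, hq, hx⟩ => ⟨q.2, ⟨q, hq, rfl⟩, hx⟩⟩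
        have hdir : ∀ q ∈ L, ∀ x y, (Occ.mod q.1 q.2).dir x y → sdir S x y := fun q hq x y h =>
          sdir_sleaves.1 ⟨_, hmem q hq, h⟩
        have huniq : ∀ q ∈ L, ∀ l ∈ sleaves S, ∀ x ∈ (Occ.mod q.1 q.2).verts, x ∈ l.verts →
            l = Occ.mod q.1 q.2 := fun q hq l hl x hx hxl =>
          eq_of_mem_verts hnl hl (hmem q hq) hxl hx
        have hnm : ∀ q ∈ L, q.1 ∉ q.2.verts := fun q hq =>
          (Multiset.nodup_cons.1 (nodup_verts_of_mem hnl (hmem q hq))).1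
        have hdir' : ∀ q ∈ L, ∀ x ∈ q.2.verts, ∀ y, sdir S x y → q.2.dir x y := by
          intro q hq x hx y h
          obtain ⟨l, hl, h⟩ := sdir_sleaves.2 h
          obtain rfl := huniq q hq l hl x (by simp [verts, hx]) (mem_of_dir h).1
          exact h.resolve_left fun h => hnm q hq (h.1 ▸ hx)
        -- A vertex linked to the contents of a box lies, by the box-context condition, below a
        -- modality linked to that of the box, hence below a modality of this same class.
        have hcl'' : ∀ x ∈ sverts (L.map Prod.snd), ∀ y, link x y →
            y ∈ sverts (L.map Prod.snd) := by
          intro x hx y hxy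
          obtain ⟨q, hq, hx⟩ := (hcont x).1 hx
          obtain ⟨x', hx'q, hx'⟩ := hbox q.1 x y (hdir q hq _ _ (Or.inl ⟨rfl, hx⟩)) hxy
          obtain ⟨q', hq', rfl⟩ := Multiset.mem_map.1 ((hc x').2 (link.trans
            ((hc q.1).1 (Multiset.mem_map_of_mem _ hq)) (link.symm hx'q)))
          obtain ⟨l, hl, h⟩ := sdir_sleaves.2 hx'
          obtain rfl := huniq q' hq' l hl q'.1 (by simp [verts]) (mem_of_dir h).1
          exact (hcont y).2 ⟨q', hq', h.elim And.right fun h => (mem_of_dir h).2⟩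
        -- The contents carry the induced graph, so acyclicity is inherited. The one point at issue
        -- is an edge between the contents of two boxes of the class.
        have hedge : ∀ x ∈ sverts (L.map Prod.snd), ∀ y ∈ sverts (L.map Prod.snd),
            (sedge (L.map Prod.snd) x y ↔ sedge S x y) := by
          intro x hx y hy
          constructor
          · rintro ⟨T, hT, h⟩
            obtain ⟨q, hq, rfl⟩ := Multiset.mem_map.1 hT
            rcases h with h | h
            · obtain ⟨T, hT, hl⟩ := mem_sleaves.1 (hmem q hq)
              exact ⟨T, hT, Or.inl (und_of_mem_leaves hl h)⟩
            · obtain ⟨T, hT, h⟩ := hdir q hq x y (Or.inr h)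
              exact ⟨T, hT, Or.inr h⟩
          · obtain ⟨q, hq, hx⟩ := (hcont x).1 hx
            obtain ⟨q', hq', hy⟩ := (hcont y).1 hy
            rintro ⟨T, hT, h | h⟩
            · rcases und_cases h with ⟨l, hl, h⟩ | ⟨l, hl, l', hl', hxl, hyl', h⟩
              · obtain rfl := huniq q hq l (mem_sleaves.2 ⟨T, hT, hl⟩) x (by simp [verts, hx])
                  (mem_of_und h).1
                exact ⟨q.2, Multiset.mem_map_of_mem _ hq, Or.inl h⟩
              · obtain rfl := huniq q hq l (mem_sleaves.2 ⟨T, hT, hl⟩) x (by simp [verts, hx]) hxl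
                obtain rfl := huniq q' hq' l' (mem_sleaves.2 ⟨T, hT, hl'⟩) y (by simp [verts, hy])
                  hyl'
                -- Such an edge would also join the two modalities, which are linked: a cycle of
                -- length two.
                have hab := h q.1 (by simp [overts]) q'.1 (by simp [overts])
                have hlk : link q.1 q'.1 := link.trans
                  (link.symm ((hc q.1).1 (Multiset.mem_map_of_mem _ hq)))
                  ((hc q'.1).1 (Multiset.mem_map_of_mem _ hq'))
                by_cases hne : q.1 = q'.1
                · rw [hne] at hab
                  exact absurd hab (ound_irrefl (nodup_verts_of_mem hn hT))
                · exact absurd (CCycle.of_linked_edge hne hlk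
                    (hout _ _ ⟨T, hT, ound_symm hab⟩)) (hac 2 _)
            · exact ⟨q.2, Multiset.mem_map_of_mem _ hq, Or.inr (hdir' q hq x hx y ⟨T, hT, h⟩)⟩
        refine NDer.box L c hc (ih _ ?_ (Multiset.nodup_add.1 hn').2.1 hcl'' ?_ ?_ ?_)
        -- The count drops because the modality `c` is removed.
        · have h1 := Multiset.card_le_card hle
          have h2 : 0 < (L.map Prod.fst).card :=
            Multiset.card_pos_iff_exists_mem.2 ⟨c, (hc c).2 (link.refl c)⟩
          rw [Multiset.card_add] at h1
          omega
        · intro x y y' hxy hyy'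
          have hx := (mem_of_sdir hxy).1
          obtain ⟨T, hT, h⟩ := hxy
          obtain ⟨q, hq, rfl⟩ := Multiset.mem_map.1 hT
          obtain ⟨x', hx'x, hx'⟩ := hbox x y y' (hdir q hq x y (Or.inr h)) hyy'
          obtain ⟨q', hq', hx'q'⟩ := (hcont x').1 (hcl'' x hx x' (link.symm hx'x))
          exact ⟨x', hx'x, q'.2, Multiset.mem_map_of_mem _ hq', hdir' q' hq' x' hx'q' y' hx'⟩
        · intro m p hp
          have hm := hp.mem (X := {x | x ∈ sverts (L.map Prod.snd)}) hcl'' (fun x y => link.symm)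
            (fun x y h => mem_of_sedge h)
          exact hac m p (hp.congr fun i j hi hj => hedge _ (hm i hi) _ (hm j hj))
        · intro T hT
          obtain ⟨q, hq, rfl⟩ := Multiset.mem_map.1 hT
          exact (hwf' _ (Multiset.mem_map_of_mem (fun q : V × Occ V => Occ.mod q.1 q.2) hq)).2
      · obtain ⟨s, rfl⟩ : ∃ s : Multiset V, C = s.map Occ.atom := by
          refine exists_map_atom fun T hT => ?_
          rcases hleaf T hT with h | ⟨x, A, rfl⟩
          · exact h
          · exact absurd ((hM c x ((hc x).1 (mem_soverts.2 ⟨_, hT, by simp [overts]⟩))).2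
              (hwf' _ hT).1) hMc
        exact NDer.cls s c (by simpa using hc)

end Boxes

/-! ## Paths and cycles in the graph of a derivable sequent -/

section Graph

variable {V : Type v} {link : Setoid V}

open Occ

/-- Used to pass from a modality to the contents of another box of its class: a link, then a
directed edge. -/
theorem CPath.triple {L E : V → V → Prop} {x y z : V} (hxy : x ≠ y) (hyz : y ≠ z) (hxz : x ≠ z)
    (h : L x y) (h' : E y z) (hc : ¬ E x z) :
    CPath L E 2 fun i => if i = 0 then x else if i = 1 then y else z := by
  refine ⟨⟨true, fun i hi => ?_⟩, fun i j hi hj h => ?_, fun i j hij hj => ?_⟩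
  · interval_cases i
    · simpa [AltStep] using ⟨h, hxy⟩
    · simpa [AltStep] using h'
  · interval_cases i <;> interval_cases j <;> simp_all [eq_comm]
  · obtain rfl : i = 0 := by omega
    obtain rfl : j = 2 := by omega
    simpa using hc

/-- From `p k` the cycle is followed forward to its end, which is also its start, and then once
around. Closure is needed only in the forward direction of edges, which suits directed edges. -/
theorem CCycle.mem_of_closed {L E : V → V → Prop} {X : Set V} {n : ℕ} {p : ℕ → V}
    (h : CCycle L E n p) (hL : ∀ x ∈ X, ∀ y, L x y → y ∈ X) (hE : ∀ x ∈ X, ∀ y, E x y → y ∈ X)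
    {k : ℕ} (hk : k ≤ n) (hkX : p k ∈ X) : ∀ i ≤ n, p i ∈ X := by
  obtain ⟨b, hb⟩ := h.alternating
  have h1 := mem_of_altStep (p := fun i => p (k + i)) (n := n - k) (X := X)
    (b := fun i => b ^^ (k + i).bodd) (fun i hi => hb (k + i) (by omega)) hL hE hkX (n - k) le_rfl
  refine mem_of_altStep hb hL hE ?_
  rw [← h.closed]
  convert h1 using 2
  omega

theorem CCycle.exists_edge {L E : V → V → Prop} {n : ℕ} {p : ℕ → V} (h : CCycle L E n p) :
    ∃ i < n, E (p i) (p (i + 1)) := by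
  obtain ⟨h0, ⟨k, rfl⟩, -, ⟨b, hb⟩, -, -⟩ := h
  have s0 := hb 0 h0
  have s1 := hb 1 (by omega)
  cases b
  · exact ⟨0, h0, by simpa [AltStep] using s0⟩
  · exact ⟨1, by omega, by simpa [AltStep] using s1⟩

theorem Occ.edge_tens {A B : Occ V} {x y : V} : (Occ.tens A B).edge x y ↔
    A.edge x y ∨ B.edge x y ∨ (x ∈ A.verts ∧ y ∈ B.verts) ∨ (x ∈ B.verts ∧ y ∈ A.verts) := by
  simp only [edge, und, dir]
  tauto

theorem Occ.edge_par {A B : Occ V} {x y : V} :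
    (Occ.par A B).edge x y ↔ A.edge x y ∨ B.edge x y := by
  simp only [edge, und, dir]
  tauto

theorem sedge_par {A B : Occ V} {S : Multiset (Occ V)} :
    sedge (Occ.par A B ::ₘ S) = sedge (A ::ₘ B ::ₘ S) := by
  ext x y
  simp only [sedge_cons, edge_par, or_assoc]

theorem sverts_par {A B : Occ V} {S : Multiset (Occ V)} :
    sverts (Occ.par A B ::ₘ S) = sverts (A ::ₘ B ::ₘ S) := by
  simp [verts, add_assoc]

theorem sverts_tens {A B : Occ V} {S T : Multiset (Occ V)} :
    sverts (Occ.tens A B ::ₘ (S + T)) = sverts (A ::ₘ S) + sverts (B ::ₘ T) := by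
  simp [verts, add_add_add_comm]

theorem sedge_tens {A B : Occ V} {S T : Multiset (Occ V)} {x y : V} :
    sedge (Occ.tens A B ::ₘ (S + T)) x y ↔ sedge (A ::ₘ S) x y ∨ sedge (B ::ₘ T) x y ∨
      (x ∈ A.verts ∧ y ∈ B.verts) ∨ (x ∈ B.verts ∧ y ∈ A.verts) := by
  simp only [sedge_cons, sedge_add, edge_tens]
  tauto

theorem sedge_tens_comm {A B : Occ V} {S T : Multiset (Occ V)} :
    sedge (Occ.tens A B ::ₘ (S + T)) = sedge (Occ.tens B A ::ₘ (T + S)) := by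
  ext x y
  simp only [sedge_tens]
  tauto

theorem mem_sverts_cons_left {A : Occ V} {S : Multiset (Occ V)} {x : V} (h : x ∈ A.verts) :
    x ∈ sverts (A ::ₘ S) := by
  simp [h]

theorem sedge_tens_left {A B : Occ V} {S T : Multiset (Occ V)}
    (hd : Disjoint (sverts (A ::ₘ S)) (sverts (B ::ₘ T))) {x y : V}
    (hx : x ∈ sverts (A ::ₘ S)) (hy : y ∈ sverts (A ::ₘ S)) :
    sedge (A ::ₘ S) x y ↔ sedge (Occ.tens A B ::ₘ (S + T)) x y := by
  rw [sedge_tens]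
  refine ⟨Or.inl, ?_⟩
  rintro (h | h | h | h)
  · exact h
  · exact absurd (mem_of_sedge h).1 (Multiset.disjoint_left.1 hd hx)
  · exact absurd (mem_sverts_cons_left h.2) (Multiset.disjoint_left.1 hd hy)
  · exact absurd (mem_sverts_cons_left h.1) (Multiset.disjoint_left.1 hd hx)

theorem sedge_tens_right {A B : Occ V} {S T : Multiset (Occ V)}
    (hd : Disjoint (sverts (A ::ₘ S)) (sverts (B ::ₘ T))) {x y : V}
    (hx : x ∈ sverts (B ::ₘ T)) (hy : y ∈ sverts (B ::ₘ T)) :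
    sedge (B ::ₘ T) x y ↔ sedge (Occ.tens A B ::ₘ (S + T)) x y := by
  rw [sedge_tens_comm]
  exact sedge_tens_left hd.symm hx hy

/-- The only edges between the two premises of a tensor are those of the complete join of `A` and
`B`. -/
theorem sedge_tens_cross {A B : Occ V} {S T : Multiset (Occ V)}
    (hd : Disjoint (sverts (A ::ₘ S)) (sverts (B ::ₘ T))) {x y : V}
    (hx : x ∈ sverts (A ::ₘ S)) (hy : y ∉ sverts (A ::ₘ S))
    (h : sedge (Occ.tens A B ::ₘ (S + T)) x y ∨ sedge (Occ.tens A B ::ₘ (S + T)) y x) :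
    x ∈ A.verts ∧ y ∈ B.verts := by
  have h1 := Multiset.disjoint_left.1 hd hx
  simp only [sedge_tens] at h
  rcases h with (h | h | h | h) | (h | h | h | h)
  · exact absurd (mem_of_sedge h).2 hy
  · exact absurd (mem_of_sedge h).1 h1
  · exact h
  · exact absurd (mem_sverts_cons_left h.1) h1
  · exact absurd (mem_of_sedge h).1 hy
  · exact absurd (mem_of_sedge h).2 h1
  · exact absurd (mem_sverts_cons_left h.2) h1
  · exact h.symm

theorem mem_iff_of_closed {X : Set V} (h : ∀ x ∈ X, ∀ y, link x y → y ∈ X) (x y : V)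
    (hxy : link x y) : x ∈ X ↔ y ∈ X :=
  ⟨fun hx => h x hx y hxy, fun hy => h y hy x (link.symm hxy)⟩

theorem sedge_map_mod {L : Multiset (V × Occ V)} {x y : V} :
    sedge (L.map fun q => Occ.mod q.1 q.2) x y ↔
      (∃ q ∈ L, x = q.1 ∧ y ∈ q.2.verts) ∨ sedge (L.map Prod.snd) x y := by
  simp only [sedge, Multiset.mem_map, edge, exists_exists_and_eq_and, und, dir]
  constructor
  · rintro ⟨q, hq, h | h | h⟩
    · exact Or.inr ⟨q, hq, Or.inl h⟩
    · exact Or.inl ⟨q, hq, h⟩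
    · exact Or.inr ⟨q, hq, Or.inr h⟩
  · rintro (⟨q, hq, h⟩ | ⟨q, hq, h | h⟩)
    · exact ⟨q, hq, Or.inr (Or.inl h)⟩
    · exact ⟨q, hq, Or.inl h⟩
    · exact ⟨q, hq, Or.inr (Or.inr h)⟩

theorem sdir_map_mod {L : Multiset (V × Occ V)} {x y : V} :
    sdir (L.map fun q => Occ.mod q.1 q.2) x y ↔
      (∃ q ∈ L, x = q.1 ∧ y ∈ q.2.verts) ∨ sdir (L.map Prod.snd) x y := by
  simp only [sdir, Multiset.mem_map, exists_exists_and_eq_and, dir]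
  constructor
  · rintro ⟨q, hq, h | h⟩
    · exact Or.inl ⟨q, hq, h⟩
    · exact Or.inr ⟨q, hq, h⟩
  · rintro (⟨q, hq, h⟩ | ⟨q, hq, h⟩)
    · exact ⟨q, hq, Or.inl h⟩
    · exact ⟨q, hq, Or.inr h⟩

theorem mem_sverts_snd {L : Multiset (V × Occ V)} {x : V} :
    x ∈ sverts (L.map Prod.snd) ↔ ∃ q ∈ L, x ∈ q.2.verts := by
  simp only [mem_sverts, Multiset.mem_map, exists_exists_and_eq_and]

theorem sedge_map_mod_mem {L : Multiset (V × Occ V)} {x y : V}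
    (h : sedge (L.map fun q => Occ.mod q.1 q.2) x y) : y ∈ sverts (L.map Prod.snd) := by
  rcases sedge_map_mod.1 h with ⟨q, hq, -, h⟩ | h
  · exact mem_sverts_snd.2 ⟨q, hq, h⟩
  · exact (mem_of_sedge h).2

/-- A promotion adds edges only out of the modalities, and with distinct vertices none of these lies
in the contents. -/
theorem sedge_map_mod_iff {L : Multiset (V × Occ V)}
    (hn : (sverts (L.map fun q => Occ.mod q.1 q.2)).Nodup) {x y : V}
    (hx : x ∈ sverts (L.map Prod.snd)) :
    sedge (L.map Prod.snd) x y ↔ sedge (L.map fun q => Occ.mod q.1 q.2) x y := by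
  rw [sedge_map_mod]
  refine ⟨Or.inr, fun h => h.resolve_left ?_⟩
  rintro ⟨q, hq, rfl, -⟩
  rw [sverts_map_mod] at hn
  exact nodup_add_disjoint hn (Multiset.mem_map_of_mem _ hq) hx

/-- There is a chordless path in the graph of `S` from `x` to `y`. -/
def Reach (link : Setoid V) (S : Multiset (Occ V)) (x y : V) : Prop :=
  ∃ n p, CPath link (sedge S) n p ∧ p 0 = x ∧ p n = y

theorem Reach.of_link {S : Multiset (Occ V)} {x y : V} (h : link x y) : Reach link S x y := by
  by_cases hxy : x = y
  · exact ⟨0, _, CPath.single x, rfl, hxy⟩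
  · exact ⟨1, _, CPath.pair (b := true) (by simpa [AltStep] using ⟨h, hxy⟩) hxy, by simp, by simp⟩

theorem Reach.mono {S S' : Multiset (Occ V)} {x y : V} (h : Reach link S x y)
    (hcl : ∀ x ∈ sverts S, ∀ y, link x y → y ∈ sverts S)
    (hE : ∀ x ∈ sverts S, ∀ y ∈ sverts S, (sedge S x y ↔ sedge S' x y)) (hx : x ∈ sverts S) :
    Reach link S' x y := by
  obtain ⟨n, p, hp, rfl, rfl⟩ := h
  have hm := hp.mem (X := {x | x ∈ sverts S}) hcl (fun x _ y h => (mem_of_sedge h).2) hx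
  exact ⟨n, p, hp.congr fun i j hi hj => hE _ (hm i hi) _ (hm j hj), rfl, rfl⟩

/-- A chordless path between vertices of one premise cannot make an excursion through the join. -/
theorem Reach.restrict_tens {A B : Occ V} {S T : Multiset (Occ V)} {x y : V}
    (hd : Disjoint (sverts (A ::ₘ S)) (sverts (B ::ₘ T)))
    (hcl : ∀ x ∈ sverts (A ::ₘ S), ∀ y, link x y → y ∈ sverts (A ::ₘ S))
    (h : Reach link (Occ.tens A B ::ₘ (S + T)) x y) (hx : x ∈ sverts (A ::ₘ S))
    (hy : y ∈ sverts (A ::ₘ S)) : Reach link (A ::ₘ S) x y := by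
  obtain ⟨n, p, hp, rfl, rfl⟩ := h
  have hm := hp.mem_of_join (X := {x | x ∈ sverts (A ::ₘ S)}) (A := {x | x ∈ A.verts})
    (B := {x | x ∈ B.verts}) (mem_iff_of_closed hcl)
    (fun x hx y hy h => sedge_tens_cross hd hx hy h)
    (fun x hx y hy => sedge_tens.2 (Or.inr (Or.inr (Or.inl ⟨hx, hy⟩)))) hx hy
  exact ⟨n, p, hp.congr fun i j hi hj => (sedge_tens_left hd (hm i hi) (hm j hj)).symm, rfl, rfl⟩

theorem Reach.join {A B : Occ V} {S T : Multiset (Occ V)} {x y a b : V}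
    (hn : (sverts (Occ.tens A B ::ₘ (S + T))).Nodup)
    (hS : ∀ x ∈ sverts (A ::ₘ S), ∀ y, link x y → y ∈ sverts (A ::ₘ S))
    (hT : ∀ x ∈ sverts (B ::ₘ T), ∀ y, link x y → y ∈ sverts (B ::ₘ T))
    (hx : x ∈ sverts (A ::ₘ S)) (ha : a ∈ A.verts) (hb : b ∈ B.verts)
    (h : Reach link (A ::ₘ S) x a) (h' : Reach link (B ::ₘ T) b y) :
    Reach link (Occ.tens A B ::ₘ (S + T)) x y := by
  rw [sverts_tens, Multiset.nodup_add] at hn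
  obtain ⟨n1, n2, hd⟩ := hn
  rw [sverts_cons] at n1 n2
  have hd' : ∀ z ∈ sverts (A ::ₘ S), z ∉ sverts (B ::ₘ T) :=
    fun z hz => Multiset.disjoint_left.1 hd hz
  obtain ⟨n, p, hp, rfl, rfl⟩ := h
  obtain ⟨m, q, hq, rfl, rfl⟩ := h'
  have hpm := hp.mem (X := {x | x ∈ sverts (A ::ₘ S)}) hS (fun x _ y h => (mem_of_sedge h).2) hx
  have hqm := hq.mem (X := {x | x ∈ sverts (B ::ₘ T)}) hT (fun x _ y h => (mem_of_sedge h).2)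
    (mem_sverts_cons_left hb)
  have hp' := hp.congr (E' := sedge (Occ.tens A B ::ₘ (S + T)))
    fun i j hi hj => sedge_tens_left hd (hpm i hi) (hpm j hj)
  have hq' := hq.congr (E' := sedge (Occ.tens A B ::ₘ (S + T)))
    fun i j hi hj => sedge_tens_right hd (hqm i hi) (hqm j hj)
  exact hp'.exists_join hq' (A := {x | x ∈ A.verts}) (B := {x | x ∈ B.verts}) hpm hqm
    (fun x hx hx' => hd' x hx hx')
    (fun x hx y hy => ⟨fun h => sedge_tens_cross hd hx (fun hy' => hd' y hy' hy) (Or.inl h),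
      fun h => sedge_tens.2 (Or.inr (Or.inr (Or.inl h)))⟩)
    (fun x hx y hy hxA h => by
      rcases sedge_cons.1 ((sedge_tens_left hd hx (mem_sverts_cons_left hy)).2 h) with h | h
      · exact hxA (mem_of_edge h).1
      · exact nodup_add_disjoint n1 hy (mem_of_sedge h).2)
    (fun x hx y hy hyB h => by
      rcases sedge_cons.1 ((sedge_tens_right hd (mem_sverts_cons_left hx) hy).2 h) with h | h
      · exact hyB (mem_of_edge h).2
      · exact nodup_add_disjoint n2 hx (mem_of_sedge h).1) ha hb

theorem Reach.congr_edge {S S' : Multiset (Occ V)} (hE : sedge S = sedge S') {x y : V} :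
    Reach link S x y ↔ Reach link S' x y := by
  rw [Reach, Reach, hE]

/-- A derivation with mix of a sequent whose vertices are pairwise connected does not need mix. -/
theorem NDer.mixfree {N : Multiset (Occ V)} (h : NDer true link N) : (sverts N).Nodup →
    N = 0 ∨ NDer false link N ∨
      ∃ x ∈ sverts N, ∃ y ∈ sverts N, ¬ Reach link N x y ∧ ¬ Reach link N y x := by
  induction h with
  | cls s c h => exact fun _ => Or.inr (Or.inl (NDer.cls s c h))
  | nil _ => exact fun _ => Or.inl rfl
  | box L c h hL ih =>
    intro hn
    have hn' := hn
    rw [sverts_map_mod, Multiset.nodup_add] at hn'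
    rcases ih hn'.2.1 with h0 | hf | ⟨x, hx, y, hy, hxy, hyx⟩
    · rw [Multiset.map_eq_zero] at h0
      subst h0
      exact absurd ((h c).2 (link.refl c)) (by simp)
    · exact Or.inr (Or.inl (NDer.box L c h hf))
    -- Every edge ends in the contents and the contents are closed under links, so a path from the
    -- contents never visits the new modalities.
    · have key : ∀ x ∈ sverts (L.map Prod.snd), ∀ y,
          Reach link (L.map fun q => Occ.mod q.1 q.2) x y → Reach link (L.map Prod.snd) x y := by
        rintro x hx y ⟨n, p, hp, rfl, rfl⟩
        have hm := hp.mem (X := {x | x ∈ sverts (L.map Prod.snd)}) hL.sverts_closed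
          (fun x _ y h => sedge_map_mod_mem h) hx
        exact ⟨n, p, hp.congr fun i j hi hj => (sedge_map_mod_iff hn (hm i hi)).symm, rfl, rfl⟩
      exact Or.inr (Or.inr ⟨x, by simp [hx], y, by simp [hy], fun h => hxy (key _ hx _ h),
        fun h => hyx (key _ hy _ h)⟩)
  | par A B S hS ih =>
    intro hn
    rw [sverts_par] at hn ⊢
    rcases ih hn with h | h | h
    · simp at h
    · exact Or.inr (Or.inl (NDer.par _ _ _ h))
    · refine Or.inr (Or.inr ?_)
      simpa only [Reach.congr_edge (link := link) (sedge_par (A := A) (B := B) (S := S))] using h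
  | tens A B S T hS hT ihS ihT =>
    intro hn
    rw [sverts_tens] at hn ⊢
    obtain ⟨n1, n2, hd⟩ := Multiset.nodup_add.1 hn
    rcases ihS n1 with h | h | ⟨x, hx, y, hy, hxy, hyx⟩
    · simp at h
    · rcases ihT n2 with h' | h' | ⟨x, hx, y, hy, hxy, hyx⟩
      · simp at h'
      · exact Or.inr (Or.inl (NDer.tens _ _ _ _ h h'))
      · refine Or.inr (Or.inr ⟨x, Multiset.mem_add.2 (Or.inr hx), y, Multiset.mem_add.2 (Or.inr hy),
          fun h => hxy ?_, fun h => hyx ?_⟩)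
        · exact Reach.restrict_tens hd.symm hT.sverts_closed
            ((Reach.congr_edge sedge_tens_comm).1 h) hx hy
        · exact Reach.restrict_tens hd.symm hT.sverts_closed
            ((Reach.congr_edge sedge_tens_comm).1 h) hy hx
    · exact Or.inr (Or.inr ⟨x, Multiset.mem_add.2 (Or.inl hx), y, Multiset.mem_add.2 (Or.inl hy),
        fun h => hxy (h.restrict_tens hd hS.sverts_closed hx hy),
        fun h => hyx (h.restrict_tens hd hS.sverts_closed hy hx)⟩)
  | mix _ S T hS hT ihS ihT =>
    intro hn
    rw [sverts_add, Multiset.nodup_add] at hn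
    rcases S.empty_or_exists_mem with rfl | ⟨U, hU⟩
    · simpa using ihT hn.2.1
    rcases T.empty_or_exists_mem with rfl | ⟨W, hW⟩
    · simpa using ihS hn.1
    obtain ⟨x, hx⟩ := U.exists_mem_overts
    obtain ⟨y, hy⟩ := W.exists_mem_overts
    have hx : x ∈ sverts S := mem_sverts.2 ⟨U, hU, Multiset.mem_of_le U.overts_le_verts hx⟩
    have hy : y ∈ sverts T := mem_sverts.2 ⟨W, hW, Multiset.mem_of_le W.overts_le_verts hy⟩
    -- Neither links nor edges cross a mix, so any two vertices from its two nonempty sides are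
    -- witnesses.
    refine Or.inr (Or.inr ⟨x, by simp [hx], y, by simp [hy], ?_, ?_⟩)
    · rintro ⟨n, p, hp, rfl, rfl⟩
      refine Multiset.disjoint_left.1 hn.2.2 (hp.mem (X := {x | x ∈ sverts S}) hS.sverts_closed
        (fun x hx y h => ?_) hx n le_rfl) hy
      rcases sedge_add.1 h with h | h
      · exact (mem_of_sedge h).2
      · exact absurd (mem_of_sedge h).1 (Multiset.disjoint_left.1 hn.2.2 hx)
    · rintro ⟨n, p, hp, rfl, rfl⟩
      refine Multiset.disjoint_right.1 hn.2.2 (hp.mem (X := {x | x ∈ sverts T}) hT.sverts_closed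
        (fun x hx y h => ?_) hy n le_rfl) hx
      rcases sedge_add.1 h with h | h
      · exact absurd (mem_of_sedge h).1 (Multiset.disjoint_right.1 hn.2.2 hx)
      · exact (mem_of_sedge h).2

/-- A vertex linked to the contents of a box is again in the contents of the same promotion, whose
modalities form one class. The other rules create no directed edges. -/
theorem NDer.boxContext {N : Multiset (Occ V)} (h : NDer false link N) :
    ∀ x y y', sdir N x y → link y y' → ∃ x', link x' x ∧ sdir N x' y' := by
  induction h with
  | cls s c h =>
    rintro x y y' ⟨T, hT, h⟩
    obtain ⟨z, -, rfl⟩ := Multiset.mem_map.1 hT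
    exact h.elim
  | nil h => simp at h
  | mix h => simp at h
  | box L c h hL ih =>
    intro x y y' hxy hyy'
    simp only [sdir_map_mod] at hxy ⊢
    rcases hxy with ⟨q, hq, rfl, hy⟩ | hxy
    · obtain ⟨q', hq', hy'⟩ := mem_sverts_snd.1
        (hL.sverts_closed y (mem_sverts_snd.2 ⟨q, hq, hy⟩) y' hyy')
      exact ⟨q'.1, link.trans (link.symm ((h q'.1).1 (Multiset.mem_map_of_mem _ hq')))
        ((h q.1).1 (Multiset.mem_map_of_mem _ hq)), Or.inl ⟨q', hq', rfl, hy'⟩⟩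
    · obtain ⟨x', h1, h2⟩ := ih x y y' hxy hyy'
      exact ⟨x', h1, Or.inr h2⟩
  | par A B S hS ih => simpa [dir, or_assoc] using ih
  | tens A B S T hS hT ihS ihT =>
    have key : ∀ x y, sdir (Occ.tens A B ::ₘ (S + T)) x y ↔ sdir (A ::ₘ S) x y ∨
        sdir (B ::ₘ T) x y := by
      intro x y
      simp only [sdir_cons, sdir_add, dir]
      tauto
    intro x y y' hxy hyy'
    simp only [key] at hxy ⊢
    rcases hxy with h | h
    · obtain ⟨x', h1, h2⟩ := ihS x y y' h hyy'
      exact ⟨x', h1, Or.inl h2⟩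
    · obtain ⟨x', h1, h2⟩ := ihT x y y' h hyy'
      exact ⟨x', h1, Or.inr h2⟩

/-- A chordless cycle cannot cross the join of a tensor, nor pass through the modalities of a
promotion, so it already lies in a premise. Axioms have no edges. -/
theorem NDer.acyclic {N : Multiset (Occ V)} (h : NDer false link N) (hn : (sverts N).Nodup) :
    ∀ n p, ¬ CCycle link (sedge N) n p := by
  induction h with
  | cls s c h =>
    intro n p hp
    obtain ⟨i, -, T, hT, h⟩ := hp.exists_edge
    obtain ⟨z, -, rfl⟩ := Multiset.mem_map.1 hT
    exact h.elim id id
  | nil h => simp at h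
  | mix h => simp at h
  | box L c h hL ih =>
    intro n p hp
    obtain ⟨i, hi, he⟩ := hp.exists_edge
    -- A cycle uses an edge, edges end in the contents, and from there neither a link nor an edge
    -- leads out.
    have hm := hp.mem_of_closed (X := {x | x ∈ sverts (L.map Prod.snd)}) hL.sverts_closed
      (fun x _ y h => sedge_map_mod_mem h) (show i + 1 ≤ n from hi) (sedge_map_mod_mem he)
    have hn' := hn
    rw [sverts_map_mod, Multiset.nodup_add] at hn'
    exact ih hn'.2.1 n p (hp.congr fun i j hi _ => (sedge_map_mod_iff hn (hm i hi)).symm)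
  | par A B S hS ih =>
    rw [sverts_par] at hn
    rw [sedge_par]
    exact ih hn
  | tens A B S T hS hT ihS ihT =>
    intro n p hp
    rw [sverts_tens] at hn
    obtain ⟨n1, n2, hd⟩ := Multiset.nodup_add.1 hn
    have hcl : ∀ x ∈ sverts (A ::ₘ S) + sverts (B ::ₘ T), ∀ y, link x y →
        y ∈ sverts (A ::ₘ S) + sverts (B ::ₘ T) := fun x hx y hxy => Multiset.mem_add.2
      ((Multiset.mem_add.1 hx).imp (fun h => hS.sverts_closed x h y hxy)
        (fun h => hT.sverts_closed x h y hxy))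
    have h0 := hp.mem (X := {x | x ∈ sverts (A ::ₘ S) + sverts (B ::ₘ T)}) hcl
      (fun x y => link.symm) (fun x y h => by
        have := mem_of_sedge h
        rwa [sverts_tens] at this) 0 (Nat.zero_le n)
    rcases Multiset.mem_add.1 h0 with h0 | h0
    · have hm := hp.mem_of_join (X := {x | x ∈ sverts (A ::ₘ S)}) (A := {x | x ∈ A.verts})
        (B := {x | x ∈ B.verts}) (mem_iff_of_closed hS.sverts_closed)
        (fun x hx y hy h => sedge_tens_cross hd hx hy h)
        (fun x hx y hy => sedge_tens.2 (Or.inr (Or.inr (Or.inl ⟨hx, hy⟩)))) (Nat.zero_le n) h0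
      exact ihS n1 n p (hp.congr fun i j hi hj => (sedge_tens_left hd (hm i hi) (hm j hj)).symm)
    · rw [sedge_tens_comm] at hp
      have hm := hp.mem_of_join (X := {x | x ∈ sverts (B ::ₘ T)}) (A := {x | x ∈ B.verts})
        (B := {x | x ∈ A.verts}) (mem_iff_of_closed hT.sverts_closed)
        (fun x hx y hy h => sedge_tens_cross hd.symm hx hy h)
        (fun x hx y hy => sedge_tens.2 (Or.inr (Or.inr (Or.inl ⟨hx, hy⟩)))) (Nat.zero_le n) h0
      exact ihT n2 n p
        (hp.congr fun i j hi hj => (sedge_tens_left hd.symm (hm i hi) (hm j hj)).symm)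

theorem Reach.join_right {A B : Occ V} {S T : Multiset (Occ V)} {x y a b : V}
    (hn : (sverts (Occ.tens A B ::ₘ (S + T))).Nodup)
    (hS : ∀ x ∈ sverts (A ::ₘ S), ∀ y, link x y → y ∈ sverts (A ::ₘ S))
    (hT : ∀ x ∈ sverts (B ::ₘ T), ∀ y, link x y → y ∈ sverts (B ::ₘ T))
    (hx : x ∈ sverts (B ::ₘ T)) (ha : a ∈ A.verts) (hb : b ∈ B.verts)
    (h : Reach link (B ::ₘ T) x b) (h' : Reach link (A ::ₘ S) a y) :
    Reach link (Occ.tens A B ::ₘ (S + T)) x y := by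
  rw [Reach.congr_edge sedge_tens_comm]
  refine Reach.join ?_ hT hS hx hb ha h h'
  rw [sverts_tens] at hn ⊢
  rwa [add_comm]

theorem Reach.tens_left {A B : Occ V} {S T : Multiset (Occ V)} {x y : V}
    (hn : (sverts (Occ.tens A B ::ₘ (S + T))).Nodup)
    (hS : ∀ x ∈ sverts (A ::ₘ S), ∀ y, link x y → y ∈ sverts (A ::ₘ S))
    (hx : x ∈ sverts (A ::ₘ S)) (h : Reach link (A ::ₘ S) x y) :
    Reach link (Occ.tens A B ::ₘ (S + T)) x y := by
  rw [sverts_tens, Multiset.nodup_add] at hn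
  exact h.mono hS (fun x hx y hy => sedge_tens_left hn.2.2 hx hy) hx

theorem Reach.tens_right {A B : Occ V} {S T : Multiset (Occ V)} {x y : V}
    (hn : (sverts (Occ.tens A B ::ₘ (S + T))).Nodup)
    (hT : ∀ x ∈ sverts (B ::ₘ T), ∀ y, link x y → y ∈ sverts (B ::ₘ T))
    (hx : x ∈ sverts (B ::ₘ T)) (h : Reach link (B ::ₘ T) x y) :
    Reach link (Occ.tens A B ::ₘ (S + T)) x y := by
  rw [sverts_tens, Multiset.nodup_add] at hn
  exact h.mono hT (fun x hx y hy => sedge_tens_right hn.2.2 hx hy) hx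

theorem Reach.box {L : Multiset (V × Occ V)} {x y : V}
    (hn : (sverts (L.map fun q => Occ.mod q.1 q.2)).Nodup)
    (hL : ∀ x ∈ sverts (L.map Prod.snd), ∀ y, link x y → y ∈ sverts (L.map Prod.snd))
    (hx : x ∈ sverts (L.map Prod.snd)) (h : Reach link (L.map Prod.snd) x y) :
    Reach link (L.map fun q => Occ.mod q.1 q.2) x y :=
  h.mono hL (fun _ hx _ _ => sedge_map_mod_iff hn hx) hx

theorem mem_sverts_of_mem {S : Multiset (Occ V)} {T : Occ V} (hT : T ∈ S) {x : V}
    (hx : x ∈ T.verts) : x ∈ sverts S := mem_sverts.2 ⟨T, hT, hx⟩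

/-- Every vertex is connected, in both directions, to every formula of the sequent. -/
theorem NDer.reach {N : Multiset (Occ V)} (h : NDer false link N) : (sverts N).Nodup →
    ∀ x ∈ sverts N, ∀ T ∈ N, (∃ t ∈ T.verts, Reach link N x t) ∧ ∃ t ∈ T.verts, Reach link N t x := by
  induction h with
  | cls s c h =>
    intro _ x hx T hT
    obtain ⟨y, hy, rfl⟩ := Multiset.mem_map.1 hT
    rw [sverts_map_atom] at hx
    have hxy : link x y := link.trans (link.symm ((h x).1 hx)) ((h y).1 hy)
    exact ⟨⟨y, by simp [verts], Reach.of_link hxy⟩, ⟨y, by simp [verts],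
      Reach.of_link (link.symm hxy)⟩⟩
  | nil h => simp at h
  | mix h => simp at h
  | box L c h hL ih =>
    intro hn x hx T hT
    obtain ⟨q, hq, rfl⟩ := Multiset.mem_map.1 hT
    have hn' := hn
    rw [sverts_map_mod, Multiset.nodup_add] at hn'
    rw [sverts_map_mod] at hx
    rcases Multiset.mem_add.1 hx with hx | hx
    · have hxy : link x q.1 := link.trans (link.symm ((h x).1 hx))
        ((h q.1).1 (Multiset.mem_map_of_mem _ hq))
      exact ⟨⟨q.1, by simp [verts], Reach.of_link hxy⟩, ⟨q.1, by simp [verts],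
        Reach.of_link (link.symm hxy)⟩⟩
    · obtain ⟨⟨t, ht, h1⟩, ⟨t', ht', h2⟩⟩ := ih hn'.2.1 x hx q.2 (Multiset.mem_map_of_mem _ hq)
      exact ⟨⟨t, by simp [verts, ht], h1.box hn hL.sverts_closed hx⟩, ⟨t', by simp [verts, ht'],
        h2.box hn hL.sverts_closed (mem_sverts_snd.2 ⟨q, hq, ht'⟩)⟩⟩
  | par A B S hS ih =>
    intro hn x hx T hT
    rw [sverts_par] at hn hx
    simp only [Reach.congr_edge sedge_par]
    rcases Multiset.mem_cons.1 hT with rfl | hT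
    · obtain ⟨⟨t, ht, h1⟩, ⟨t', ht', h2⟩⟩ := ih hn x hx A (by simp)
      exact ⟨⟨t, by simp [verts, ht], h1⟩, ⟨t', by simp [verts, ht'], h2⟩⟩
    · exact ih hn x hx T (by simp [hT])
  | tens A B S T hS hT ihS ihT =>
    intro hn x hx U hU
    have hn' := hn
    rw [sverts_tens, Multiset.nodup_add] at hn'
    rw [sverts_tens] at hx
    have cS := hS.sverts_closed
    have cT := hT.sverts_closed
    rcases Multiset.mem_add.1 hx with hx | hx
    · obtain ⟨⟨a, ha, h1⟩, ⟨a', ha', h2⟩⟩ := ihS hn'.1 x hx A (by simp)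
      rw [Multiset.mem_cons, Multiset.mem_add] at hU
      rcases hU with rfl | hU | hU
      · exact ⟨⟨a, by simp [verts, ha], h1.tens_left hn cS hx⟩, ⟨a', by simp [verts, ha'],
          h2.tens_left hn cS (mem_sverts_cons_left ha')⟩⟩
      · obtain ⟨⟨t, ht, h1⟩, ⟨t', ht', h2⟩⟩ := ihS hn'.1 x hx U (by simp [hU])
        exact ⟨⟨t, ht, h1.tens_left hn cS hx⟩, ⟨t', ht', h2.tens_left hn cS
          (mem_sverts_of_mem (Multiset.mem_cons_of_mem hU) ht')⟩⟩
      -- For a formula of the other premise, any vertex `b` of `B` serves as the bridge: join a path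
      -- between `x` and `A` with one between `b` and the formula.
      · obtain ⟨b, hb⟩ := B.exists_mem_overts
        have hb := Multiset.mem_of_le B.overts_le_verts hb
        obtain ⟨⟨t, ht, h3⟩, ⟨t', ht', h4⟩⟩ :=
          ihT hn'.2.1 b (mem_sverts_cons_left hb) U (by simp [hU])
        exact ⟨⟨t, ht, Reach.join hn cS cT hx ha hb h1 h3⟩, ⟨t', ht', Reach.join_right hn cS cT
          (mem_sverts_of_mem (Multiset.mem_cons_of_mem hU) ht') ha' hb h4 h2⟩⟩
    · obtain ⟨⟨b, hb, h1⟩, ⟨b', hb', h2⟩⟩ := ihT hn'.2.1 x hx B (by simp)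
      rw [Multiset.mem_cons, Multiset.mem_add] at hU
      rcases hU with rfl | hU | hU
      · exact ⟨⟨b, by simp [verts, hb], h1.tens_right hn cT hx⟩, ⟨b', by simp [verts, hb'],
          h2.tens_right hn cT (mem_sverts_cons_left hb')⟩⟩
      · obtain ⟨a, ha⟩ := A.exists_mem_overts
        have ha := Multiset.mem_of_le A.overts_le_verts ha
        obtain ⟨⟨t, ht, h3⟩, ⟨t', ht', h4⟩⟩ :=
          ihS hn'.1 a (mem_sverts_cons_left ha) U (by simp [hU])
        exact ⟨⟨t, ht, Reach.join_right hn cS cT hx ha hb h1 h3⟩, ⟨t', ht', Reach.join hn cS cT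
          (mem_sverts_of_mem (Multiset.mem_cons_of_mem hU) ht') ha hb' h4 h2⟩⟩
      · obtain ⟨⟨t, ht, h1⟩, ⟨t', ht', h2⟩⟩ := ihT hn'.2.1 x hx U (by simp [hU])
        exact ⟨⟨t, ht, h1.tens_right hn cT hx⟩, ⟨t', ht', h2.tens_right hn cT
          (mem_sverts_of_mem (Multiset.mem_cons_of_mem hU) ht')⟩⟩

/-- The real content is the case of two vertices from different premises of a tensor, where
`NDer.reach` supplies paths to and from the tensor components. -/
theorem NDer.connected {N : Multiset (Occ V)} (h : NDer false link N) : (sverts N).Nodup →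
    ∀ x ∈ sverts N, ∀ y ∈ sverts N, Reach link N x y ∨ Reach link N y x := by
  induction h with
  | cls s c h =>
    intro _ x hx y hy
    rw [sverts_map_atom] at hx hy
    exact Or.inl (Reach.of_link (link.trans (link.symm ((h x).1 hx)) ((h y).1 hy)))
  | nil h => simp at h
  | mix h => simp at h
  | box L c h hL ih =>
    intro hn x hx y hy
    have hn' := hn
    rw [sverts_map_mod] at hn' hx hy
    have hdisj := fun z => nodup_add_disjoint hn' (x := z)
    -- Either `x` is the modality above `y`, or a link leads from `x` to a modality above `y`. Paths
    -- exist only towards the contents, which is why connectedness is asked in one direction only.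
    have key : ∀ x ∈ L.map Prod.fst, ∀ y ∈ sverts (L.map Prod.snd),
        Reach link (L.map fun q => Occ.mod q.1 q.2) x y := by
      intro x hx y hy
      by_cases hxy : sedge (L.map fun q => Occ.mod q.1 q.2) x y
      · have hne : x ≠ y := fun h => hdisj x hx (h ▸ hy)
        exact ⟨1, _, CPath.pair (b := false) (by simpa [AltStep] using hxy) hne, by simp, by simp⟩
      · obtain ⟨q, hq, hyq⟩ := mem_sverts_snd.1 hy
        have hq1 : q.1 ∈ L.map Prod.fst := Multiset.mem_map_of_mem _ hq
        have he : sedge (L.map fun q => Occ.mod q.1 q.2) q.1 y :=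
          sedge_map_mod.2 (Or.inl ⟨q, hq, rfl, hyq⟩)
        refine ⟨2, _, CPath.triple (x := x) (y := q.1) (z := y) (fun h => hxy (h ▸ he))
          (fun h => hdisj q.1 hq1 (h ▸ hy)) (fun h => hdisj x hx (h ▸ hy))
          (link.trans (link.symm ((h x).1 hx)) ((h q.1).1 hq1)) he hxy, by simp, by simp⟩
    rcases Multiset.mem_add.1 hx with hx | hx <;> rcases Multiset.mem_add.1 hy with hy | hy
    · exact Or.inl (Reach.of_link (link.trans (link.symm ((h x).1 hx)) ((h y).1 hy)))
    · exact Or.inl (key x hx y hy)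
    · exact Or.inr (key y hy x hx)
    · exact (ih (Multiset.nodup_add.1 hn').2.1 x hx y hy).imp
        (Reach.box hn hL.sverts_closed hx) (Reach.box hn hL.sverts_closed hy)
  | par A B S hS ih =>
    intro hn x hx y hy
    rw [sverts_par] at hn hx hy
    simp only [Reach.congr_edge sedge_par]
    exact ih hn x hx y hy
  | tens A B S T hS hT ihS ihT =>
    intro hn x hx y hy
    have hn' := hn
    rw [sverts_tens, Multiset.nodup_add] at hn'
    rw [sverts_tens] at hx hy
    have cS := hS.sverts_closed
    have cT := hT.sverts_closed
    have key : ∀ x ∈ sverts (A ::ₘ S), ∀ y ∈ sverts (B ::ₘ T),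
        Reach link (Occ.tens A B ::ₘ (S + T)) x y := by
      intro x hx y hy
      obtain ⟨⟨a, ha, h1⟩, -⟩ := hS.reach hn'.1 x hx A (by simp)
      obtain ⟨-, ⟨b, hb, h2⟩⟩ := hT.reach hn'.2.1 y hy B (by simp)
      exact Reach.join hn cS cT hx ha hb h1 h2
    rcases Multiset.mem_add.1 hx with hx | hx <;> rcases Multiset.mem_add.1 hy with hy | hy
    · exact (ihS hn'.1 x hx y hy).imp (Reach.tens_left hn cS hx) (Reach.tens_left hn cS hy)
    · exact Or.inl (key x hx y hy)
    · exact Or.inr (key y hy x hx)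
    · exact (ihT hn'.2.1 x hx y hy).imp (Reach.tens_right hn cT hx) (Reach.tens_right hn cT hy)

end Graph

/-! ## Located derivations and derivations -/

section Labels

variable {𝒜 : Type u} {V : Type v}

/-- The formula of a vertex that carries a literal or a constant. -/
def Label.toFormula : Label 𝒜 → Formula 𝒜
  | .pos a => .pos a
  | .neg a => .neg a
  | .one => .one
  | .bot => .bot
  -- This covers `!` and `?` as well; well-formedness keeps them off the atoms.
  | _ => .jump

/-- The underlying formula. -/
def Occ.toFormula (lab : V → Label 𝒜) : Occ V → Formula 𝒜
  | .atom x => (lab x).toFormula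
  | .par A B => .par (A.toFormula lab) (B.toFormula lab)
  | .tens A B => .tens (A.toFormula lab) (B.toFormula lab)
  | .mod x A => match lab x with
    | .bang => .bang (A.toFormula lab)
    -- In a well-formed formula the only remaining label here is `?`.
    | _ => .quest (A.toFormula lab)

/-- The conditions on the linking class of one vertex of an RGB-cograph. -/
structure GoodAt (lab : V → Label 𝒜) (link : Setoid V) (x : V) : Prop where
  ne_bot : lab x ≠ Label.bot
  atom : (lab x).IsAtom → ∃! y, (lab y).IsAtom ∧ link x y ∧ x ≠ y
  dual : ∀ y, (lab x).IsAtom → (lab y).IsAtom → link x y → x ≠ y → (lab x).Dual (lab y)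
  one : lab x = Label.one → ∀ y, link x y → y ≠ x → lab y = Label.jump
  jump : lab x = Label.jump → ∃ y, ((lab y).IsAtom ∨ lab y = Label.one) ∧ link x y
  modal : (lab x).IsModal → (∀ y, link x y → (lab y).IsModal) ∧ ∃! y, lab y = Label.bang ∧ link x y

theorem RGBCograph.goodAt (G : RGBCograph 𝒜 V) (x : V) : GoodAt G.lab G.link x :=
  ⟨G.lab_ne_bot x, G.link_atom x, G.link_dual x, G.link_one x, G.link_jump x, G.link_modal x⟩

theorem GoodAt.congr {lab : V → Label 𝒜} {link link' : Setoid V} {x : V} (h : GoodAt lab link x)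
    (hl : ∀ y, link x y ↔ link' x y) : GoodAt lab link' x := by
  obtain ⟨h1, h2, h3, h4, h5, h6⟩ := h
  simp only [hl] at h2 h3 h4 h5 h6
  exact ⟨h1, h2, h3, h4, h5, h6⟩

theorem Label.not_isModal_of_isAtom {l : Label 𝒜} (h : l.IsAtom) : ¬ l.IsModal := by
  rcases h with ⟨a, rfl⟩ | ⟨a, rfl⟩ <;> simp [Label.IsModal]

theorem Label.cases_of_not_isModal {l : Label 𝒜} (h : ¬ l.IsModal) (hb : l ≠ .bot) :
    l.IsAtom ∨ l = .one ∨ l = .jump := by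
  cases l <;> simp_all [Label.IsModal, Label.IsAtom]

theorem map_toFormula_jump {lab : V → Label 𝒜} {s : Multiset V}
    (h : ∀ x ∈ s, lab x = Label.jump) :
    s.map (fun x => (lab x).toFormula) = Multiset.replicate s.card Formula.jump := by
  rw [Multiset.eq_replicate]
  refine ⟨by simp, fun b hb => ?_⟩
  obtain ⟨x, hx, rfl⟩ := Multiset.mem_map.1 hb
  rw [h x hx]
  rfl

/-- Located derivations without mix give derivations. -/
theorem NDer.derivable {link : Setoid V} {lab : V → Label 𝒜} {R : Set Rule}
    (hpar : Rule.par ∈ R) (htens : Rule.tens ∈ R)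
    (hax : ∀ a n, (0 < n → ∃ x, lab x = Label.jump) → Derivable R
      (Formula.pos a ::ₘ Formula.neg a ::ₘ Multiset.replicate n (Formula.jump : Formula 𝒜)))
    (hone : (∃ x, lab x = Label.one) → ∀ n,
      Derivable R (Formula.one ::ₘ Multiset.replicate n (Formula.jump : Formula 𝒜)))
    (hwp : (∃ x, (lab x).IsModal) → Rule.wprom ∈ R) (hg : ∀ x, GoodAt lab link x)
    {S : Multiset (Occ V)} (h : NDer false link S) : (sverts S).Nodup →
    (∀ T ∈ S, T.WF fun x => (lab x).IsModal) → Derivable R (S.map (Occ.toFormula lab)) := by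
  induction h with
  | nil h => simp at h
  | mix h => simp at h
  | par A B S _ ih =>
    intro hn hwf
    rw [Multiset.map_cons]
    refine Derivable.par hpar _ _ _ ?_
    have := ih (by rwa [← sverts_par]) fun T hT => by
      rw [Multiset.mem_cons, Multiset.mem_cons] at hT
      rcases hT with rfl | rfl | hT
      · exact (hwf (Occ.par T B) (Multiset.mem_cons_self _ _)).1
      · exact (hwf (Occ.par A T) (Multiset.mem_cons_self _ _)).2
      · exact hwf T (Multiset.mem_cons_of_mem hT)
    simpa using this
  | tens A B S T _ _ ihS ihT =>
    intro hn hwf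
    rw [sverts_tens, Multiset.nodup_add] at hn
    rw [Multiset.map_cons, Multiset.map_add]
    refine Derivable.tens htens _ _ _ _ ?_ ?_
    · have := ihS hn.1 fun U hU => by
        rcases Multiset.mem_cons.1 hU with rfl | hU
        · exact (hwf (Occ.tens U B) (Multiset.mem_cons_self _ _)).1
        · exact hwf U (by simp [hU])
      simpa using this
    · have := ihT hn.2.1 fun U hU => by
        rcases Multiset.mem_cons.1 hU with rfl | hU
        · exact (hwf (Occ.tens A U) (Multiset.mem_cons_self _ _)).2
        · exact hwf U (by simp [hU])
      simpa using this
  | cls s c h =>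
    intro hn hwf
    rw [sverts_map_atom] at hn
    have hnm : ∀ x ∈ s, ¬ (lab x).IsModal := fun x hx =>
      hwf _ (Multiset.mem_map_of_mem Occ.atom hx)
    have hlink : ∀ x ∈ s, ∀ y ∈ s, link x y := fun x hx y hy =>
      link.trans (link.symm ((h x).1 hx)) ((h y).1 hy)
    have hmem : ∀ x ∈ s, ∀ y, link x y → y ∈ s := fun x hx y hy =>
      (h y).2 (link.trans ((h x).1 hx) hy)
    -- Every jump is linked to a literal or to a `1`, so the class has a root that decides which
    -- axiom it is.
    obtain ⟨r, hr, hrl⟩ : ∃ r ∈ s, (lab r).IsAtom ∨ lab r = Label.one := by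
      have hc := (h c).2 (link.refl c)
      rcases Label.cases_of_not_isModal (hnm c hc) (hg c).ne_bot with h1 | h1 | h1
      · exact ⟨c, hc, Or.inl h1⟩
      · exact ⟨c, hc, Or.inr h1⟩
      · obtain ⟨y, hy, hcy⟩ := (hg c).jump h1
        exact ⟨y, hmem c hc y hcy, hy⟩
    have hmap : ∀ t : Multiset V, (t.map Occ.atom).map (Occ.toFormula lab) =
        t.map fun x => (lab x).toFormula := fun t => by
      rw [Multiset.map_map]
      rfl
    rw [hmap]
    obtain ⟨s, rfl⟩ := Multiset.exists_cons_of_mem hr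
    have hrs := (Multiset.nodup_cons.1 hn).1
    by_cases hone' : lab r = Label.one
    · have hj : ∀ x ∈ s, lab x = Label.jump := fun x hx => (hg r).one hone' x
        (hlink r hr x (Multiset.mem_cons_of_mem hx)) fun h => hrs (h ▸ hx)
      rw [Multiset.map_cons, map_toFormula_jump hj, hone']
      exact hone ⟨r, hone'⟩ _
    · have hra := hrl.resolve_right hone'
      obtain ⟨y, ⟨hya, hry, hne⟩, huniq⟩ := (hg r).atom hra
      have hys : y ∈ s := (Multiset.mem_cons.1 (hmem r hr y hry)).resolve_left fun h => hne h.symm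
      obtain ⟨s, rfl⟩ := Multiset.exists_cons_of_mem hys
      have hns := (Multiset.nodup_cons.1 (Multiset.nodup_cons.1 hn).2).1
      -- A third literal is excluded by uniqueness of the partner, and a `1` because it may be
      -- linked to jumps only.
      have hj : ∀ x ∈ s, lab x = Label.jump := by
        intro x hx
        have hxs : x ∈ r ::ₘ y ::ₘ s := by simp [hx]
        have hrx : r ≠ x := fun h => hrs (by simp [h, hx])
        rcases Label.cases_of_not_isModal (hnm x hxs) (hg x).ne_bot with h1 | h1 | h1
        · exact absurd (huniq x ⟨h1, hlink r hr x hxs, hrx⟩) fun h => hns (h ▸ hx)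
        · have := (hg x).one h1 r (hlink x hxs r hr) hrx
          rw [this] at hra
          simp [Label.IsAtom] at hra
        · exact h1
      rw [Multiset.map_cons, Multiset.map_cons, map_toFormula_jump hj]
      -- Records that a nonempty tail comes from actual jump vertices; without such vertices the
      -- plain axiom suffices.
      have hex : 0 < s.card → ∃ x, lab x = Label.jump := fun h0 => by
        obtain ⟨x, hx⟩ := Multiset.card_pos_iff_exists_mem.1 h0
        exact ⟨x, hj x hx⟩
      obtain ⟨a, ⟨e1, e2⟩ | ⟨e1, e2⟩⟩ := (hg r).dual y hra hya hry hne
      · rw [e1, e2]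
        exact hax a _ hex
      · rw [e1, e2, Multiset.cons_swap]
        exact hax a _ hex
  | box L c h _ ih =>
    intro hn hwf
    rw [sverts_map_mod, Multiset.nodup_add] at hn
    have hwf' : ∀ q ∈ L, (lab q.1).IsModal ∧ q.2.WF fun x => (lab x).IsModal := fun q hq =>
      hwf _ (Multiset.mem_map_of_mem (fun q : V × Occ V => Occ.mod q.1 q.2) hq)
    have ih := ih hn.2.1 fun T hT => by
      obtain ⟨q, hq, rfl⟩ := Multiset.mem_map.1 hT
      exact (hwf' q hq).2
    obtain ⟨q, hq, hqc⟩ := Multiset.mem_map.1 ((h c).2 (link.refl c))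
    have hc : (lab c).IsModal := hqc ▸ (hwf' q hq).1
    obtain ⟨y, ⟨hyb, hcy⟩, huniq⟩ := ((hg c).modal hc).2
    obtain ⟨r, hr, rfl⟩ := Multiset.mem_map.1 ((h y).2 hcy)
    obtain ⟨L, rfl⟩ := Multiset.exists_cons_of_mem hr
    have hnr : r.1 ∉ L.map Prod.fst := by
      have := hn.1
      rw [Multiset.map_cons, Multiset.nodup_cons] at this
      exact this.1
    have hq : ∀ q ∈ L, lab q.1 = Label.quest := by
      intro q hq
      rcases (hwf' q (Multiset.mem_cons_of_mem hq)).1 with h1 | h1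
      -- A second `!` in the class would equal the first, which `hnr` forbids.
      · have := huniq q.1 ⟨h1, (h q.1).1 (Multiset.mem_map_of_mem _ (Multiset.mem_cons_of_mem hq))⟩
        exact absurd (Multiset.mem_map_of_mem Prod.fst hq) (this ▸ hnr)
      · exact h1
    have e : ((r ::ₘ L).map fun q => Occ.mod q.1 q.2).map (Occ.toFormula lab) =
        Formula.bang (r.2.toFormula lab) ::ₘ
          (L.map fun q => q.2.toFormula lab).map Formula.quest := by
      rw [Multiset.map_map, Multiset.map_map, Multiset.map_cons]
      congr 1
      · simp [Occ.toFormula, hyb]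
      · refine Multiset.map_congr rfl fun q hq' => ?_
        simp [Occ.toFormula, hq q hq']
    rw [e]
    refine Derivable.wprom (hwp ⟨r.1, Or.inl hyb⟩) _ _ ?_
    simpa using ih

/-- The setoid that agrees with `r` on `U` and with `r'` outside `U`. -/
def glue (U : V → Prop) (r r' : Setoid V) : Setoid V where
  r x y := (U x ∧ U y ∧ r x y) ∨ (¬ U x ∧ ¬ U y ∧ r' x y)
  iseqv := by
    refine ⟨fun x => ?_, fun {x y} h => ?_, fun {x y z} h h' => ?_⟩
    · by_cases hx : U x
      · exact Or.inl ⟨hx, hx, r.refl x⟩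
      · exact Or.inr ⟨hx, hx, r'.refl x⟩
    · exact h.imp (fun h => ⟨h.2.1, h.1, r.symm h.2.2⟩) (fun h => ⟨h.2.1, h.1, r'.symm h.2.2⟩)
    · rcases h with ⟨h1, h2, h3⟩ | ⟨h1, h2, h3⟩ <;> rcases h' with ⟨h1', h2', h3'⟩ | ⟨h1', h2', h3'⟩
      · exact Or.inl ⟨h1, h2', r.trans h3 h3'⟩
      · exact absurd h2 h1'
      · exact absurd h1' h2
      · exact Or.inr ⟨h1, h2', r'.trans h3 h3'⟩

theorem glue_left {U : V → Prop} {r r' : Setoid V} {x : V} (hx : U x)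
    (hU : ∀ y, r x y → U y) (y : V) : r x y ↔ glue U r r' x y := by
  constructor
  · exact fun h => Or.inl ⟨hx, hU y h, h⟩
  · rintro (⟨-, -, h⟩ | ⟨h, -⟩)
    · exact h
    · exact absurd hx h

theorem glue_right {U : V → Prop} {r r' : Setoid V} {x : V} (hx : ¬ U x)
    (hU : ∀ y, r' x y → ¬ U y) (y : V) : r' x y ↔ glue U r r' x y := by
  constructor
  · exact fun h => Or.inr ⟨hx, hU y h, h⟩
  · rintro (⟨h, -⟩ | ⟨-, -, h⟩)
    · exact absurd h hx
    · exact h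

theorem glue_top {U : V → Prop} {r' : Setoid V} {x y : V} (hx : U x) :
    glue U ⊤ r' x y ↔ U y := by
  constructor
  · rintro (⟨-, h, -⟩ | ⟨h, -⟩)
    · exact h
    · exact absurd hx h
  · exact fun h => Or.inl ⟨hx, h, trivial⟩

/-- Only the classes of the vertices of the sequent enter its derivation, so the linking may be
changed elsewhere. This permits gluing the linkings of several premises. -/
theorem NDer.congr {m : Bool} {link link' : Setoid V} {S : Multiset (Occ V)} (h : NDer m link S) :
    (∀ x ∈ sverts S, ∀ y, link x y ↔ link' x y) → NDer m link' S := by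
  induction h with
  | cls s c h =>
    intro hl
    rw [sverts_map_atom] at hl
    exact NDer.cls s c fun x => (h x).trans (hl c ((h c).2 (link.refl c)) x)
  | box L c h _ ih =>
    intro hl
    rw [sverts_map_mod] at hl
    exact NDer.box L c (fun x => (h x).trans (hl c (Multiset.mem_add.2
      (Or.inl ((h c).2 (link.refl c)))) x)) (ih fun x hx => hl x (Multiset.mem_add.2 (Or.inr hx)))
  | par A B S _ ih =>
    intro hl
    rw [sverts_par] at hl
    exact NDer.par _ _ _ (ih hl)
  | tens A B S T _ _ ihS ihT =>
    intro hl
    rw [sverts_tens] at hl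
    exact NDer.tens _ _ _ _ (ihS fun x hx => hl x (Multiset.mem_add.2 (Or.inl hx)))
      (ihT fun x hx => hl x (Multiset.mem_add.2 (Or.inr hx)))
  | nil h => exact fun _ => NDer.nil h
  | mix h S T _ _ ihS ihT =>
    intro hl
    rw [sverts_add] at hl
    exact NDer.mix h _ _ (ihS fun x hx => hl x (Multiset.mem_add.2 (Or.inl hx)))
      (ihT fun x hx => hl x (Multiset.mem_add.2 (Or.inr hx)))

/-! ### Recovering the shape of a located formula -/

section Inversion

variable {lab : V → Label 𝒜} {T : Occ V}

theorem Occ.eq_par_of_toFormula {A B : Formula 𝒜} (h : T.toFormula lab = Formula.par A B) :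
    ∃ T₁ T₂, T = Occ.par T₁ T₂ ∧ T₁.toFormula lab = A ∧ T₂.toFormula lab = B := by
  cases T with
  | atom x => simp only [toFormula] at h; cases e : lab x <;> simp [e, Label.toFormula] at h
  | par T₁ T₂ => simp only [toFormula, Formula.par.injEq] at h; exact ⟨T₁, T₂, rfl, h⟩
  | tens T₁ T₂ => simp [toFormula] at h
  | mod x A => simp only [toFormula] at h; cases e : lab x <;> simp [e] at h

theorem Occ.eq_tens_of_toFormula {A B : Formula 𝒜} (h : T.toFormula lab = Formula.tens A B) :
    ∃ T₁ T₂, T = Occ.tens T₁ T₂ ∧ T₁.toFormula lab = A ∧ T₂.toFormula lab = B := by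
  cases T with
  | atom x => simp only [toFormula] at h; cases e : lab x <;> simp [e, Label.toFormula] at h
  | tens T₁ T₂ => simp only [toFormula, Formula.tens.injEq] at h; exact ⟨T₁, T₂, rfl, h⟩
  | par T₁ T₂ => simp [toFormula] at h
  | mod x A => simp only [toFormula] at h; cases e : lab x <;> simp [e] at h

theorem Occ.eq_bang_of_toFormula {A : Formula 𝒜} (h : T.toFormula lab = Formula.bang A) :
    ∃ x T₁, T = Occ.mod x T₁ ∧ lab x = Label.bang ∧ T₁.toFormula lab = A := by
  cases T with
  | atom x => simp only [toFormula] at h; cases e : lab x <;> simp [e, Label.toFormula] at h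
  | tens T₁ T₂ => simp [toFormula] at h
  | par T₁ T₂ => simp [toFormula] at h
  | mod x B =>
    simp only [toFormula] at h
    cases e : lab x <;> simp [e] at h
    exact ⟨x, B, rfl, e, h⟩

/-- Well-formedness is needed because `Occ.toFormula` reads every modality not labelled `!` as `?`.
-/
theorem Occ.eq_quest_of_toFormula {A : Formula 𝒜} (h : T.toFormula lab = Formula.quest A)
    (hwf : T.WF fun x => (lab x).IsModal) :
    ∃ x T₁, T = Occ.mod x T₁ ∧ lab x = Label.quest ∧ T₁.toFormula lab = A := by
  cases T with
  | atom x => simp only [toFormula] at h; cases e : lab x <;> simp [e, Label.toFormula] at h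
  | tens T₁ T₂ => simp [toFormula] at h
  | par T₁ T₂ => simp [toFormula] at h
  | mod x B =>
    rcases hwf.1 with e | e
    · simp [toFormula, e] at h
    · simp only [toFormula, e, Formula.quest.injEq] at h
      exact ⟨x, B, rfl, e, h⟩

/-- `Label.toFormula` is injective only on non-modal labels, since `!`, `?` and the jump have the
same image. -/
theorem Occ.eq_atom_of_toFormula {l : Label 𝒜} (hl : ¬ l.IsModal)
    (h : T.toFormula lab = l.toFormula) (hwf : T.WF fun x => (lab x).IsModal) :
    ∃ x, T = Occ.atom x ∧ lab x = l := by
  cases T with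
  | atom x =>
    refine ⟨x, rfl, ?_⟩
    have hx : ¬ (lab x).IsModal := hwf
    simp only [toFormula] at h
    revert h hx hl
    cases lab x <;> cases l <;> simp [Label.toFormula, Label.IsModal]
  | tens T₁ T₂ => cases l <;> simp [toFormula, Label.toFormula] at h
  | par T₁ T₂ => cases l <;> simp [toFormula, Label.toFormula] at h
  | mod x B =>
    rcases hwf.1 with e | e <;> cases l <;> simp [toFormula, Label.toFormula, e] at h

end Inversion

/-! ### Reading a linking off a derivation -/

theorem exists_jumps {lab : V → Label 𝒜} {n : ℕ} {S : Multiset (Occ V)}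
    (h : S.map (Occ.toFormula lab) = Multiset.replicate n Formula.jump)
    (hwf : ∀ T ∈ S, T.WF fun x => (lab x).IsModal) :
    ∃ s : Multiset V, S = s.map Occ.atom ∧ ∀ x ∈ s, lab x = Label.jump := by
  have key : ∀ T ∈ S, ∃ x, T = Occ.atom x ∧ lab x = Label.jump := fun T hT =>
    Occ.eq_atom_of_toFormula (by simp [Label.IsModal])
      (Multiset.eq_of_mem_replicate (h ▸ Multiset.mem_map_of_mem _ hT)) (hwf T hT)
  obtain ⟨s, rfl⟩ := exists_map_atom fun T hT => (key T hT).imp fun x h => h.1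
  refine ⟨s, rfl, fun x hx => ?_⟩
  obtain ⟨y, hy, hl⟩ := key _ (Multiset.mem_map_of_mem Occ.atom hx)
  rw [Occ.atom.injEq] at hy
  rwa [hy]

/-- All of `s` becomes one class. Outside `s` the linking is discrete, an arbitrary choice that
later gluing overrides. -/
theorem exists_link_class (s : Multiset V) (c : V) (hc : c ∈ s) :
    ∃ link : Setoid V, NDer false link (s.map Occ.atom) ∧
      ∀ x ∈ sverts (s.map Occ.atom), ∀ y, link x y ↔ y ∈ s := by
  refine ⟨glue (fun x => x ∈ s) ⊤ ⊥, NDer.cls s c fun x => (glue_top hc).symm, fun x hx y => ?_⟩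
  rw [sverts_map_atom] at hx
  exact glue_top hx

theorem exists_link_ax {lab : V → Label 𝒜} {a : 𝒜} {n : ℕ} {S : Multiset (Occ V)}
    (h : S.map (Occ.toFormula lab) =
      Formula.pos a ::ₘ Formula.neg a ::ₘ Multiset.replicate n Formula.jump)
    (hwf : ∀ T ∈ S, T.WF fun x => (lab x).IsModal) (hn : (sverts S).Nodup) :
    ∃ link : Setoid V, NDer false link S ∧ ∀ x ∈ sverts S, GoodAt lab link x := by
  obtain ⟨T, S, rfl, hT, h₁⟩ := map_eq_cons_iff' h
  obtain ⟨U, S, rfl, hU, h₂⟩ := map_eq_cons_iff' h₁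
  obtain ⟨x, rfl, hx⟩ := Occ.eq_atom_of_toFormula (l := .pos a) (by simp [Label.IsModal]) hT
    (hwf _ (by simp))
  obtain ⟨y, rfl, hy⟩ := Occ.eq_atom_of_toFormula (l := .neg a) (by simp [Label.IsModal]) hU
    (hwf _ (by simp))
  obtain ⟨s, rfl, hs⟩ := exists_jumps h₂ fun T hT => hwf T (by simp [hT])
  have e : Occ.atom x ::ₘ Occ.atom y ::ₘ s.map Occ.atom = (x ::ₘ y ::ₘ s).map Occ.atom := by simp
  rw [e] at hn ⊢
  obtain ⟨link, hd, hl⟩ := exists_link_class (x ::ₘ y ::ₘ s) x (by simp)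
  have hxy : x ≠ y := by
    rintro rfl
    rw [hx] at hy
    simp at hy
  refine ⟨link, hd, fun z hz => ?_⟩
  have hl := hl z hz
  rw [sverts_map_atom, Multiset.mem_cons, Multiset.mem_cons] at hz
  have hlab : ∀ w, w ∈ x ::ₘ y ::ₘ s → (lab w).IsAtom → w = x ∨ w = y := by
    intro w hw hwa
    rw [Multiset.mem_cons, Multiset.mem_cons] at hw
    rcases hw with rfl | rfl | hw
    · exact Or.inl rfl
    · exact Or.inr rfl
    · rw [hs w hw] at hwa
      simp [Label.IsAtom] at hwa
  have hxa : (lab x).IsAtom := Or.inl ⟨a, hx⟩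
  have hya : (lab y).IsAtom := Or.inr ⟨a, hy⟩
  rcases hz with rfl | rfl | hz
  · refine ⟨by simp [hx], fun _ => ⟨y, ⟨hya, (hl y).2 (by simp), hxy⟩, fun w hw => ?_⟩,
      fun w _ hwa hzw hne => ?_, by simp [hx], by simp [hx], by simp [hx, Label.IsModal]⟩
    · exact (hlab w ((hl w).1 hw.2.1) hw.1).resolve_left fun h => hw.2.2 h.symm
    · obtain rfl := (hlab w ((hl w).1 hzw) hwa).resolve_left fun h => hne h.symm
      exact ⟨a, Or.inl ⟨hx, hy⟩⟩
  · refine ⟨by simp [hy], fun _ => ⟨x, ⟨hxa, (hl x).2 (by simp), hxy.symm⟩, fun w hw => ?_⟩,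
      fun w _ hwa hzw hne => ?_, by simp [hy], by simp [hy], by simp [hy, Label.IsModal]⟩
    · exact (hlab w ((hl w).1 hw.2.1) hw.1).resolve_right fun h => hw.2.2 h.symm
    · obtain rfl := (hlab w ((hl w).1 hzw) hwa).resolve_right fun h => hne h.symm
      exact ⟨a, Or.inr ⟨hy, hx⟩⟩
  · have hzj := hs z hz
    exact ⟨by simp [hzj], by simp [hzj, Label.IsAtom], by simp [hzj, Label.IsAtom], by simp [hzj],
      fun _ => ⟨x, Or.inl hxa, (hl x).2 (by simp)⟩, by simp [hzj, Label.IsModal]⟩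

theorem exists_link_one {lab : V → Label 𝒜} {n : ℕ} {S : Multiset (Occ V)}
    (h : S.map (Occ.toFormula lab) = Formula.one ::ₘ Multiset.replicate n Formula.jump)
    (hwf : ∀ T ∈ S, T.WF fun x => (lab x).IsModal) :
    ∃ link : Setoid V, NDer false link S ∧ ∀ x ∈ sverts S, GoodAt lab link x := by
  obtain ⟨T, S, rfl, hT, h₂⟩ := map_eq_cons_iff' h
  obtain ⟨x, rfl, hx⟩ := Occ.eq_atom_of_toFormula (l := .one) (by simp [Label.IsModal]) hT
    (hwf _ (by simp))
  obtain ⟨s, rfl, hs⟩ := exists_jumps h₂ fun T hT => hwf T (by simp [hT])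
  have e : Occ.atom x ::ₘ s.map Occ.atom = (x ::ₘ s).map Occ.atom := by simp
  rw [e]
  obtain ⟨link, hd, hl⟩ := exists_link_class (x ::ₘ s) x (by simp)
  refine ⟨link, hd, fun z hz => ?_⟩
  have hl := hl z hz
  rw [sverts_map_atom, Multiset.mem_cons] at hz
  rcases hz with rfl | hz
  · refine ⟨by simp [hx], by simp [hx, Label.IsAtom], by simp [hx, Label.IsAtom],
      fun _ w hw hne => hs w ?_, by simp [hx], by simp [hx, Label.IsModal]⟩
    exact (Multiset.mem_cons.1 ((hl w).1 hw)).resolve_left hne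
  · have hzj := hs z hz
    exact ⟨by simp [hzj], by simp [hzj, Label.IsAtom], by simp [hzj, Label.IsAtom], by simp [hzj],
      fun _ => ⟨x, Or.inr hx, (hl x).2 (by simp)⟩, by simp [hzj, Label.IsModal]⟩

/-- A derivation links the vertices of any located version of its conclusion. -/
theorem Derivable.exists_link {R : Set Rule} {lab : V → Label 𝒜} {Γ : Multiset (Formula 𝒜)}
    (h : Derivable R Γ) : ∀ S : Multiset (Occ V), S.map (Occ.toFormula lab) = Γ →
      (∀ T ∈ S, T.WF fun x => (lab x).IsModal) → (sverts S).Nodup →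
      ∃ link : Setoid V, NDer false link S ∧ ∀ x ∈ sverts S, GoodAt lab link x := by
  induction h with
  | ax _ a => exact fun S hS hwf hn => exists_link_ax (n := 0) hS hwf hn
  | axj _ a n => exact fun S hS hwf hn => exists_link_ax hS hwf hn
  | onej _ n => exact fun S hS hwf _ => exists_link_one hS hwf
  | par _ Γ A B _ ih =>
    intro S hS hwf hn
    obtain ⟨T, S, rfl, hT, rfl⟩ := map_eq_cons_iff' hS
    obtain ⟨T₁, T₂, rfl, rfl, rfl⟩ := Occ.eq_par_of_toFormula hT
    rw [sverts_par] at hn ⊢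
    obtain ⟨link, hd, hg⟩ := ih (T₁ ::ₘ T₂ ::ₘ S) (by simp) (fun T hT => by
      rw [Multiset.mem_cons, Multiset.mem_cons] at hT
      rcases hT with rfl | rfl | hT
      · exact (hwf (Occ.par T T₂) (Multiset.mem_cons_self _ _)).1
      · exact (hwf (Occ.par T₁ T) (Multiset.mem_cons_self _ _)).2
      · exact hwf T (Multiset.mem_cons_of_mem hT)) hn
    exact ⟨link, NDer.par _ _ _ hd, hg⟩
  | tens _ Γ Δ A B _ _ ihΓ ihΔ =>
    intro S hS hwf hn
    obtain ⟨T, S, rfl, hT, hS'⟩ := map_eq_cons_iff' hS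
    obtain ⟨S₁, S₂, rfl, rfl, rfl⟩ := map_eq_add_iff' hS'
    obtain ⟨T₁, T₂, rfl, rfl, rfl⟩ := Occ.eq_tens_of_toFormula hT
    rw [sverts_tens] at hn ⊢
    rw [Multiset.nodup_add] at hn
    obtain ⟨n1, n2, hdis⟩ := hn
    obtain ⟨r₁, hd₁, hg₁⟩ := ihΓ (T₁ ::ₘ S₁) (by simp) (fun T hT => by
      rcases Multiset.mem_cons.1 hT with rfl | hT
      · exact (hwf (Occ.tens T T₂) (Multiset.mem_cons_self _ _)).1
      · exact hwf T (by simp [hT])) n1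
    obtain ⟨r₂, hd₂, hg₂⟩ := ihΔ (T₂ ::ₘ S₂) (by simp) (fun T hT => by
      rcases Multiset.mem_cons.1 hT with rfl | hT
      · exact (hwf (Occ.tens T₁ T) (Multiset.mem_cons_self _ _)).2
      · exact hwf T (by simp [hT])) n2
    -- The two linkings are glued along the disjoint vertex sets of the premises, each of which is
    -- closed under its own linking.
    have e₁ : ∀ x ∈ sverts (T₁ ::ₘ S₁), ∀ y,
        r₁ x y ↔ glue (fun x => x ∈ sverts (T₁ ::ₘ S₁)) r₁ r₂ x y := fun x hx =>
      glue_left hx (hd₁.sverts_closed x hx)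
    have e₂ : ∀ x ∈ sverts (T₂ ::ₘ S₂), ∀ y,
        r₂ x y ↔ glue (fun x => x ∈ sverts (T₁ ::ₘ S₁)) r₁ r₂ x y := fun x hx =>
      glue_right (Multiset.disjoint_right.1 hdis hx) fun y hy =>
        Multiset.disjoint_right.1 hdis (hd₂.sverts_closed x hx y hy)
    refine ⟨_, NDer.tens _ _ _ _ (hd₁.congr e₁) (hd₂.congr e₂), fun x hx => ?_⟩
    rcases Multiset.mem_add.1 hx with hx | hx
    · exact (hg₁ x hx).congr (e₁ x hx)
    · exact (hg₂ x hx).congr (e₂ x hx)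
  | wprom _ Γ A _ ih =>
    intro S hS hwf hn
    obtain ⟨T, S, rfl, hT, hS'⟩ := map_eq_cons_iff' hS
    obtain ⟨z, T₁, rfl, hz, rfl⟩ := Occ.eq_bang_of_toFormula hT
    have hq : ∀ U ∈ S, ∃ x T₂, U = Occ.mod x T₂ ∧ lab x = Label.quest := by
      intro U hU
      obtain ⟨B, -, hB⟩ := Multiset.mem_map.1 (hS' ▸ Multiset.mem_map_of_mem _ hU)
      obtain ⟨x, T₂, h1, h2, -⟩ := Occ.eq_quest_of_toFormula hB.symm (hwf U (by simp [hU]))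
      exact ⟨x, T₂, h1, h2⟩
    obtain ⟨L, rfl⟩ := exists_map_mod fun U hU => (hq U hU).imp fun x h => h.imp fun _ h => h.1
    have hlab : ∀ q ∈ L, lab q.1 = Label.quest := by
      intro q hq'
      obtain ⟨x, T₂, h1, h2⟩ := hq _ (Multiset.mem_map_of_mem
        (fun q : V × Occ V => Occ.mod q.1 q.2) hq')
      rw [Occ.mod.injEq] at h1
      rwa [h1.1]
    have hΓ : L.map (fun q => q.2.toFormula lab) = Γ := by
      -- Injectivity of `?` lets the premise context be recovered from the promoted one.
      have hinj : Function.Injective (Formula.quest : Formula 𝒜 → Formula 𝒜) := fun A B h => by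
        simpa using h
      apply Multiset.map_injective hinj
      rw [← hS', Multiset.map_map, Multiset.map_map]
      refine Multiset.map_congr rfl fun q hq => ?_
      simp [Occ.toFormula, hlab q hq]
    have e : Occ.mod z T₁ ::ₘ (L.map fun q => Occ.mod q.1 q.2) =
        ((z, T₁) ::ₘ L).map fun q => Occ.mod q.1 q.2 := by simp
    rw [e] at hn hwf ⊢
    obtain ⟨K, hK⟩ : ∃ K, K = (z, T₁) ::ₘ L := ⟨_, rfl⟩
    rw [← hK] at hn hwf ⊢
    rw [sverts_map_mod] at hn ⊢
    obtain ⟨n1, n2, hdis⟩ := Multiset.nodup_add.1 hn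
    obtain ⟨r, hd, hg⟩ := ih (K.map Prod.snd) (by simp [hK, ← hΓ]) (fun T hT => by
      obtain ⟨q, hq, rfl⟩ := Multiset.mem_map.1 hT
      exact (hwf _ (Multiset.mem_map_of_mem (fun q : V × Occ V => Occ.mod q.1 q.2) hq)).2) n2
    have hzK : z ∈ K.map Prod.fst := by simp [hK]
    have e₁ : ∀ x ∈ K.map Prod.fst, ∀ y,
        glue (fun x => x ∈ K.map Prod.fst) ⊤ r x y ↔ y ∈ K.map Prod.fst := fun x hx y => glue_top hx
    have e₂ : ∀ x ∈ sverts (K.map Prod.snd), ∀ y,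
        r x y ↔ glue (fun x => x ∈ K.map Prod.fst) ⊤ r x y := fun x hx =>
      glue_right (Multiset.disjoint_right.1 hdis hx) fun y hy =>
        Multiset.disjoint_right.1 hdis (hd.sverts_closed x hx y hy)
    -- The modalities introduced by the promotion form one new class, and the contents keep the
    -- linking of the premise.
    refine ⟨_, NDer.box K z (fun x => (e₁ z hzK x).symm) (hd.congr e₂), fun x hx => ?_⟩
    rcases Multiset.mem_add.1 hx with hx | hx
    · have hKlab : ∀ w ∈ K.map Prod.fst, w = z ∨ lab w = Label.quest := by
        intro w hw
        rw [hK, Multiset.map_cons, Multiset.mem_cons] at hw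
        refine hw.imp id fun hw => ?_
        obtain ⟨q, hq, rfl⟩ := Multiset.mem_map.1 hw
        exact hlab q hq
      have hmod : ∀ w ∈ K.map Prod.fst, (lab w).IsModal := fun w hw =>
        (hKlab w hw).elim (fun h => Or.inl (h ▸ hz)) Or.inr
      have hxm := hmod x hx
      have hna : ¬ (lab x).IsAtom := fun h => Label.not_isModal_of_isAtom h hxm
      refine ⟨?_, fun h => absurd h hna, fun _ h => absurd h hna, ?_, ?_,
        fun _ => ⟨fun y hy => hmod y ((e₁ x hx y).1 hy), z, ⟨hz, (e₁ x hx z).2 hzK⟩,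
          fun w hw => (hKlab w ((e₁ x hx w).1 hw.2)).resolve_right (by simp [hw.1])⟩⟩
      · intro h
        simp [h, Label.IsModal] at hxm
      · intro h
        simp [h, Label.IsModal] at hxm
      · intro h
        simp [h, Label.IsModal] at hxm
    · exact (hg x hx).congr (e₂ x hx)

end Labels

/-! ## Relation webs of formulas -/

section Webs

variable {𝒜 : Type u} {V : Type v} {W : Type w}

namespace MixedGraph

theorem IsModalRelationWeb.single {l : Label 𝒜} (h : ¬ l.IsModal) :
    (single l).IsModalRelationWeb where
  nonempty := ⟨()⟩
  dir_trans _ _ _ h := h.elim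
  cograph _ _ _ _ h := h.elim
  series_parallel _ _ _ _ h := h.elim
  triangle_out _ _ _ h := h.elim
  triangle_in _ _ _ h := h.elim
  properly_labeled _ := ⟨fun ⟨_, h'⟩ => h'.elim, fun h' => absurd h' h⟩
  modal _ _ _ h := h.elim

theorem IsModalRelationWeb.par {G : MixedGraph 𝒜 V} {H : MixedGraph 𝒜 W}
    (hG : G.IsModalRelationWeb) (hH : H.IsModalRelationWeb) : (G.par H).IsModalRelationWeb where
  nonempty := hG.nonempty.map Sum.inl
  dir_trans := by
    rintro (x | x) (y | y) (z | z) h h'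
    exacts [hG.dir_trans x y z h h', h'.elim, h.elim, h.elim, h.elim, h.elim, h'.elim,
      hH.dir_trans x y z h h']
  cograph := by
    rintro (x | x) (y | y) (z | z) (t | t) h h' h'' <;>
      first
      | exact h.elim
      | exact h'.elim
      | exact h''.elim
      | exact hG.cograph x y z t h h' h''
      | exact hH.cograph x y z t h h' h''
  series_parallel := by
    rintro (x | x) (y | y) (z | z) (t | t) h h' h'' <;>
      first
      | exact h.elim
      | exact h'.elim
      | exact h''.elim
      | exact hG.series_parallel x y z t h h' h''
      | exact hH.series_parallel x y z t h h' h''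
  triangle_out := by
    rintro (x | x) (y | y) (z | z) h h' <;>
      first
      | exact h.elim
      | exact h'.elim
      | exact hG.triangle_out x y z h h'
      | exact hH.triangle_out x y z h h'
  triangle_in := by
    rintro (x | x) (y | y) (z | z) h h' <;>
      first
      | exact h.elim
      | exact h'.elim
      | exact hG.triangle_in x y z h h'
      | exact hH.triangle_in x y z h h'
  properly_labeled := by
    rintro (x | x)
    · refine Iff.trans ?_ (hG.properly_labeled x)
      exact ⟨by rintro ⟨y | y, h⟩; exacts [⟨y, h⟩, h.elim], fun ⟨y, h⟩ => ⟨.inl y, h⟩⟩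
    · refine Iff.trans ?_ (hH.properly_labeled x)
      exact ⟨by rintro ⟨y | y, h⟩; exacts [h.elim, ⟨y, h⟩], fun ⟨y, h⟩ => ⟨.inr y, h⟩⟩
  modal := by
    rintro (x | x) (y | y) (z | z) h h' <;>
      first
      | exact h.elim
      | exact h'.elim
      | exact (hG.modal x y z h h').imp_right (Or.imp_right (congrArg Sum.inl))
      | exact (hH.modal x y z h h').imp_right (Or.imp_right (congrArg Sum.inr))

theorem IsModalRelationWeb.tens {G : MixedGraph 𝒜 V} {H : MixedGraph 𝒜 W}
    (hG : G.IsModalRelationWeb) (hH : H.IsModalRelationWeb) : (G.tens H).IsModalRelationWeb where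
  nonempty := hG.nonempty.map Sum.inl
  dir_trans := by
    rintro (x | x) (y | y) (z | z) h h'
    exacts [hG.dir_trans x y z h h', h'.elim, h.elim, h.elim, h.elim, h.elim, h'.elim,
      hH.dir_trans x y z h h']
  cograph := by
    rintro (x | x) (y | y) (z | z) (t | t) h h' h'' <;>
      first
      | exact hG.cograph x y z t h h' h''
      | exact hH.cograph x y z t h h' h''
      | exact Or.inl trivial
      | exact Or.inr (Or.inl trivial)
      | exact Or.inr (Or.inr trivial)
  series_parallel := by
    rintro (x | x) (y | y) (z | z) (t | t) h h' h'' <;>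
      first
      | exact h.elim
      | exact h'.elim
      | exact h''.elim
      | exact hG.series_parallel x y z t h h' h''
      | exact hH.series_parallel x y z t h h' h''
  triangle_out := by
    rintro (x | x) (y | y) (z | z) h h' <;>
      first
      | exact hG.triangle_out x y z h h'
      | exact hH.triangle_out x y z h h'
      | exact h.elim
      | exact Or.inl trivial
  triangle_in := by
    rintro (x | x) (y | y) (z | z) h h' <;>
      first
      | exact hG.triangle_in x y z h h'
      | exact hH.triangle_in x y z h h'
      | exact h.elim
      | exact Or.inl trivial
  properly_labeled := by
    rintro (x | x)
    · refine Iff.trans ?_ (hG.properly_labeled x)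
      exact ⟨by rintro ⟨y | y, h⟩; exacts [⟨y, h⟩, h.elim], fun ⟨y, h⟩ => ⟨.inl y, h⟩⟩
    · refine Iff.trans ?_ (hH.properly_labeled x)
      exact ⟨by rintro ⟨y | y, h⟩; exacts [h.elim, ⟨y, h⟩], fun ⟨y, h⟩ => ⟨.inr y, h⟩⟩
  modal := by
    rintro (x | x) (y | y) (z | z) h h' <;>
      first
      | exact h.elim
      | exact h'.elim
      | exact (hG.modal x y z h h').imp_right (Or.imp_right (congrArg Sum.inl))
      | exact (hH.modal x y z h h').imp_right (Or.imp_right (congrArg Sum.inr))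

theorem IsModalRelationWeb.seq {l : Label 𝒜} (hl : l.IsModal) {H : MixedGraph 𝒜 W}
    (hH : H.IsModalRelationWeb) : ((MixedGraph.single l).seq H).IsModalRelationWeb where
  nonempty := ⟨.inl ()⟩
  dir_trans := by
    rintro (x | x) (y | y) (z | z) h h' <;>
      first
      | exact h.elim
      | exact h'.elim
      | exact trivial
      | exact hH.dir_trans x y z h h'
  cograph := by
    rintro (x | x) (y | y) (z | z) (t | t) h h' h'' <;>
      first
      | exact h.elim
      | exact h'.elim
      | exact h''.elim
      | exact hH.cograph x y z t h h' h''
  series_parallel := by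
    rintro (x | x) (y | y) (z | z) (t | t) h h' h'' <;>
      first
      | exact h.elim
      | exact h'.elim
      | exact h''.elim
      | exact Or.inl trivial
      | exact Or.inr (Or.inl trivial)
      | exact Or.inr (Or.inr (Or.inl trivial))
      | exact hH.series_parallel x y z t h h' h''
  triangle_out := by
    rintro (x | x) (y | y) (z | z) h h' <;>
      first
      | exact h.elim
      | exact h'.elim
      | exact hH.triangle_out x y z h h'
  triangle_in := by
    rintro (x | x) (y | y) (z | z) h h' <;>
      first
      | exact h.elim
      | exact h'.elim
      | exact Or.inr (Or.inl trivial)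
      | exact hH.triangle_in x y z h h'
  properly_labeled := by
    rintro (x | x)
    · obtain ⟨y⟩ := hH.nonempty
      exact ⟨fun _ => hl, fun _ => ⟨.inr y, trivial⟩⟩
    · refine Iff.trans ?_ (hH.properly_labeled x)
      exact ⟨by rintro ⟨y | y, h⟩; exacts [h.elim, ⟨y, h⟩], fun ⟨y, h⟩ => ⟨.inr y, h⟩⟩
  modal := by
    rintro (x | x) (y | y) (z | z) h h' <;>
      first
      | exact h.elim
      | exact h'.elim
      | exact Or.inr (Or.inr rfl)
      | exact Or.inl trivial
      | exact Or.inr (Or.inl trivial)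
      | exact (hH.modal x y z h h').imp_right (Or.imp_right (congrArg Sum.inr))

end MixedGraph

/-- Required to regard the web of a provable formula as an RGB-cograph. An `inl`/`inr` case split
handles each connective: a forbidden configuration that uses both sides lacks an edge or has an
extra one. -/
theorem Formula.web_isModalRelationWeb (F : Formula 𝒜) : F.web.IsModalRelationWeb := by
  induction F with
  | pos a => exact .single (by simp [Label.IsModal])
  | neg a => exact .single (by simp [Label.IsModal])
  | par A B ihA ihB => exact ihA.par ihB
  | tens A B ihA ihB => exact ihA.tens ihB
  | bang A ih => exact .seq (Or.inl rfl) ih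
  | quest A ih => exact .seq (Or.inr rfl) ih
  | bot => exact .single (by simp [Label.IsModal])
  | one => exact .single (by simp [Label.IsModal])
  | jump => exact .single (by simp [Label.IsModal])

/-- The formula `F` located at the vertices given by `f`. -/
def Formula.occ : (F : Formula 𝒜) → (F.Vertex → V) → Occ V
  | .pos _, f => .atom (f ())
  | .neg _, f => .atom (f ())
  | .par A B, f => .par (A.occ fun x => f (.inl x)) (B.occ fun x => f (.inr x))
  | .tens A B, f => .tens (A.occ fun x => f (.inl x)) (B.occ fun x => f (.inr x))
  | .bang A, f => .mod (f (.inl ())) (A.occ fun x => f (.inr x))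
  | .quest A, f => .mod (f (.inl ())) (A.occ fun x => f (.inr x))
  | .bot, f => .atom (f ())
  | .one, f => .atom (f ())
  | .jump, f => .atom (f ())

theorem Formula.occ_toFormula {lab : V → Label 𝒜} (F : Formula 𝒜) (f : F.Vertex → V)
    (h : ∀ x, lab (f x) = F.web.lab x) : (F.occ f).toFormula lab = F := by
  induction F with
  | pos a => exact congrArg Label.toFormula (h ())
  | neg a => exact congrArg Label.toFormula (h ())
  | par A B ihA ihB =>
    exact congrArg₂ Formula.par (ihA _ fun x => h (.inl x)) (ihB _ fun x => h (.inr x))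
  | tens A B ihA ihB =>
    exact congrArg₂ Formula.tens (ihA _ fun x => h (.inl x)) (ihB _ fun x => h (.inr x))
  | bang A ih =>
    have h1 : lab (f (.inl ())) = Label.bang := h (.inl ())
    simp only [occ, Occ.toFormula, h1]
    exact congrArg Formula.bang (ih _ fun x => h (.inr x))
  | quest A ih =>
    have h1 : lab (f (.inl ())) = Label.quest := h (.inl ())
    simp only [occ, Occ.toFormula, h1]
    exact congrArg Formula.quest (ih _ fun x => h (.inr x))
  | bot => exact congrArg Label.toFormula (h ())
  | one => exact congrArg Label.toFormula (h ())
  | jump => exact congrArg Label.toFormula (h ())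

theorem Formula.occ_wf {lab : V → Label 𝒜} (F : Formula 𝒜) (f : F.Vertex → V)
    (h : ∀ x, lab (f x) = F.web.lab x) : (F.occ f).WF fun x => (lab x).IsModal := by
  have key : ∀ {x : V} {l : Label 𝒜}, lab x = l → ¬ l.IsModal → ¬ (lab x).IsModal :=
    fun e hl => e ▸ hl
  induction F with
  | pos a => exact key (h ()) (by simp [web, MixedGraph.single, Label.IsModal])
  | neg a => exact key (h ()) (by simp [web, MixedGraph.single, Label.IsModal])
  | par A B ihA ihB => exact ⟨ihA _ fun x => h (.inl x), ihB _ fun x => h (.inr x)⟩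
  | tens A B ihA ihB => exact ⟨ihA _ fun x => h (.inl x), ihB _ fun x => h (.inr x)⟩
  | bang A ih => exact ⟨Or.inl (h (.inl ())), ih _ fun x => h (.inr x)⟩
  | quest A ih => exact ⟨Or.inr (h (.inl ())), ih _ fun x => h (.inr x)⟩
  | bot => exact key (h ()) (by simp [web, MixedGraph.single, Label.IsModal])
  | one => exact key (h ()) (by simp [web, MixedGraph.single, Label.IsModal])
  | jump => exact key (h ()) (by simp [web, MixedGraph.single, Label.IsModal])

theorem Formula.mem_occ_verts (F : Formula 𝒜) (f : F.Vertex → V) {x : V} :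
    x ∈ (F.occ f).verts ↔ ∃ y, f y = x := by
  have unit : ∀ g : Unit → V, x ∈ ({g ()} : Multiset V) ↔ ∃ y, g y = x := fun g =>
    ⟨fun h => ⟨(), (Multiset.mem_singleton.1 h).symm⟩, fun ⟨_, h⟩ => Multiset.mem_singleton.2 h.symm⟩
  have sum : ∀ {α β : Type} (g : α ⊕ β → V), (∃ y, g y = x) ↔
      (∃ a, g (.inl a) = x) ∨ ∃ b, g (.inr b) = x := fun g => Sum.exists
  induction F with
  | pos a => exact unit f
  | neg a => exact unit f
  | par A B ihA ihB =>
    exact (Multiset.mem_add.trans (or_congr (ihA _) (ihB _))).trans (sum f).symm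
  | tens A B ihA ihB =>
    exact (Multiset.mem_add.trans (or_congr (ihA _) (ihB _))).trans (sum f).symm
  | bang A ih =>
    exact (Multiset.mem_cons.trans (or_congr (Multiset.mem_singleton.symm.trans
      (unit fun y => f (.inl y))) (ih _))).trans (sum f).symm
  | quest A ih =>
    exact (Multiset.mem_cons.trans (or_congr (Multiset.mem_singleton.symm.trans
      (unit fun y => f (.inl y))) (ih _))).trans (sum f).symm
  | bot => exact unit f
  | one => exact unit f
  | jump => exact unit f

theorem inl_inr_ne {α β : Type} {f : α ⊕ β → V} (hf : f.Injective) {a : α} {b : β} :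
    f (.inl a) ≠ f (.inr b) := fun h => Sum.inl_ne_inr (hf h)

theorem Formula.occ_verts_nodup (F : Formula 𝒜) (f : F.Vertex → V) (hf : f.Injective) :
    (F.occ f).verts.Nodup := by
  have bin : ∀ (A B : Formula 𝒜) (g : A.Vertex ⊕ B.Vertex → V), g.Injective →
      (A.occ fun x => g (.inl x)).verts.Nodup → (B.occ fun x => g (.inr x)).verts.Nodup →
      ((A.occ fun x => g (.inl x)).verts + (B.occ fun x => g (.inr x)).verts).Nodup := by
    intro A B g hg hA hB
    rw [Multiset.nodup_add]
    refine ⟨hA, hB, Multiset.disjoint_left.2 fun {x} h h' => ?_⟩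
    obtain ⟨a, rfl⟩ := (mem_occ_verts _ _).1 h
    obtain ⟨b, hb⟩ := (mem_occ_verts _ _).1 h'
    exact inl_inr_ne hg hb.symm
  have un : ∀ (A : Formula 𝒜) (g : Unit ⊕ A.Vertex → V), g.Injective →
      (A.occ fun x => g (.inr x)).verts.Nodup →
      (g (.inl ()) ::ₘ (A.occ fun x => g (.inr x)).verts).Nodup := by
    intro A g hg hA
    rw [Multiset.nodup_cons]
    refine ⟨fun h => ?_, hA⟩
    obtain ⟨b, hb⟩ := (mem_occ_verts _ _).1 h
    exact inl_inr_ne hg hb.symm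
  have hl : ∀ {α β : Type} {g : α ⊕ β → V}, g.Injective → Function.Injective fun x => g (.inl x) :=
    fun hg => hg.comp Sum.inl_injective
  have hr : ∀ {α β : Type} {g : α ⊕ β → V}, g.Injective → Function.Injective fun x => g (.inr x) :=
    fun hg => hg.comp Sum.inr_injective
  induction F with
  | pos a => exact Multiset.nodup_singleton _
  | neg a => exact Multiset.nodup_singleton _
  | par A B ihA ihB => exact bin A B f hf (ihA _ (hl hf)) (ihB _ (hr hf))
  | tens A B ihA ihB => exact bin A B f hf (ihA _ (hl hf)) (ihB _ (hr hf))
  | bang A ih => exact un A f hf (ih _ (hr hf))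
  | quest A ih => exact un A f hf (ih _ (hr hf))
  | bot => exact Multiset.nodup_singleton _
  | one => exact Multiset.nodup_singleton _
  | jump => exact Multiset.nodup_singleton _

/-- Injectivity of `f` keeps the images of two subformulas disjoint, so the edges of the located
formula are exactly those of the web carried along `f`. -/
theorem Formula.occ_und (F : Formula 𝒜) (f : F.Vertex → V) (hf : f.Injective) :
    ∀ x y, (F.occ f).und (f x) (f y) ↔ F.web.und x y := by
  have hl : ∀ {α β : Type} {g : α ⊕ β → V}, g.Injective → Function.Injective fun x => g (.inl x) :=
    fun hg => hg.comp Sum.inl_injective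
  have hr : ∀ {α β : Type} {g : α ⊕ β → V}, g.Injective → Function.Injective fun x => g (.inr x) :=
    fun hg => hg.comp Sum.inr_injective
  have nl : ∀ (A : Formula 𝒜) {β : Type} (g : A.Vertex ⊕ β → V), g.Injective → ∀ b,
      g (.inr b) ∉ (A.occ fun x => g (.inl x)).verts := fun A β g hg b h => by
    obtain ⟨a, ha⟩ := (mem_occ_verts _ _).1 h
    exact inl_inr_ne hg ha
  have nr : ∀ (B : Formula 𝒜) {α : Type} (g : α ⊕ B.Vertex → V), g.Injective → ∀ a,
      g (.inl a) ∉ (B.occ fun x => g (.inr x)).verts := fun B α g hg b h => by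
    obtain ⟨a, ha⟩ := (mem_occ_verts _ _).1 h
    exact inl_inr_ne hg ha.symm
  have ml : ∀ (A : Formula 𝒜) {β : Type} (g : A.Vertex ⊕ β → V) a,
      g (.inl a) ∈ (A.occ fun x => g (.inl x)).verts := fun A β g a => (mem_occ_verts _ _).2 ⟨a, rfl⟩
  have mr : ∀ (B : Formula 𝒜) {α : Type} (g : α ⊕ B.Vertex → V) b,
      g (.inr b) ∈ (B.occ fun x => g (.inr x)).verts := fun B α g b => (mem_occ_verts _ _).2 ⟨b, rfl⟩
  have bin : ∀ (A B : Formula 𝒜) (g : A.Vertex ⊕ B.Vertex → V), g.Injective →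
      (∀ x y, (A.occ fun x => g (.inl x)).und (g (.inl x)) (g (.inl y)) ↔ A.web.und x y) →
      (∀ x y, (B.occ fun x => g (.inr x)).und (g (.inr x)) (g (.inr y)) ↔ B.web.und x y) →
      ∀ x y, (A.occ fun x => g (.inl x)).und (g x) (g y) ∨
        (B.occ fun x => g (.inr x)).und (g x) (g y) ↔ (A.web.par B.web).und x y := by
    rintro A B g hg hA hB (x | x) (y | y)
    · exact (or_iff_left fun h => nr B g hg _ (Occ.mem_of_und h).1).trans (hA x y)
    · exact iff_of_false (fun h => h.elim (fun h => nl A g hg _ (Occ.mem_of_und h).2)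
        fun h => nr B g hg _ (Occ.mem_of_und h).1) id
    · exact iff_of_false (fun h => h.elim (fun h => nl A g hg _ (Occ.mem_of_und h).1)
        fun h => nr B g hg _ (Occ.mem_of_und h).2) id
    · exact (or_iff_right fun h => nl A g hg _ (Occ.mem_of_und h).1).trans (hB x y)
  have un : ∀ (A : Formula 𝒜) (l : Label 𝒜) (g : Unit ⊕ A.Vertex → V), g.Injective →
      (∀ x y, (A.occ fun x => g (.inr x)).und (g (.inr x)) (g (.inr y)) ↔ A.web.und x y) →
      ∀ x y, (A.occ fun x => g (.inr x)).und (g x) (g y) ↔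
        ((MixedGraph.single l).seq A.web).und x y := by
    rintro A l g hg hA (x | x) (y | y)
    · exact iff_of_false (fun h => nr A g hg _ (Occ.mem_of_und h).1) id
    · exact iff_of_false (fun h => nr A g hg _ (Occ.mem_of_und h).1) id
    · exact iff_of_false (fun h => nr A g hg _ (Occ.mem_of_und h).2) id
    · exact hA x y
  induction F with
  | pos a => exact fun _ _ => Iff.rfl
  | neg a => exact fun _ _ => Iff.rfl
  | par A B ihA ihB => exact bin A B f hf (ihA _ (hl hf)) (ihB _ (hr hf))
  | tens A B ihA ihB =>
    have hb := bin A B f hf (ihA _ (hl hf)) (ihB _ (hr hf))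
    rintro (x | x) (y | y)
    · refine Iff.trans (or_iff_left ?_) (hb (.inl x) (.inl y))
      exact fun h => h.elim (fun h => nr B f hf _ h.2) fun h => nr B f hf _ h.1
    · exact iff_of_true (Or.inr (Or.inl ⟨ml A f x, mr B f y⟩)) trivial
    · exact iff_of_true (Or.inr (Or.inr ⟨mr B f x, ml A f y⟩)) trivial
    · refine Iff.trans (or_iff_left ?_) (hb (.inr x) (.inr y))
      exact fun h => h.elim (fun h => nl A f hf _ h.1) fun h => nl A f hf _ h.2
  | bang A ih => exact un A .bang f hf (ih _ (hr hf))
  | quest A ih => exact un A .quest f hf (ih _ (hr hf))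
  | bot => exact fun _ _ => Iff.rfl
  | one => exact fun _ _ => Iff.rfl
  | jump => exact fun _ _ => Iff.rfl

theorem Formula.occ_dir (F : Formula 𝒜) (f : F.Vertex → V) (hf : f.Injective) :
    ∀ x y, (F.occ f).dir (f x) (f y) ↔ F.web.dir x y := by
  have hl : ∀ {α β : Type} {g : α ⊕ β → V}, g.Injective → Function.Injective fun x => g (.inl x) :=
    fun hg => hg.comp Sum.inl_injective
  have hr : ∀ {α β : Type} {g : α ⊕ β → V}, g.Injective → Function.Injective fun x => g (.inr x) :=
    fun hg => hg.comp Sum.inr_injective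
  have nl : ∀ (A : Formula 𝒜) {β : Type} (g : A.Vertex ⊕ β → V), g.Injective → ∀ b,
      g (.inr b) ∉ (A.occ fun x => g (.inl x)).verts := fun A β g hg b h => by
    obtain ⟨a, ha⟩ := (mem_occ_verts _ _).1 h
    exact inl_inr_ne hg ha
  have nr : ∀ (B : Formula 𝒜) {α : Type} (g : α ⊕ B.Vertex → V), g.Injective → ∀ a,
      g (.inl a) ∉ (B.occ fun x => g (.inr x)).verts := fun B α g hg b h => by
    obtain ⟨a, ha⟩ := (mem_occ_verts _ _).1 h
    exact inl_inr_ne hg ha.symm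
  have mr : ∀ (B : Formula 𝒜) {α : Type} (g : α ⊕ B.Vertex → V) b,
      g (.inr b) ∈ (B.occ fun x => g (.inr x)).verts := fun B α g b => (mem_occ_verts _ _).2 ⟨b, rfl⟩
  have bin : ∀ (A B : Formula 𝒜) (g : A.Vertex ⊕ B.Vertex → V), g.Injective →
      (∀ x y, (A.occ fun x => g (.inl x)).dir (g (.inl x)) (g (.inl y)) ↔ A.web.dir x y) →
      (∀ x y, (B.occ fun x => g (.inr x)).dir (g (.inr x)) (g (.inr y)) ↔ B.web.dir x y) →
      ∀ x y, (A.occ fun x => g (.inl x)).dir (g x) (g y) ∨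
        (B.occ fun x => g (.inr x)).dir (g x) (g y) ↔ (A.web.par B.web).dir x y := by
    rintro A B g hg hA hB (x | x) (y | y)
    · exact (or_iff_left fun h => nr B g hg _ (Occ.mem_of_dir h).1).trans (hA x y)
    · exact iff_of_false (fun h => h.elim (fun h => nl A g hg _ (Occ.mem_of_dir h).2)
        fun h => nr B g hg _ (Occ.mem_of_dir h).1) id
    · exact iff_of_false (fun h => h.elim (fun h => nl A g hg _ (Occ.mem_of_dir h).1)
        fun h => nr B g hg _ (Occ.mem_of_dir h).2) id
    · exact (or_iff_right fun h => nl A g hg _ (Occ.mem_of_dir h).1).trans (hB x y)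
  have un : ∀ (A : Formula 𝒜) (l : Label 𝒜) (g : Unit ⊕ A.Vertex → V), g.Injective →
      (∀ x y, (A.occ fun x => g (.inr x)).dir (g (.inr x)) (g (.inr y)) ↔ A.web.dir x y) →
      ∀ x y, (g x = g (.inl ()) ∧ g y ∈ (A.occ fun x => g (.inr x)).verts) ∨
        (A.occ fun x => g (.inr x)).dir (g x) (g y) ↔
        ((MixedGraph.single l).seq A.web).dir x y := by
    rintro A l g hg hA (x | x) (y | y)
    · exact iff_of_false (fun h => h.elim (fun h => nr A g hg _ h.2)
        fun h => nr A g hg _ (Occ.mem_of_dir h).1) id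
    · exact iff_of_true (Or.inl ⟨rfl, mr A g y⟩) trivial
    · exact iff_of_false (fun h => h.elim (fun h => nr A g hg _ h.2)
        fun h => nr A g hg _ (Occ.mem_of_dir h).2) id
    · exact (or_iff_right fun h => inl_inr_ne hg h.1.symm).trans (hA x y)
  induction F with
  | pos a => exact fun _ _ => Iff.rfl
  | neg a => exact fun _ _ => Iff.rfl
  | par A B ihA ihB => exact bin A B f hf (ihA _ (hl hf)) (ihB _ (hr hf))
  | tens A B ihA ihB =>
    intro x y
    refine (bin A B f hf (ihA _ (hl hf)) (ihB _ (hr hf)) x y).trans ?_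
    rcases x with x | x <;> rcases y with y | y <;> exact Iff.rfl
  | bang A ih => exact un A .bang f hf (ih _ (hr hf))
  | quest A ih => exact un A .quest f hf (ih _ (hr hf))
  | bot => exact fun _ _ => Iff.rfl
  | one => exact fun _ _ => Iff.rfl
  | jump => exact fun _ _ => Iff.rfl

end Webs

/-! ## Correctness and provability -/

section Main

variable {𝒜 : Type u}

/-- A correct RGB-cograph on the web of `F` gives a located derivation without mix. -/
theorem RGBCograph.MELLCorrect.nder {V : Type v} {G : RGBCograph 𝒜 V} (h : G.MELLCorrect)
    {F : Formula 𝒜} (e : G.toMixedGraph.Iso F.web) :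
    NDer false G.link {F.occ e.toEquiv.symm} := by
  have hf : Function.Injective e.toEquiv.symm := e.toEquiv.symm.injective
  have hund : ∀ x y, (F.occ e.toEquiv.symm).und x y ↔ G.und x y := fun x y => by
    have := F.occ_und e.toEquiv.symm hf (e.toEquiv x) (e.toEquiv y)
    rw [e.toEquiv.symm_apply_apply, e.toEquiv.symm_apply_apply] at this
    exact this.trans (e.und_iff x y)
  have hdir : ∀ x y, (F.occ e.toEquiv.symm).dir x y ↔ G.dir x y := fun x y => by
    have := F.occ_dir e.toEquiv.symm hf (e.toEquiv x) (e.toEquiv y)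
    rw [e.toEquiv.symm_apply_apply, e.toEquiv.symm_apply_apply] at this
    exact this.trans (e.dir_iff x y)
  have hv : ∀ x, x ∈ (F.occ e.toEquiv.symm).verts := fun x =>
    (F.mem_occ_verts _).2 ⟨e.toEquiv x, e.toEquiv.symm_apply_apply x⟩
  have hlab : ∀ x, G.lab (e.toEquiv.symm x) = F.web.lab x := fun x => by
    have := e.lab_eq (e.toEquiv.symm x)
    rw [e.toEquiv.apply_symm_apply] at this
    exact this.symm
  have hwf := F.occ_wf (lab := G.lab) e.toEquiv.symm hlab
  have hn := F.occ_verts_nodup e.toEquiv.symm hf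
  obtain ⟨T, hT⟩ : ∃ T, T = F.occ e.toEquiv.symm := ⟨_, rfl⟩
  rw [← hT] at hund hdir hv hwf hn ⊢
  have hE : sedge {T} = fun x y => G.und x y ∨ G.dir x y := by
    ext x y
    simp [sedge, Occ.edge, hund, hdir]
  have hD : sdir {T} = G.dir := by
    ext x y
    simp [sdir, hdir]
  have hS : sverts {T} = T.verts := Multiset.singleton_bind _ _
  -- Acyclicity and the box-context condition are used here; connectedness is kept for the removal
  -- of mix.
  have hmix : NDer true G.link {T} := by
    refine NDer.of_acyclic_boxContext (fun x => (G.lab x).IsModal) (fun x y hxy => ?_) _ _ le_rfl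
      (by rwa [hS]) (fun x _ y _ => by rw [hS]; exact hv y) (by rw [hD]; exact h.boxContext)
      (fun m p hp => ?_) (by simpa using hwf)
    · exact ⟨fun hx => (G.link_modal x hx).1 y hxy,
        fun hy => (G.link_modal y hy).1 x (G.link.symm hxy)⟩
    · rw [hE] at hp
      obtain ⟨h0, h1, h2, ⟨b, hb⟩, h4, h5⟩ := hp
      -- The kind of step `i` is determined by the first kind and the parity of `i`; this supplies
      -- the Boolean sequence of `RGBCograph.Alternating`.
      refine h.acyclic m p ⟨h0, h1, h2, ⟨fun i => b ^^ i.bodd, fun i => ?_, hb⟩, h4,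
        fun i j hij hj hn' => ?_⟩
      · simp only [Nat.bodd_succ]
        cases b <;> cases i.bodd <;> rfl
      · obtain ⟨h6, h7⟩ := h5 i j hij hj hn'
        rintro (h | h | h)
        · exact h6 (Or.inl h)
        · exact h6 (Or.inr h)
        · exact h7 (Or.inr h)
  rcases hmix.mixfree (by rwa [hS]) with h0 | hd | ⟨x, -, y, -, hxy, hyx⟩
  · simp at h0
  · exact hd
  · obtain ⟨n, p, ⟨⟨c, hc, hstep⟩, h2, h3⟩, hp⟩ := h.connected x y
    have hc' : ∀ i, c i = (c 0 ^^ i.bodd) := by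
      intro i
      induction i with
      | zero => simp
      | succ i ih =>
        rw [hc, ih, Nat.bodd_succ]
        cases c 0 <;> cases i.bodd <;> rfl
    have hpath : CPath G.link (sedge {T}) n p := by
      rw [hE]
      refine ⟨⟨c 0, fun i hi => ?_⟩, h2, h3⟩
      rw [← hc']
      exact hstep i hi
    rcases hp with ⟨rfl, rfl⟩ | ⟨rfl, rfl⟩
    · exact absurd ⟨n, p, hpath, rfl, rfl⟩ hxy
    · exact absurd ⟨n, p, hpath, rfl, rfl⟩ hyx

theorem Provable.of_correct {X : Logic} {F : Formula 𝒜} {V : Type v} {G : RGBCograph 𝒜 V}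
    (e : G.toMixedGraph.Iso F.web) (h : G.Correct X) : Provable X.linear F := by
  have hM : G.MELLCorrect := by
    cases X
    · exact h.1
    · exact h.1
    · exact h
  have hlab : ∀ x, G.lab (e.toEquiv.symm x) = F.web.lab x := fun x => by
    have := e.lab_eq (e.toEquiv.symm x)
    rw [e.toEquiv.apply_symm_apply] at this
    exact this.symm
  have hder : Derivable X.linear (Multiset.map (Occ.toFormula G.lab) {F.occ e.toEquiv.symm}) := by
    refine NDer.derivable ?_ ?_ (fun a n hj => ?_) (fun ho n => ?_) (fun hm => ?_) G.goodAt
      (hM.nder e) ?_ ?_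
    · cases X <;> simp [Logic.linear]
    · cases X <;> simp [Logic.linear]
    · cases X
      -- An `MLL`-correct graph has no jump vertices, so its axiom classes are bare pairs and the
      -- rule `ax` applies.
      · obtain rfl : n = 0 := by
          by_contra hn
          obtain ⟨x, hx⟩ := hj (Nat.pos_of_ne_zero hn)
          have := h.2 x
          simp [hx, Label.IsAtom] at this
        exact Derivable.ax (by simp [Logic.linear]) a
      · exact Derivable.axj (by simp [Logic.linear]) a n
      · exact Derivable.axj (by simp [Logic.linear]) a n
    · cases X
      · obtain ⟨x, hx⟩ := ho
        have := h.2 x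
        simp [hx, Label.IsAtom] at this
      · exact Derivable.onej (by simp [Logic.linear]) n
      · exact Derivable.onej (by simp [Logic.linear]) n
    · obtain ⟨x, hx⟩ := hm
      cases X
      · exact absurd hx (Label.not_isModal_of_isAtom (h.2 x))
      · rcases h.2 x with h' | h' | h'
        · exact absurd hx (Label.not_isModal_of_isAtom h')
        · simp [h', Label.IsModal] at hx
        · simp [h', Label.IsModal] at hx
      · simp [Logic.linear]
    · rw [show sverts {F.occ e.toEquiv.symm} = _ from Multiset.singleton_bind _ _]
      exact F.occ_verts_nodup _ e.toEquiv.symm.injective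
    · simpa using F.occ_wf (lab := G.lab) e.toEquiv.symm hlab
  rw [Multiset.map_singleton, F.occ_toFormula (lab := G.lab) e.toEquiv.symm hlab] at hder
  exact hder

theorem Formula.forall_lab_iff (P : Label 𝒜 → Prop) (F : Formula 𝒜) :
    (∀ x, P (F.web.lab x)) ↔ match F with
      | .pos a => P (.pos a)
      | .neg a => P (.neg a)
      | .par A B => (∀ x, P (A.web.lab x)) ∧ ∀ x, P (B.web.lab x)
      | .tens A B => (∀ x, P (A.web.lab x)) ∧ ∀ x, P (B.web.lab x)
      | .bang A => P .bang ∧ ∀ x, P (A.web.lab x)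
      | .quest A => P .quest ∧ ∀ x, P (A.web.lab x)
      | .bot => P .bot
      | .one => P .one
      | .jump => P .jump := by
  have sum : ∀ {α β : Type} (Q : α ⊕ β → Prop), (∀ x, Q x) ↔
      (∀ a, Q (.inl a)) ∧ ∀ b, Q (.inr b) := fun Q => Sum.forall
  cases F with
  | pos a => exact ⟨fun h => h (), fun h _ => h⟩
  | neg a => exact ⟨fun h => h (), fun h _ => h⟩
  | par A B => exact sum fun x => P ((A.par B).web.lab x)
  | tens A B => exact sum fun x => P ((A.tens B).web.lab x)
  | bang A =>
    refine Iff.trans (sum fun x => P (A.bang.web.lab x)) ?_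
    exact and_congr_left fun _ => ⟨fun h => h (), fun h _ => h⟩
  | quest A =>
    refine Iff.trans (sum fun x => P (A.quest.web.lab x)) ?_
    exact and_congr_left fun _ => ⟨fun h => h (), fun h _ => h⟩
  | bot => exact ⟨fun h => h (), fun h _ => h⟩
  | one => exact ⟨fun h => h (), fun h _ => h⟩
  | jump => exact ⟨fun h => h (), fun h _ => h⟩

/-- All labels that occur in a derivable sequent are introduced by the rules in use. -/
theorem Derivable.forall_lab {R : Set Rule} {P : Label 𝒜 → Prop}
    (hatom : ∀ l : Label 𝒜, l.IsAtom → P l)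
    (hj : Rule.axj ∈ R ∨ Rule.onej ∈ R → P .jump) (h1 : Rule.onej ∈ R → P .one)
    (hw : Rule.wprom ∈ R → P .bang ∧ P .quest) {Γ : Multiset (Formula 𝒜)} (h : Derivable R Γ) :
    ∀ F ∈ Γ, ∀ x, P (F.web.lab x) := by
  have hpos : ∀ a, P (.pos a) := fun a => hatom _ (Or.inl ⟨a, rfl⟩)
  have hneg : ∀ a, P (.neg a) := fun a => hatom _ (Or.inr ⟨a, rfl⟩)
  induction h with
  | ax _ a =>
    intro F hF
    simp only [Multiset.insert_eq_cons, Multiset.mem_cons, Multiset.mem_singleton] at hF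
    rcases hF with rfl | rfl
    · exact (Formula.forall_lab_iff P _).2 (hpos a)
    · exact (Formula.forall_lab_iff P _).2 (hneg a)
  | axj h a n =>
    intro F hF
    rw [Multiset.mem_cons, Multiset.mem_cons] at hF
    rcases hF with rfl | rfl | hF
    · exact (Formula.forall_lab_iff P _).2 (hpos a)
    · exact (Formula.forall_lab_iff P _).2 (hneg a)
    · rw [Multiset.eq_of_mem_replicate hF]
      exact (Formula.forall_lab_iff P _).2 (hj (Or.inl h))
  | onej h n =>
    intro F hF
    rw [Multiset.mem_cons] at hF
    rcases hF with rfl | hF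
    · exact (Formula.forall_lab_iff P _).2 (h1 h)
    · rw [Multiset.eq_of_mem_replicate hF]
      exact (Formula.forall_lab_iff P _).2 (hj (Or.inr h))
  | par _ Γ A B _ ih =>
    intro F hF
    rcases Multiset.mem_cons.1 hF with rfl | hF
    · exact (Formula.forall_lab_iff P _).2 ⟨ih A (by simp), ih B (by simp)⟩
    · exact ih F (by simp [hF])
  | tens _ Γ Δ A B _ _ ihΓ ihΔ =>
    intro F hF
    rw [Multiset.mem_cons, Multiset.mem_add] at hF
    rcases hF with rfl | hF | hF
    · exact (Formula.forall_lab_iff P _).2 ⟨ihΓ A (by simp), ihΔ B (by simp)⟩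
    · exact ihΓ F (by simp [hF])
    · exact ihΔ F (by simp [hF])
  | wprom h Γ A _ ih =>
    intro F hF
    rw [Multiset.mem_cons] at hF
    rcases hF with rfl | hF
    · exact (Formula.forall_lab_iff P _).2 ⟨(hw h).1, ih A (by simp)⟩
    · obtain ⟨B, hB, rfl⟩ := Multiset.mem_map.1 hF
      exact (Formula.forall_lab_iff P _).2 ⟨(hw h).2, ih B (by simp [hB])⟩

/-- The formula is located on its own vertices by the identity. The linking comes from the
derivation, and correctness from the properties of mix-free located derivations. -/
theorem exists_correct_of_provable {X : Logic} {F : Formula 𝒜} (h : Provable X.linear F) :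
    ∃ G : RGBCograph 𝒜 F.Vertex, G.toMixedGraph = F.web ∧ G.Correct X := by
  obtain ⟨T, hT⟩ : ∃ T, T = F.occ (id : F.Vertex → F.Vertex) := ⟨_, rfl⟩
  have hund : ∀ x y, T.und x y ↔ F.web.und x y := hT ▸ F.occ_und id Function.injective_id
  have hdir : ∀ x y, T.dir x y ↔ F.web.dir x y := hT ▸ F.occ_dir id Function.injective_id
  have hv : ∀ x, x ∈ T.verts := fun x => hT ▸ (F.mem_occ_verts _).2 ⟨x, rfl⟩
  have hn : T.verts.Nodup := hT ▸ F.occ_verts_nodup id Function.injective_id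
  have hwf : T.WF fun x => (F.web.lab x).IsModal := hT ▸ F.occ_wf id fun _ => rfl
  have hF : T.toFormula F.web.lab = F := hT ▸ F.occ_toFormula id fun _ => rfl
  have hS : sverts {T} = T.verts := Multiset.singleton_bind _ _
  have hE : sedge {T} = fun x y => F.web.und x y ∨ F.web.dir x y := by
    ext x y
    simp [sedge, Occ.edge, hund, hdir]
  have hD : sdir {T} = F.web.dir := by
    ext x y
    simp [sdir, hdir]
  have hn' : (sverts {T}).Nodup := by rwa [hS]
  obtain ⟨link, hd, hg⟩ := h.exists_link (lab := F.web.lab) {T} (by simp [hF]) (by simpa using hwf)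
    hn'
  have hg : ∀ x, GoodAt F.web.lab link x := fun x => hg x (by rw [hS]; exact hv x)
  obtain ⟨G, hG, hGl⟩ : ∃ G : RGBCograph 𝒜 F.Vertex, G.toMixedGraph = F.web ∧ G.link = link :=
    ⟨{ toMixedGraph := F.web
       isModalRelationWeb := F.web_isModalRelationWeb
       link := link
       lab_ne_bot := fun x => (hg x).ne_bot
       link_atom := fun x => (hg x).atom
       link_dual := fun x => (hg x).dual
       link_one := fun x => (hg x).one
       link_jump := fun x => (hg x).jump
       link_modal := fun x => (hg x).modal }, rfl, rfl⟩
  subst hGl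
  have hM : G.MELLCorrect := by
    rw [← hG] at hE hD
    refine ⟨?_, fun x y => ?_, fun n p hp => ?_, ?_⟩
    · exact F.web_isModalRelationWeb.nonempty
    · have key : ∀ x y, Reach G.link {T} x y → ∃ n p, G.IsChordlessPath n p ∧ p 0 = x ∧ p n = y := by
        rintro x y ⟨n, p, hp, h0⟩
        rw [hE] at hp
        obtain ⟨⟨b, hb⟩, h2, h3⟩ := hp
        refine ⟨n, p, ⟨⟨fun i => b ^^ i.bodd, fun i => ?_, hb⟩, h2, h3⟩, h0⟩
        simp only [Nat.bodd_succ]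
        cases b <;> cases i.bodd <;> rfl
      rcases hd.connected hn' x (by rw [hS]; exact hv x) y (by rw [hS]; exact hv y) with h | h
      · obtain ⟨n, p, hp, h⟩ := key _ _ h
        exact ⟨n, p, hp, Or.inl h⟩
      · obtain ⟨n, p, hp, h⟩ := key _ _ h
        exact ⟨n, p, hp, Or.inr h⟩
    · refine hd.acyclic hn' n p ?_
      rw [hE]
      obtain ⟨h0, h1, h2, ⟨c, hc, hstep⟩, h4, h5⟩ := hp
      refine ⟨h0, h1, h2, ⟨c 0, fun i hi => ?_⟩, h4, fun i j hij hj hn => ?_⟩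
      · have hc' : ∀ i, c i = (c 0 ^^ i.bodd) := by
          intro i
          induction i with
          | zero => simp
          | succ i ih =>
            rw [hc, ih, Nat.bodd_succ]
            cases c 0 <;> cases i.bodd <;> rfl
        rw [← hc']
        exact hstep i hi
      · have h6 := h5 i j hij hj hn
        refine ⟨fun h => h6 (h.imp_right Or.inl), fun h => h6 (h.elim (fun h => Or.inl ?_)
          fun h => Or.inr (Or.inr h))⟩
        exact G.und_symm _ _ h
    · have := hd.boxContext
      rwa [hD] at this
  refine ⟨G, hG, ?_⟩
  -- The label restrictions of the three logics reflect which rules can introduce a label.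
  have hlab : ∀ (P : Label 𝒜 → Prop), (∀ l : Label 𝒜, l.IsAtom → P l) →
      (Rule.axj ∈ X.linear ∨ Rule.onej ∈ X.linear → P .jump) → (Rule.onej ∈ X.linear → P .one) →
      (Rule.wprom ∈ X.linear → P .bang ∧ P .quest) → ∀ x, P (G.lab x) := by
    intro P h1 h2 h3 h4
    rw [hG]
    exact h.forall_lab h1 h2 h3 h4 F (by simp)
  cases X
  · exact ⟨hM, hlab _ (fun l h => h) (by simp [Logic.linear]) (by simp [Logic.linear])
      (by simp [Logic.linear])⟩
  · exact ⟨hM, hlab (fun l => l.IsAtom ∨ l = Label.one ∨ l = Label.jump) (fun l h => Or.inl h)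
      (fun _ => Or.inr (Or.inr rfl)) (fun _ => Or.inr (Or.inl rfl)) (by simp [Logic.linear])⟩
  · exact hM

end Main

end LL

theorem mainTheorem3 {𝒜 : Type*} (X : LL.Logic) (F : LL.Formula 𝒜) :
    (∀ (V : Type*) (G : LL.RGBCograph 𝒜 V),
        Nonempty (G.toMixedGraph.Iso F.web) → G.Correct X → LL.Provable X.linear F) ∧
    (LL.Provable X.linear F ↔
        ∃ G : LL.RGBCograph 𝒜 F.Vertex, G.toMixedGraph = F.web ∧ G.Correct X) := by
  refine ⟨fun V G ⟨e⟩ h => LL.Provable.of_correct e h, LL.exists_correct_of_provable, ?_⟩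
  rintro ⟨G, hG, h⟩
  -- Equality of graphs is the special case of the identity isomorphism, so the converse reduces to
  -- the first part.
  exact LL.Provable.of_correct (hG ▸ ⟨Equiv.refl _, fun _ _ => Iff.rfl, fun _ _ => Iff.rfl,
    fun _ => rfl⟩) h
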